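/- **Notation.** For $\rho>0$ let $\mathbb T_\rho=\{z\in\mathbb C/\mathbb Z: |\mathrm{Im}\,z|<\rho\}$, and let $\mathrm{Per}(\mathbb T_\rho)$ be the space of $1$-periodic functions that are continuous on $\overline{\mathbb T}_\rho$, holomorphic in $\mathbb T_\rho$ and real on the real axis, with $\|g\|_\rho=\sup_{\mathbb T_\rho}|g|$. Let $\mathcal D(\gamma,\tau)=\{\theta\in\mathbb R: |q\theta-p|\ge\gamma|q|^{-\tau}\ \ \forall (p,q)\in\mathbb Z^2,\ q\ne0\}$ and $\Theta=[0,1]\cap\mathcal D(\gamma,\tau)$. **Constants.** Fix $\tau>1$, $0<\delta<\rho/2$, $0<\rho_\infty<\rho-2\delta$, $\rho<r\le\hat\rho$ and $\sigma>1$. For $0<\gamma<\frac12$, $g\in \mathrm{Per}(\mathbb T_{\hat\rho})$ and $\varepsilon\ge0$, let $c_{xx},c_{xxx}$ be any constants with $\varepsilon|g''|\le c_{xx}$ and $\varepsilon|g'''|\le c_{xxx}$ on $\mathbb T_r$ (they exist by Cauchy's estimates whenever $r<\hat\rho$), and put $E=\varepsilon\|g\|_\rho$, $a_1=\frac{\rho-\rho_\infty}{\rho-2\delta-\rho_\infty}$,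 $a_3=\rho/\delta$, $$c_R=\frac{\sqrt{\zeta(2,2^\tau)\Gamma(2\tau+1)}}{2(2\pi)^\tau},\qquad \hat c_R=\tau^{-2\tau}(2\tau+1)^{2\tau+1}c_R^2,\qquad \zeta(2,a)=\sum_{n\ge0}(n+a)^{-2},$$ $$C_1=(1+\sigma)(1+\sigma^2)\sigma c_R,\quad C_2=\sigma^3C_1,\quad C_3=C_1\gamma\delta^{\tau-1}+\tfrac12c_{xx}\sigma^2C_1^2,$$ $$L_0=2\sigma^3(\sigma-1)(1+\sigma^2),\quad L_1=\sigma\bigl(L_0+2\sigma(\sigma-1)(1+\sigma^2)\bigr),\quad L_2=c_RL_1\gamma\delta^{\tau+1}+\hat c_R(1+\sigma^2)\sigma,$$ $$L_3=(\sigma+1)L_2+(\sigma-1)c_R(1+\sigma^2)\sigma\gamma\delta^{\tau+1},\quad L_4=(\sigma-1)C_1\gamma\delta^{\tau+1}+\sigma L_3,$$ $$L_5=L_3\gamma\delta^{\tau-1}+\tfrac12c_{xxx}(\sigma-1)\sigma^2C_1^2\gamma\delta^{\tau+1}+c_{xx}\sigma C_1L_4,$$ $$L_6=\max\{C_3,(L_5+2C_3)a_1^{-\tau-1}\},\quad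 L_7=L_4+\sigma C_1,\quad L_8=L_0\gamma\delta^{\tau+1}+\sigma^2,$$ $$\kappa=\frac{C_3a_1^{2\tau}E}{\gamma^2\delta^{2\tau}},\qquad \mu=\frac{L_6a_1^{2\tau}E}{\gamma^2\delta^{2\tau}},\qquad \Sigma_{t,\lambda}=\sum_{j\ge0}t^{2^j-1}a_1^{-\lambda j},$$ $$C_4=\max\Bigl\{\frac{\sigma C_1\delta\,\Sigma_{\kappa,\tau}}{r-\rho},\ \frac{\sigma C_1\Sigma_{\kappa,\tau-1}}{\sigma-1},\ \frac{\sigma^3C_1\Sigma_{\kappa,\tau-1}}{\sigma-1},\ \frac{\sigma^2C_2\Sigma_{\kappa,\tau-1}}{\sigma-1}\Bigr\},$$ $$L_9=\frac{1}{\sigma-1}\max\Bigl\{L_7\Sigma_{\mu,-1}a_3^{2\tau+1}\rho,\ L_7\Sigma_{\mu,-2}a_3^{2\tau+2},\ L_8\Sigma_{\mu,\tau-1}\gamma(a_3\rho)^{\tau+1},\ 2\sigma C_1\Sigma_{\kappa,\tau-2}\gamma a_3^{\tau+2}\rho^\tau\Bigr\},$$ $$\mathfrak C_1^{\rm Lip}=\max\bigl\{(a_1a_3)^{2\tau}\rho^2L_6,\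 a_3^{\tau+1}C_4\gamma\rho^{\tau+1},\ L_9\bigr\}\ \text{ if }\mu<1\ (\infty\text{ otherwise}),\qquad \mathfrak C_2^{\rm Lip}=a_3^{\tau+1}L_8\Sigma_{\mu,\tau-1}.$$ **Statement.** Let $f_\alpha(x)=x+\alpha+\varepsilon g(x)$, $\alpha\in\mathbb R$, and suppose that $$\varepsilon\,\frac{\mathfrak C_1^{\rm Lip}\|g\|_\rho}{\gamma^2\rho^{2\tau+2}}<1 .$$ Then for every $\theta\in\Theta$ there are $\alpha_\infty(\theta)\in\mathbb R$ and a circle homeomorphism $h_\theta$ with $h_\theta-\mathrm{id}\in\mathrm{Per}(\mathbb T_{\rho_\infty})$ of zero average, with $h_\theta'\neq0$ in $\mathbb T_{\rho_\infty}$ and $h_\theta(\overline{\mathbb T}_{\rho_\infty})\subset\mathbb T_r$, such that $f_{\alpha_\infty(\theta)}(h_\theta(x))=h_\theta(x+\theta)$ on $\overline{\mathbb T}_{\rho_\infty}$. Moreover $$\mathrm{Leb}(\alpha_\infty(\Theta))\ \ge\ \Bigl(1-\varepsilon\frac{\mathfrak C_2^{\rm Lip}\|g\|_\rho}{\gamma\rho^{\tau+1}}\Bigr)\mathrm{Leb}(\Theta),\qquad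 \mathrm{Leb}(\Theta)\ge 1-2\gamma\frac{\zeta(\tau)}{\zeta(\tau+1)},$$ and, provided that the two factors on the right are not both negative, $$\mathrm{Leb}(\alpha_\infty(\Theta))\ \ge\ \Bigl(1-\varepsilon\frac{\mathfrak C_2^{\rm Lip}\|g\|_\rho}{\gamma\rho^{\tau+1}}\Bigr)\Bigl(1-2\gamma\frac{\zeta(\tau)}{\zeta(\tau+1)}\Bigr),$$ where $\zeta$ is the Riemann zeta function. In every case, both this product and $\mathrm{Leb}(\alpha_\infty(\Theta))$ are strictly larger than $$1-\gamma\Bigl(\frac{\mathfrak C_2^{\rm Lip}\rho^{\tau+1}}{\mathfrak C_1^{\rm Lip}}+2\frac{\zeta(\tau)}{\zeta(\tau+1)}\Bigr),$$ and the expression in parentheses is bounded by a constant $K>0$ that depends only on $\tau,\hat\rho,r,\rho,\delta,\rho_\infty,\sigma$ (not on $\gamma$, $g$, $\varepsilon$, $c_{xx}$, $c_{xxx}$), so that $\mathrm{Leb}(\alpha_\infty(\Theta))> 1-K\gamma$. -/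

import Mathlib

noncomputable section

namespace CircleKAM

/-- `g` represents an element of `Per(𝕋_ρ)`: a `1`-periodic continuous function on the closed strip
`|Im z| ≤ ρ`, holomorphic in the open strip and real on the real axis.
(Values of `g` outside the closed strip are irrelevant.) -/
structure IsPer (ρ : ℝ) (g : ℂ → ℂ) : Prop where
  continuousOn : ContinuousOn g {z : ℂ | |z.im| ≤ ρ}
  holomorphic : DifferentiableOn ℂ g {z : ℂ | |z.im| < ρ}
  periodic : ∀ z : ℂ, |z.im| ≤ ρ → g (z + 1) = g z
  real : ∀ x : ℝ, (g (x : ℂ)).im = 0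

/-- The analytic norm `‖g‖_ρ`, the supremum of `|g|` over the open strip `|Im z| < ρ`. -/
def stripNorm (ρ : ℝ) (g : ℂ → ℂ) : ℝ :=
  ⨆ z : {z : ℂ // |z.im| < ρ}, ‖g z.1‖

/-- `h` is (a lift of) an analytic circle map in the affine space `Dif(𝕋_ρ)`: `h - id` belongs to
`Per(𝕋_ρ)` and `h` induces a homeomorphism of the circle, that is, its real lift, which
satisfies `h (x + 1) = h x + 1`, is strictly increasing. -/
structure IsCircleMap (ρ : ℝ) (h : ℂ → ℂ) : Prop where
  sub_id : IsPer ρ (fun z => h z - z)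
  homeo : StrictMono (fun x : ℝ => (h (x : ℂ)).re)

/-- The set `𝒟(γ, τ)` of `(γ, τ)`-Diophantine numbers. -/
def Diophantine (γ τ : ℝ) : Set ℝ :=
  {θ : ℝ | ∀ p q : ℤ, q ≠ 0 → γ * |(q : ℝ)| ^ (-τ) ≤ |(q : ℝ) * θ - (p : ℝ)|}

/-- The Diophantine rotation numbers in `[0, 1]`. -/
def Theta (γ τ : ℝ) : Set ℝ := Set.Icc 0 1 ∩ Diophantine γ τ

/-- The family `f_α(z) = z + α + ε g(z)`. -/
def family (ε : ℝ) (g : ℂ → ℂ) (α : ℝ) (z : ℂ) : ℂ := z + (α : ℂ) + (ε : ℂ) * g z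

/-- The Riemann zeta function at a real argument. -/
def zetaReal (s : ℝ) : ℝ := (riemannZeta (s : ℂ)).re

/-- The Hurwitz zeta function `ζ(2, a) = ∑ₙ 1 / (n + a)²`. -/
def hurwitzTwo (a : ℝ) : ℝ := ∑' n : ℕ, 1 / ((n : ℝ) + a) ^ 2

/-- The constant `c_R` of the Rüssmann estimates. -/
def cR (τ : ℝ) : ℝ :=
  Real.sqrt (hurwitzTwo ((2 : ℝ) ^ τ) * Real.Gamma (2 * τ + 1)) / (2 * (2 * Real.pi) ^ τ)

/-- The constant `ĉ_R` of the Lipschitz version of the Rüssmann estimates. -/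
def cRhat (τ : ℝ) : ℝ := τ ^ (-(2 * τ)) * (2 * τ + 1) ^ (2 * τ + 1) * cR τ ^ 2

/-- The numerical input of the a-posteriori theorem for the measure of conjugations, for a family
`α ∈ ℝ ↦ f_α` and an approximate conjugacy `θ ∈ Θ ↦ (h_θ, α(θ))`. The parameter domain is
all of `ℝ`, so it has no boundary, and no distance to that boundary enters. -/
structure Data where
  /-- strip of the approximate conjugacies -/
  ρ : ℝ
  /-- first loss of strip -/
  δ : ℝ
  /-- strip of the final conjugacies -/
  ρinf : ℝ
  /-- Diophantine constant -/
  γ : ℝ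
  /-- Diophantine exponent -/
  τ : ℝ
  /-- bounds of the partial derivatives of `f_α(x)` -/
  cα : ℝ
  cxx : ℝ
  cxα : ℝ
  cαα : ℝ
  cxxx : ℝ
  cxxα : ℝ
  cxαα : ℝ
  cααα : ℝ
  /-- strict bounds of `‖h'‖`, `‖1/h'‖`, `‖h''‖` and `|1/⟨b⟩|` -/
  σ1 : ℝ
  σ2 : ℝ
  σ3 : ℝ
  σb : ℝ
  /-- strict bounds of the Lipschitz constants (in `θ`) of `h - id`, `h'` and `α` -/
  β0 : ℝ
  β1 : ℝ
  β2 : ℝ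
  /-- distance of `h_θ(𝕋_ρ)` to the boundary of the strip where `f_α` is controlled -/
  distStrip : ℝ
  /-- `‖h'‖`, `‖1/h'‖`, `‖h''‖` and `|1/⟨b⟩|`, uniformly in `θ` -/
  normDh : ℝ
  normInvDh : ℝ
  normDDh : ℝ
  invAvgB : ℝ
  /-- the Lipschitz constants (in `θ`) of `h - id`, `h'` and `α` -/
  lipH : ℝ
  lipDh : ℝ
  lipAlpha : ℝ
  /-- the norm `‖e‖_{Θ,ρ}` of the error of conjugacy, and its Lipschitz constant in `θ` -/
  err : ℝ
  lipErr : ℝ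

namespace Data

variable (d : Data)

def a1 : ℝ := (d.ρ - d.ρinf) / (d.ρ - 2 * d.δ - d.ρinf)

def a3 : ℝ := d.ρ / d.δ

def C1 : ℝ := (1 + d.σ1) * cR d.τ * (1 + d.cα * d.σb * d.σ2) * d.σ2

def C2 : ℝ :=
  d.σ1 * d.σ2 ^ 2 * d.cα * d.C1 + d.cxα * d.σ1 * d.σ2 * d.C1 * d.δ
    + d.cαα * d.σb * d.σ2 ^ 2 * d.γ * d.δ ^ (d.τ + 1)

def C3 : ℝ :=
  d.C1 * d.γ * d.δ ^ (d.τ - 1) + 1 / 2 * d.cxx * (d.σ1 * d.C1) ^ 2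
    + d.cxα * d.σb * d.σ1 * d.σ2 * d.C1 * d.γ * d.δ ^ d.τ
    + 1 / 2 * d.cαα * (d.σb * d.σ2) ^ 2 * d.γ ^ 2 * d.δ ^ (2 * d.τ)

def C0Lip : ℝ :=
  d.σb * d.σ2 ^ 2 * (d.β1 + d.σ3) * (1 + d.cα * d.σb * d.σ2)
    + d.σ2 ^ 2 * d.σb ^ 2 * (d.cαα * d.β2 + d.cxα * d.β0)

def C1Lip : ℝ :=
  d.σ2 * ((d.cαα * d.β2 + d.cxα * d.β0) * d.σb * d.σ2 + d.cα * d.C0Lip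
    + (1 + d.cα * d.σb * d.σ2) * d.σ2 * (d.β1 + d.σ3))

def C2Lip : ℝ :=
  cR d.τ * d.C1Lip * d.γ * d.δ ^ (d.τ + 1) + cRhat d.τ * (1 + d.cα * d.σb * d.σ2) * d.σ2

def C3Lip : ℝ :=
  d.C2Lip * (d.σ1 + 1)
    + d.β1 * cR d.τ * (1 + d.cα * d.σb * d.σ2) * d.σ2 * d.γ * d.δ ^ (d.τ + 1)

def C4Lip : ℝ := d.β1 * d.C1 * d.γ * d.δ ^ (d.τ + 1) + d.σ1 * d.C3Lip

def C5Lip : ℝ :=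
  d.C3Lip * d.γ * d.δ ^ (d.τ - 1)
    + 1 / 2 * (d.cxxα * d.β2 + d.cxxx * d.β0) * (d.σ1 * d.C1) ^ 2 * d.γ * d.δ ^ (d.τ + 1)
    + (d.cxαα * d.β2 + d.cxxα * d.β0) * d.σ1 * d.C1 * d.σb * d.σ2 * d.γ ^ 2
        * d.δ ^ (2 * d.τ + 1)
    + 1 / 2 * (d.cααα * d.β2 + d.cxαα * d.β0) * (d.σb * d.σ2) ^ 2 * d.γ ^ 3
        * d.δ ^ (3 * d.τ + 1)
    + d.C4Lip * (d.cxx * d.σ1 * d.C1 + d.cxα * d.σb * d.σ2 * d.γ * d.δ ^ d.τ)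
    + d.C0Lip * d.γ ^ 2 * d.δ ^ (2 * d.τ + 1)
        * (d.cxα * d.σ1 * d.C1 + d.cαα * d.σb * d.σ2 * d.γ * d.δ ^ d.τ)

def C6Lip : ℝ := max d.C3 ((d.C5Lip + 2 * d.C3) * d.a1 ^ (-d.τ - 1))

def C7Lip : ℝ := d.C4Lip + d.σ1 * d.C1

def C8Lip : ℝ := d.C0Lip * d.γ * d.δ ^ (d.τ + 1) + d.σb * d.σ2

/-- The weighted error `max {‖e‖, γ δ^{τ+1} Lip(e)}`. -/
def weightedErr : ℝ := max d.err (d.γ * d.δ ^ (d.τ + 1) * d.lipErr)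

def κ : ℝ := d.C3 * d.a1 ^ (2 * d.τ) / (d.γ ^ 2 * d.δ ^ (2 * d.τ)) * d.err

def μ : ℝ := d.C6Lip * d.a1 ^ (2 * d.τ) / (d.γ ^ 2 * d.δ ^ (2 * d.τ)) * d.weightedErr

/-- The sum `Σ_{t,l} = ∑ⱼ t^(2^j - 1) a₁^(-l j)`, convergent for `0 ≤ t < 1`. -/
def Sig (t l : ℝ) : ℝ := ∑' j : ℕ, t ^ (2 ^ j - 1) * d.a1 ^ (-l * (j : ℝ))

def C4 : ℝ :=
  max (d.σ1 * d.C1 * d.δ * d.Sig d.κ d.τ / d.distStrip)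
    (max (d.σ1 * d.C1 * d.Sig d.κ (d.τ - 1) / (d.σ1 - d.normDh))
      (max (d.σ2 ^ 2 * d.σ1 * d.C1 * d.Sig d.κ (d.τ - 1) / (d.σ2 - d.normInvDh))
        (d.σb ^ 2 * d.C2 * d.Sig d.κ (d.τ - 1) / (d.σb - d.invAvgB))))

/-- The last entry is the one that keeps the bound `‖h''‖ < σ₃` along the iteration. -/
def C9Lip : ℝ :=
  max (d.C7Lip * d.Sig d.μ (-1) * d.a3 ^ (2 * d.τ + 1) * d.ρ / (d.β0 - d.lipH))
    (max (d.C7Lip * d.Sig d.μ (-2) * d.a3 ^ (2 * d.τ + 2) / (d.β1 - d.lipDh))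
      (max (d.C8Lip * d.Sig d.μ (d.τ - 1) * d.γ * (d.a3 * d.ρ) ^ (d.τ + 1)
          / (d.β2 - d.lipAlpha))
        (2 * d.σ1 * d.C1 * d.Sig d.κ (d.τ - 2) * d.γ * d.a3 ^ (d.τ + 2) * d.ρ ^ d.τ
          / (d.σ3 - d.normDDh))))

/-- The constant `𝕮₁^Lip`. It is meant to be infinite when `μ ≥ 1`; this case needs no separate
clause, because the first entry multiplied by `weightedErr / (γ² ρ^{2τ+2})` equals `μ`, so
that the smallness condition `𝕮₁^Lip * weightedErr / (γ² ρ^{2τ+2}) < 1` entails `μ < 1`. -/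
def frakC1Lip : ℝ :=
  max ((d.a1 * d.a3) ^ (2 * d.τ) * d.ρ ^ 2 * d.C6Lip)
    (max (d.a3 ^ (d.τ + 1) * d.C4 * d.γ * d.ρ ^ (d.τ + 1)) d.C9Lip)

/-- The constant `𝕮₂^Lip`. -/
def frakC2Lip : ℝ := d.a3 ^ (d.τ + 1) * d.C8Lip * d.Sig d.μ (d.τ - 1)

end Data

/-- The input for `f_α(x) = x + α + ε g(x)` and the candidates `h_θ(x) = x`, `α(θ) = θ`, whose error
of conjugacy is `ε g`, with norm `E`, for every `θ`. Here `r` is the width of the strip on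
which `ε g''` and `ε g'''` are bounded by `c2` and `c3`, and `s > 1` is the uniform
parameter from which all bounds on the conjugacies are built. -/
def perturbativeData (r ρ δ ρinf γ τ s c2 c3 E : ℝ) : Data where
  ρ := ρ
  δ := δ
  ρinf := ρinf
  γ := γ
  τ := τ
  cα := 1
  cxx := c2
  cxα := 0
  cαα := 0
  cxxx := c3
  cxxα := 0
  cxαα := 0
  cααα := 0
  σ1 := s
  σ2 := s
  σ3 := s - 1
  σb := s
  β0 := s - 1
  β1 := s - 1
  β2 := s
  distStrip := r - ρ
  normDh := 1
  normInvDh := 1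
  normDDh := 0
  invAvgB := 1
  lipH := 0
  lipDh := 0
  lipAlpha := 1
  err := E
  lipErr := 0

end CircleKAM

end

/-! The identity conjugates `z + θ` to itself, and `f_θ ∘ id` misses the rotation by `ε g`. Newton's
method improves the pair `(h, α)`. Let `e = f_α ∘ h - h(· + θ)` and try `h + h' ξ`, `α + η`.
Differentiating `e` gives `(f_α' ∘ h) h' = h'(· + θ) + e'`, so up to `e' ξ` and a Taylor remainder
the new error vanishes when `h'(z + θ) (ξ(z + θ) - ξ(z)) = e(z) + η`. Dividing by `h'(z + θ)` leaves
a cohomological equation with constant coefficients, and `η` is chosen so that its right-hand side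
has mean zero (`Approx.exists_correction`).

The equation is solved by Fourier series. Cauchy-Schwarz between a weighted Bessel inequality and a
quadratic small divisor sum gives Rüssmann's bound `c_R M / (γ δ^τ)` on a strip narrower by `δ`
(`norm_cohom_le`). What remains of the error is quadratic (`Approx.step`), so losses of strip that
shrink geometrically are affordable and the scheme converges (`exists_isConj`). The result is
`ω`-close to the identity in `C¹`, where `ω` is of the order of `ε ‖g‖ / (γ δ^(τ+1))`.

For the measure, no regularity in `θ` is propagated through the iteration; exact conjugacies are
compared directly. If `k₁`, `k₂` conjugate `f_{α₁}`, `f_{α₂}` to the rotations by `θ₁`, `θ₂`, then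
`|θ₂ - θ₁ - (α₂ - α₁)| ≤ ω² / (1 - ω) |α₂ - α₁|` (`abs_rotation_sub_param_le`): the first order term
integrates to zero. So the inverse of `θ ↦ α∞(θ)` is Lipschitz with constant `1 + O(ω²)` on the
Cantor-like set `Θ`, which bounds the measure of the image from below
(`volume_real_le_of_abs_sub_le`). The smallness condition turns `2 ω²` into a quantity linear in
`ε`, dominated by `𝕮₂^Lip` (`second_order_le`).

The complement of `Θ` is covered by intervals around reduced fractions, and the totient Dirichlet
series gives `ζ(τ) / ζ(τ+1)`. -/

noncomputable section

namespace CircleKAM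

open MeasureTheory Filter Topology

/-! ### Periodic holomorphic functions on strips -/

/-- The open strip `|Im z| < ρ`. -/
def strip (ρ : ℝ) : Set ℂ := {z : ℂ | |z.im| < ρ}

lemma mem_strip {ρ : ℝ} {z : ℂ} : z ∈ strip ρ ↔ |z.im| < ρ := Iff.rfl

lemma isOpen_strip (ρ : ℝ) : IsOpen (strip ρ) :=
  isOpen_lt (continuous_abs.comp Complex.continuous_im) continuous_const

lemma strip_mono {ρ ρ' : ℝ} (h : ρ ≤ ρ') : strip ρ ⊆ strip ρ' := fun _ hz => lt_of_lt_of_le hz h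

lemma add_real_mem_strip {ρ : ℝ} {z : ℂ} (hz : z ∈ strip ρ) (t : ℝ) : z + (t : ℂ) ∈ strip ρ := by
  simpa [mem_strip] using hz

lemma ofReal_mem_strip {ρ : ℝ} (hρ : 0 < ρ) (x : ℝ) : (x : ℂ) ∈ strip ρ := by
  simpa [mem_strip] using hρ

lemma convex_strip (ρ : ℝ) : Convex ℝ (strip ρ) := by
  have : strip ρ = Complex.imLm ⁻¹' (Set.Ioo (-ρ) ρ) := by
    ext z; simp [mem_strip, abs_lt]
  rw [this]
  exact (convex_Ioo _ _).linear_preimage _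

/-- A `1`-periodic holomorphic function on the open strip of width `ρ`. -/
structure PerHol (ρ : ℝ) (v : ℂ → ℂ) : Prop where
  diff : DifferentiableOn ℂ v (strip ρ)
  per : ∀ z ∈ strip ρ, v (z + 1) = v z

lemma PerHol.mono {ρ ρ' : ℝ} {v : ℂ → ℂ} (hv : PerHol ρ' v) (h : ρ ≤ ρ') : PerHol ρ v :=
  ⟨hv.diff.mono (strip_mono h), fun z hz => hv.per z (strip_mono h hz)⟩

lemma PerHol.continuous_line {ρ y : ℝ} {v : ℂ → ℂ} (hv : PerHol ρ v) (hy : |y| < ρ) :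
    Continuous fun x : ℝ => v (x + y * Complex.I) := by
  refine hv.diff.continuousOn.comp_continuous (by fun_prop) fun x => ?_
  simpa [mem_strip] using hy

lemma PerHol.continuous_real {ρ : ℝ} {v : ℂ → ℂ} (hv : PerHol ρ v) (hρ : 0 < ρ) :
    Continuous fun x : ℝ => v x := by
  simpa using hv.continuous_line (y := 0) (by simpa using hρ)

/-- The mean over a period does not depend on the height in the strip. -/
lemma PerHol.integral_line {ρ y : ℝ} {v : ℂ → ℂ} (hv : PerHol ρ v) (hy : |y| < ρ) :
    ∫ x in (0 : ℝ)..1, v (x + y * Complex.I) = ∫ x in (0 : ℝ)..1, v x := by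
  have hsub : (Set.uIcc (0 : ℂ).re (1 + y * Complex.I : ℂ).re ×ℂ
      Set.uIcc (0 : ℂ).im (1 + y * Complex.I : ℂ).im) ⊆ strip ρ := by
    intro z hz
    have h2 := (Complex.mem_reProdIm.1 hz).2
    simp only [Complex.zero_im, Complex.add_im, Complex.one_im, Complex.mul_im, Complex.ofReal_re,
      Complex.I_im, mul_one, Complex.ofReal_im, Complex.I_re, mul_zero, add_zero, zero_add] at h2
    have := Set.abs_sub_left_of_mem_uIcc h2
    simp only [sub_zero] at this
    exact lt_of_le_of_lt this hy
  -- Cauchy's theorem on the rectangle with corners `0` and `1 + iy`; the two vertical sides cancel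
  -- by periodicity.
  have h := Complex.integral_boundary_rect_eq_zero_of_differentiableOn v 0 (1 + y * Complex.I)
    (hv.diff.mono hsub)
  have hside : ∫ t : ℝ in (0 : ℝ)..y, v (1 + t * Complex.I)
      = ∫ t : ℝ in (0 : ℝ)..y, v (t * Complex.I) := by
    refine intervalIntegral.integral_congr fun t ht => ?_
    have := Set.abs_sub_left_of_mem_uIcc ht
    simp only [sub_zero] at this
    have := hv.per (t * Complex.I) (by simpa [mem_strip] using lt_of_le_of_lt this hy)
    simpa [add_comm] using this
  simp [hside] at h
  linear_combination -h

/-- The `k`-th Fourier coefficient of the restriction of `v` to the real axis. -/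
def coeff (v : ℂ → ℂ) (k : ℤ) : ℂ :=
  ∫ x in (0 : ℝ)..1, v x * Complex.exp (-(2 * Real.pi * Complex.I * k * x))

/-- The character `z ↦ exp (2πikz)`. -/
def char (k : ℤ) (z : ℂ) : ℂ := Complex.exp (2 * Real.pi * Complex.I * k * z)

lemma char_add (k : ℤ) (z w : ℂ) : char k (z + w) = char k z * char k w := by
  rw [char, char, char, ← Complex.exp_add]; ring_nf

lemma char_one (k : ℤ) : char k 1 = 1 := by
  rw [char, mul_one, mul_comm]; exact Complex.exp_int_mul_two_pi_mul_I k

lemma norm_char (k : ℤ) (z : ℂ) : ‖char k z‖ = Real.exp (-(2 * Real.pi * k * z.im)) := by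
  rw [char, Complex.norm_exp]
  congr 1
  simp [Complex.mul_re, Complex.mul_im]

lemma norm_char_le (k : ℤ) {z : ℂ} {y : ℝ} (hz : |z.im| ≤ y) :
    ‖char k z‖ ≤ Real.exp (2 * Real.pi * |(k : ℝ)| * y) := by
  rw [norm_char, Real.exp_le_exp]
  have h1 : -((k : ℝ) * z.im) ≤ |(k : ℝ)| * y := by
    calc -((k : ℝ) * z.im) ≤ |(k : ℝ) * z.im| := neg_le_abs _
      _ = |(k : ℝ)| * |z.im| := abs_mul _ _
      _ ≤ _ := by gcongr
  nlinarith [Real.pi_pos]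

lemma differentiable_char (k : ℤ) : Differentiable ℂ (char k) := by
  unfold char; fun_prop

lemma coeff_zero (v : ℂ → ℂ) : coeff v 0 = ∫ x in (0 : ℝ)..1, v x := by simp [coeff]

lemma PerHol.mul_char {ρ : ℝ} {v : ℂ → ℂ} (hv : PerHol ρ v) (k : ℤ) :
    PerHol ρ fun z => v z * char k z :=
  ⟨hv.diff.mul (differentiable_char k).differentiableOn, fun z hz => by
    rw [hv.per z hz, char_add, char_one, mul_one]⟩

lemma coeff_eq (v : ℂ → ℂ) (k : ℤ) : coeff v k = ∫ x in (0 : ℝ)..1, v x * char (-k) x := by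
  simp only [coeff, char]
  refine intervalIntegral.integral_congr fun x _ => ?_
  push_cast; ring_nf

/-- Moving the line of integration to height `y` multiplies the `k`-th coefficient by `exp(-2πky)`.
This is the source of all exponential decay below. -/
lemma PerHol.coeff_line {ρ y : ℝ} {v : ℂ → ℂ} (hv : PerHol ρ v) (hy : |y| < ρ) (k : ℤ) :
    ∫ x in (0 : ℝ)..1, v (x + y * Complex.I) * char (-k) x
      = coeff v k * char k (y * Complex.I) := by
  rw [coeff_eq, ← (hv.mul_char (-k)).integral_line hy, ← intervalIntegral.integral_mul_const]
  refine intervalIntegral.integral_congr fun x _ => ?_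
  have : char (-k) (y * Complex.I) * char k (y * Complex.I) = 1 := by
    simp [char, ← Complex.exp_add]
  simp only [char_add]
  linear_combination (-v (x + y * Complex.I) * char (-k) x) * this

/-! ### Fourier series of a periodic function of a real variable. -/

section Line

variable {V : ℝ → ℂ}

local instance : Fact ((0 : ℝ) < 1) := ⟨one_pos⟩

/-- A continuous periodic function as a continuous function on the circle. -/
def circleMap (hV : Continuous V) (hp : Function.Periodic V 1) : C(AddCircle (1 : ℝ), ℂ) :=
  ⟨hp.lift, continuous_coinduced_dom.mpr hV⟩

lemma fourierCoeff_circleMap (hV : Continuous V) (hp : Function.Periodic V 1) (k : ℤ) :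
    fourierCoeff (circleMap hV hp) k = ∫ x in (0 : ℝ)..1, V x * char (-k) x := by
  rw [fourierCoeff_eq_intervalIntegral _ _ 0]
  simp only [one_div, inv_one, one_smul, zero_add]
  refine intervalIntegral.integral_congr fun x _ => ?_
  simp only [fourier_coe_apply, smul_eq_mul, char]
  rw [mul_comm]
  congr 1
  push_cast
  ring_nf

/-- Parseval on the circle, truncated to finitely many frequencies, with the `L²` norm bounded by
the sup norm. -/
lemma sum_sq_le_of_norm_le (hV : Continuous V) (hp : Function.Periodic V 1) {M : ℝ}
    (hM : ∀ x, ‖V x‖ ≤ M) (S : Finset ℤ) :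
    ∑ k ∈ S, ‖∫ x in (0 : ℝ)..1, V x * char (-k) x‖ ^ 2 ≤ M ^ 2 := by
  have hM0 : 0 ≤ M := (norm_nonneg _).trans (hM 0)
  set f := circleMap hV hp
  have h := hasSum_sq_fourierCoeff
    (ContinuousMap.toLp (E := ℂ) 2 AddCircle.haarAddCircle ℂ f)
  simp_rw [fourierCoeff_toLp, f, fourierCoeff_circleMap] at h
  refine (sum_le_hasSum S (fun _ _ => by positivity) h).trans ?_
  have hae := ContinuousMap.coeFn_toLp (E := ℂ) (p := 2) (𝕜 := ℂ) AddCircle.haarAddCircle f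
  rw [integral_congr_ae (g := fun t => ‖f t‖ ^ 2) (by
    filter_upwards [hae] with t ht; simp only [f] at ht ⊢; rw [ht])]
  have hb : ∀ t, ‖f t‖ ≤ M := by
    intro t
    induction t using QuotientAddGroup.induction_on with
    | H x => exact hM x
  calc ∫ t, ‖f t‖ ^ 2 ∂AddCircle.haarAddCircle
      ≤ ∫ _t : AddCircle (1 : ℝ), M ^ 2 ∂AddCircle.haarAddCircle := by
        refine integral_mono_of_nonneg (ae_of_all _ fun _ => by positivity) (integrable_const _)
          (ae_of_all _ fun t => ?_)
        exact pow_le_pow_left₀ (norm_nonneg _) (hb t) 2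
    _ = M ^ 2 := by simp

lemma hasSum_fourier_line (hV : Continuous V) (hp : Function.Periodic V 1)
    (hs : Summable fun k : ℤ => ∫ x in (0 : ℝ)..1, V x * char (-k) x) (x : ℝ) :
    HasSum (fun k : ℤ => (∫ x in (0 : ℝ)..1, V x * char (-k) x) * char k x) (V x) := by
  have h := has_pointwise_sum_fourier_series_of_summable (f := circleMap hV hp)
    (by simpa only [funext (fourierCoeff_circleMap hV hp)] using hs) x
  simp_rw [fourierCoeff_circleMap] at h
  have e : (fun k : ℤ => (∫ x in (0 : ℝ)..1, V x * char (-k) x) * char k x) = fun k : ℤ =>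
      (∫ x in (0 : ℝ)..1, V x * char (-k) x) • (fourier k) (x : AddCircle (1 : ℝ)) := by
    funext k; simp [char]
  rw [e]
  exact h

end Line

lemma PerHol.sum_coeff_le {ρ y M : ℝ} {v : ℂ → ℂ} (hv : PerHol ρ v) (hy : |y| < ρ)
    (hM : ∀ z ∈ strip ρ, ‖v z‖ ≤ M) (S : Finset ℤ) :
    ∑ k ∈ S, ‖coeff v k‖ ^ 2 * Real.exp (-(4 * Real.pi * k * y)) ≤ M ^ 2 := by
  have hmem : ∀ x : ℝ, (x + y * Complex.I : ℂ) ∈ strip ρ := fun x => by simpa [mem_strip] using hy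
  have h := sum_sq_le_of_norm_le (hv.continuous_line hy) (fun x => by
    have := hv.per _ (hmem x)
    simp only
    rw [← this]; push_cast; ring_nf) (fun x => hM _ (hmem x)) S
  refine le_trans (le_of_eq (Finset.sum_congr rfl fun k _ => ?_)) h
  rw [hv.coeff_line hy, norm_mul, mul_pow, norm_char, ← Real.exp_nat_mul]
  congr 2
  simp; ring

/-- The weighted Bessel inequality on a strip. -/
lemma PerHol.sum_coeff_abs_le {ρ M : ℝ} {v : ℂ → ℂ} (hρ : 0 < ρ) (hv : PerHol ρ v)
    (hM : ∀ z ∈ strip ρ, ‖v z‖ ≤ M) (S : Finset ℤ) :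
    ∑ k ∈ S, ‖coeff v k‖ ^ 2 * Real.exp (4 * Real.pi * |(k : ℝ)| * ρ) ≤ 2 * M ^ 2 := by
  -- Bessel is used at both heights `y` and `-y`, and `exp(4π|k|y)` is at most the sum of the two
  -- weights; hence the factor 2.
  have key : ∀ y ∈ Set.Ioo 0 ρ,
      ∑ k ∈ S, ‖coeff v k‖ ^ 2 * Real.exp (4 * Real.pi * |(k : ℝ)| * y) ≤ 2 * M ^ 2 := by
    intro y hy
    have h1 := hv.sum_coeff_le (y := y) (by rw [abs_of_pos hy.1]; exact hy.2) hM S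
    have h2 := hv.sum_coeff_le (y := -y) (by rw [abs_neg, abs_of_pos hy.1]; exact hy.2) hM S
    calc _ ≤ ∑ k ∈ S, (‖coeff v k‖ ^ 2 * Real.exp (-(4 * Real.pi * k * y))
            + ‖coeff v k‖ ^ 2 * Real.exp (-(4 * Real.pi * k * -y))) := by
          refine Finset.sum_le_sum fun k _ => ?_
          rw [← mul_add]
          gcongr
          rcases abs_cases (k : ℝ) with ⟨h, _⟩ | ⟨h, _⟩ <;> rw [h]
          · refine le_trans (le_of_eq ?_) (le_add_of_nonneg_left (Real.exp_nonneg _))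
            ring_nf
          · refine le_trans (le_of_eq ?_) (le_add_of_nonneg_right (Real.exp_nonneg _))
            ring_nf
      _ ≤ 2 * M ^ 2 := by rw [Finset.sum_add_distrib]; linarith
  -- A finite sum is continuous in `y`, so the bound reaches `y = ρ` although nothing is assumed
  -- about `v` on the boundary of the strip.
  have hlim : Tendsto (fun y : ℝ =>
      ∑ k ∈ S, ‖coeff v k‖ ^ 2 * Real.exp (4 * Real.pi * |(k : ℝ)| * y)) (𝓝[<] ρ)
      (𝓝 (∑ k ∈ S, ‖coeff v k‖ ^ 2 * Real.exp (4 * Real.pi * |(k : ℝ)| * ρ))) := by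
    refine (Continuous.tendsto ?_ ρ).mono_left nhdsWithin_le_nhds
    fun_prop
  exact le_of_tendsto hlim (Filter.mem_of_superset (Ioo_mem_nhdsLT hρ) key)

/-- A crude constant suffices here: the bound only serves summability. -/
lemma PerHol.norm_coeff_le {ρ M : ℝ} {v : ℂ → ℂ} (hρ : 0 < ρ) (hv : PerHol ρ v) (hM0 : 0 ≤ M)
    (hM : ∀ z ∈ strip ρ, ‖v z‖ ≤ M) (k : ℤ) :
    ‖coeff v k‖ ≤ 2 * M * Real.exp (-(2 * Real.pi * |(k : ℝ)| * ρ)) := by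
  have h := hv.sum_coeff_abs_le hρ hM {k}
  rw [Finset.sum_singleton] at h
  have h2 : (‖coeff v k‖ * Real.exp (2 * Real.pi * |(k : ℝ)| * ρ)) ^ 2 ≤ (2 * M) ^ 2 := by
    rw [mul_pow, ← Real.exp_nat_mul]
    have : ((2 : ℕ) : ℝ) * (2 * Real.pi * |(k : ℝ)| * ρ) = 4 * Real.pi * |(k : ℝ)| * ρ := by
      push_cast; ring
    rw [this]; nlinarith [sq_nonneg M]
  have h3 := abs_le_of_sq_le_sq h2 (by positivity)
  rw [Real.exp_neg, ← div_eq_mul_inv, le_div_iff₀ (Real.exp_pos _)]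
  exact (le_abs_self _).trans h3

lemma summable_exp_neg_abs {c : ℝ} (hc : 0 < c) :
    Summable fun k : ℤ => Real.exp (-(c * |(k : ℝ)|)) := by
  have h : Summable fun n : ℕ => Real.exp (-(c * n)) := by
    have := summable_geometric_of_lt_one (Real.exp_nonneg (-c)) (Real.exp_lt_one_iff.2 (by linarith))
    refine this.congr fun n => ?_
    rw [← Real.exp_nat_mul]; ring_nf
  refine Summable.of_nat_of_neg ?_ ?_
  · simpa using h
  · simpa using h

lemma PerHol.summable_coeff_mul_exp {ρ y M : ℝ} {v : ℂ → ℂ} (hv : PerHol ρ v) (hρ : 0 < ρ)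
    (hM : ∀ z ∈ strip ρ, ‖v z‖ ≤ M) (hy : y < ρ) :
    Summable fun k : ℤ => ‖coeff v k‖ * Real.exp (2 * Real.pi * |(k : ℝ)| * y) := by
  have hM0 : 0 ≤ M := (norm_nonneg _).trans (hM 0 (by simpa [mem_strip] using hρ))
  have hc : 0 < 2 * Real.pi * (ρ - y) := by have := Real.pi_pos; have := sub_pos.2 hy; positivity
  refine Summable.of_nonneg_of_le (fun k => by positivity) (fun k => ?_)
    ((summable_exp_neg_abs hc).mul_left (2 * M))
  calc _ ≤ (2 * M * Real.exp (-(2 * Real.pi * |(k : ℝ)| * ρ)))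
        * Real.exp (2 * Real.pi * |(k : ℝ)| * y) := by
        gcongr; exact hv.norm_coeff_le hρ hM0 hM k
    _ = _ := by rw [mul_assoc, ← Real.exp_add]; ring_nf

/-- Fourier expansion in the strip. -/
lemma PerHol.hasSum_coeff {ρ M : ℝ} {v : ℂ → ℂ} (hv : PerHol ρ v) (hρ : 0 < ρ)
    (hM : ∀ z ∈ strip ρ, ‖v z‖ ≤ M) {z : ℂ} (hz : z ∈ strip ρ) :
    HasSum (fun k : ℤ => coeff v k * char k z) (v z) := by
  have hy : |z.im| < ρ := hz
  have hmem : ∀ x : ℝ, (x + z.im * Complex.I : ℂ) ∈ strip ρ := fun x => by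
    simpa [mem_strip] using hy
  have h := hasSum_fourier_line (V := fun x : ℝ => v (x + z.im * Complex.I))
    (hv.continuous_line hy) (fun x => by
      have := hv.per _ (hmem x)
      simp only
      rw [← this]; push_cast; ring_nf) (by
    simp_rw [hv.coeff_line hy]
    refine Summable.of_norm_bounded (hv.summable_coeff_mul_exp hρ hM hy) fun k => ?_
    rw [norm_mul]
    gcongr
    exact norm_char_le k (by simp)) z.re
  simp_rw [hv.coeff_line hy] at h
  rw [Complex.re_add_im] at h
  convert h using 2 with k
  rw [mul_assoc, ← char_add, add_comm, Complex.re_add_im]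

/-! ### Small divisors -/

lemma summable_hurwitzTwo {a : ℝ} (ha : 0 < a) :
    Summable fun n : ℕ => 1 / ((n : ℝ) + a) ^ 2 := by
  have h := (Real.summable_one_div_nat_add_rpow a 2).2 one_lt_two
  refine h.congr fun n => ?_
  have : 0 ≤ (n : ℝ) + a := by positivity
  rw [abs_of_nonneg this]; norm_cast

lemma hurwitzTwo_pos {a : ℝ} (ha : 0 < a) : 0 < hurwitzTwo a :=
  (summable_hurwitzTwo ha).tsum_pos (fun _ => by positivity) 0 (by positivity)

/-- Sums of inverse squares over a separated set. -/
lemma sum_inv_sq_le_of_separated {K : Finset ℕ} {a : ℕ → ℝ} {c t : ℝ} (hc : 0 < c) (ht : 0 < t)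
    (hm : ∀ k ∈ K, c * t ≤ a k) (hs : ∀ k ∈ K, ∀ l ∈ K, k ≠ l → c ≤ |a k - a l|) :
    ∑ k ∈ K, 1 / a k ^ 2 ≤ hurwitzTwo t / c ^ 2 := by
  -- Cut the half-line from `c t` on into cells of length `c`. Separation puts at most one `a k` in
  -- each cell, so the sum is dominated by that of `1 / (c (j + t))²` over distinct `j`.
  set j : ℕ → ℕ := fun k => ⌊(a k - c * t) / c⌋₊
  have hj : ∀ k ∈ K, c * (j k + t) ≤ a k := by
    intro k hk
    have h0 : 0 ≤ (a k - c * t) / c := div_nonneg (sub_nonneg.2 (hm k hk)) hc.le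
    have := Nat.floor_le h0
    rw [le_div_iff₀ hc] at this
    simp only [j]; linarith
  have hlt : ∀ k, a k < c * (j k + t) + c := by
    intro k
    have := Nat.lt_floor_add_one ((a k - c * t) / c)
    rw [div_lt_iff₀ hc] at this
    simp only [j]; linarith
  have hinj : Set.InjOn j K := by
    intro k hk l hl hkl
    by_contra hne
    have h1 := hs k hk l hl hne
    have := hj k hk; have := hj l hl; have := hlt k; have := hlt l
    rw [hkl] at *
    have : |a k - a l| < c := abs_lt.2 ⟨by linarith, by linarith⟩
    linarith
  calc ∑ k ∈ K, 1 / a k ^ 2 ≤ ∑ k ∈ K, 1 / ((j k : ℝ) + t) ^ 2 / c ^ 2 := by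
        refine Finset.sum_le_sum fun k hk => ?_
        rw [div_div, ← mul_pow]
        have : 0 < ((j k : ℝ) + t) * c := by positivity
        gcongr
        have := hj k hk
        linarith
    _ = (∑ i ∈ K.image j, 1 / ((i : ℝ) + t) ^ 2) / c ^ 2 := by
        rw [Finset.sum_image hinj, Finset.sum_div]
    _ ≤ _ := by
        gcongr
        exact (summable_hurwitzTwo ht).sum_le_tsum _ (fun _ _ => by positivity)

/-- The distance of `kθ` to the nearest integer. -/
def intDist (θ : ℝ) (k : ℕ) : ℝ := |k * θ - round (k * θ)|

lemma le_abs_int_mul_sub {γ τ θ : ℝ} (hγ : 0 ≤ γ) (hτ : 0 ≤ τ) (hθ : θ ∈ Diophantine γ τ)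
    {p q : ℤ} {N : ℝ} (hq : q ≠ 0) (hN : |(q : ℝ)| ≤ N) :
    γ * N ^ (-τ) ≤ |(q : ℝ) * θ - p| := by
  refine le_trans ?_ (hθ p q hq)
  have : 0 < |(q : ℝ)| := by positivity
  exact mul_le_mul_of_nonneg_left (Real.rpow_le_rpow_of_nonpos this hN (by linarith)) hγ

/-- For `k ≠ l` in `[1, n]` both `k - l` and `k + l` are nonzero integers of size at most `2n`.
Since `||A| - |B||` equals `|A - B|` or `|A + B|`, the distances to the integers are separated by `γ
(2n)^(-τ)`. Each is at least `γ n^(-τ)`, which is `2^τ` separations; hence the `ζ(2, 2^τ)` in `c_R`.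
-/
lemma sum_intDist_le {γ τ θ : ℝ} (hγ : 0 < γ) (hτ : 0 ≤ τ) (hθ : θ ∈ Diophantine γ τ) (n : ℕ) :
    ∑ k ∈ Finset.Icc 1 n, 1 / intDist θ k ^ 2
      ≤ hurwitzTwo ((2 : ℝ) ^ τ) * (2 * n) ^ (2 * τ) / γ ^ 2 := by
  rcases Nat.eq_zero_or_pos n with rfl | hn
  · simp only [zero_lt_one, Finset.Icc_eq_empty_of_lt, Finset.sum_empty]
    have := (hurwitzTwo_pos (a := (2 : ℝ) ^ τ) (by positivity)).le
    positivity
  have hn' : (0 : ℝ) < n := by exact_mod_cast hn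
  have h := sum_inv_sq_le_of_separated (K := Finset.Icc 1 n) (a := intDist θ)
    (c := γ * (2 * n) ^ (-τ)) (t := (2 : ℝ) ^ τ) (by positivity) (by positivity) ?_ ?_
  · refine h.trans (le_of_eq ?_)
    rw [mul_pow, ← Real.rpow_natCast ((2 * (n : ℝ)) ^ (-τ)), ← Real.rpow_mul (by positivity),
      show -τ * (2 : ℕ) = -(2 * τ) by push_cast; ring, Real.rpow_neg (by positivity)]
    field_simp
  · intro k hk
    rw [Finset.mem_Icc] at hk
    have e : γ * (2 * (n : ℝ)) ^ (-τ) * (2 : ℝ) ^ τ = γ * (n : ℝ) ^ (-τ) := by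
      rw [Real.mul_rpow (by positivity) (by positivity), Real.rpow_neg (by positivity : (0:ℝ) ≤ 2)]
      field_simp
    rw [e]
    have := le_abs_int_mul_sub hγ.le hτ hθ (p := round (k * θ)) (q := k) (N := n)
      (by omega) (by simpa using hk.2)
    simpa [intDist] using this
  · intro k hk l hl hkl
    rw [Finset.mem_Icc] at hk hl
    have hsum := le_abs_int_mul_sub hγ.le hτ hθ (p := round (k * θ) + round (l * θ))
      (q := k + l) (N := 2 * n) (by omega) (by
        push_cast
        rw [abs_of_nonneg (by positivity)]
        have : (k : ℝ) ≤ n := by exact_mod_cast hk.2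
        have : (l : ℝ) ≤ n := by exact_mod_cast hl.2
        linarith)
    have hdiff := le_abs_int_mul_sub hγ.le hτ hθ (p := round (k * θ) - round (l * θ))
      (q := k - l) (N := 2 * n) (by omega) (by
        push_cast
        have : (k : ℝ) ≤ n := by exact_mod_cast hk.2
        have : (l : ℝ) ≤ n := by exact_mod_cast hl.2
        have : (0 : ℝ) ≤ k := by positivity
        have : (0 : ℝ) ≤ l := by positivity
        rw [abs_le]; constructor <;> linarith)
    push_cast at hsum hdiff
    set A := (k : ℝ) * θ - round ((k : ℝ) * θ) with hA
    set B := (l : ℝ) * θ - round ((l : ℝ) * θ) with hB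
    have e1 : ((k : ℝ) + l) * θ - (round ((k : ℝ) * θ) + round ((l : ℝ) * θ)) = A + B := by
      rw [hA, hB]; ring
    have e2 : ((k : ℝ) - l) * θ - (round ((k : ℝ) * θ) - round ((l : ℝ) * θ)) = A - B := by
      rw [hA, hB]; ring
    rw [e1] at hsum
    rw [e2] at hdiff
    change _ ≤ abs (abs A - abs B)
    rcases abs_cases A with ⟨h1, _⟩ | ⟨h1, _⟩ <;> rcases abs_cases B with ⟨h2, _⟩ | ⟨h2, _⟩ <;>
      rw [h1, h2]
    · exact hdiff
    · simpa using hsum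
    · rw [show -A - B = -(A + B) by ring, abs_neg]; exact hsum
    · rw [show -A - -B = -(A - B) by ring, abs_neg]; exact hdiff

/-- Summation by parts against an exponential weight. -/
lemma sum_mul_exp_le {a : ℕ → ℝ} {B p c : ℝ} (ha : ∀ k, 0 ≤ a k) (hc : 0 < c) (hp : 0 ≤ p)
    (hB : 0 ≤ B)
    (h : ∀ n : ℕ, ∑ k ∈ Finset.Icc 1 n, a k ≤ B * (n : ℝ) ^ p) (N : ℕ) :
    ∑ k ∈ Finset.Icc 1 N, a k * Real.exp (-(c * k)) ≤ B * Real.Gamma (p + 1) / c ^ p := by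
  -- Writing `exp(-ck)` as the integral of `c exp(-ct)` over `t > k` replaces the weighted sum by an
  -- integral of the partial sums of `a`, to which `h` applies; the Gamma integral remains.
  have hexp : ∀ k : ℕ, Real.exp (-(c * k))
      = ∫ t in Set.Ioi (0 : ℝ), Set.indicator (Set.Ioi (k : ℝ)) (fun t => c * Real.exp (-c * t)) t := by
    intro k
    rw [setIntegral_indicator measurableSet_Ioi,
      Set.inter_eq_self_of_subset_right (Set.Ioi_subset_Ioi (by positivity)),
      integral_const_mul, integral_exp_mul_Ioi (by linarith)]
    rw [neg_mul]; field_simp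
  have hint0 : IntegrableOn (fun t => c * Real.exp (-c * t)) (Set.Ioi (0 : ℝ)) :=
    (integrableOn_exp_mul_Ioi (by linarith) 0).const_mul c
  have hint : ∀ k : ℕ, IntegrableOn
      (Set.indicator (Set.Ioi (k : ℝ)) (fun t => c * Real.exp (-c * t))) (Set.Ioi (0 : ℝ)) :=
    fun k => hint0.indicator measurableSet_Ioi
  have hG : ∫ t in Set.Ioi (0 : ℝ), t ^ p * Real.exp (-(c * t))
      = (1 / c) ^ (p + 1) * Real.Gamma (p + 1) := by
    have := Real.integral_rpow_mul_exp_neg_mul_Ioi (a := p + 1) (by linarith) hc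
    simpa using this
  have hGint : IntegrableOn (fun t : ℝ => t ^ p * Real.exp (-c * t)) (Set.Ioi 0) := by
    have := integrableOn_rpow_mul_exp_neg_mul_rpow (p := 1) (s := p) (b := c)
      (by linarith) one_pos hc
    simpa using this
  calc ∑ k ∈ Finset.Icc 1 N, a k * Real.exp (-(c * k))
      = ∫ t in Set.Ioi (0 : ℝ), ∑ k ∈ Finset.Icc 1 N,
          a k * Set.indicator (Set.Ioi (k : ℝ)) (fun t => c * Real.exp (-c * t)) t := by
        rw [integral_finsetSum _ fun k _ => (hint k).const_mul _]
        simp_rw [integral_const_mul, ← hexp]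
    _ ≤ ∫ t in Set.Ioi (0 : ℝ), B * c * (t ^ p * Real.exp (-c * t)) := by
        refine setIntegral_mono_on (integrable_finsetSum _ fun k _ => (hint k).const_mul _)
          (hGint.const_mul _) measurableSet_Ioi fun t ht => ?_
        have ht0 : 0 < t := ht
        calc ∑ k ∈ Finset.Icc 1 N,
              a k * Set.indicator (Set.Ioi (k : ℝ)) (fun t => c * Real.exp (-c * t)) t
            ≤ ∑ k ∈ Finset.Icc 1 ⌊t⌋₊, a k * (c * Real.exp (-c * t)) := by
              have e : ∀ k, a k * Set.indicator (Set.Ioi (k : ℝ))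
                  (fun t => c * Real.exp (-c * t)) t
                  = if (k : ℝ) < t then a k * (c * Real.exp (-c * t)) else 0 := by
                intro k; simp [Set.indicator_apply]
              simp_rw [e]
              rw [← Finset.sum_filter]
              refine Finset.sum_le_sum_of_subset_of_nonneg (fun k hk => ?_)
                fun k _ _ => mul_nonneg (ha k) (by positivity)
              rw [Finset.mem_filter, Finset.mem_Icc] at hk
              exact Finset.mem_Icc.2 ⟨hk.1.1, Nat.le_floor hk.2.le⟩
          _ = (∑ k ∈ Finset.Icc 1 ⌊t⌋₊, a k) * (c * Real.exp (-c * t)) := by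
              rw [Finset.sum_mul]
          _ ≤ B * t ^ p * (c * Real.exp (-c * t)) := by
              gcongr
              refine (h _).trans ?_
              gcongr
              exact Nat.floor_le ht0.le
          _ = _ := by ring
    _ = _ := by
        rw [integral_const_mul]
        simp_rw [neg_mul]
        rw [hG, Real.div_rpow zero_le_one hc.le, Real.one_rpow, Real.rpow_add hc, Real.rpow_one]
        field_simp

lemma char_natCast (k : ℕ) (θ : ℝ) :
    char k θ = Complex.exp (Complex.I * ((2 * Real.pi * (k * θ - round (k * θ)) : ℝ) : ℂ)) := by
  have h : Complex.I * ((2 * Real.pi * (k * θ - round (k * θ)) : ℝ) : ℂ)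
      = 2 * Real.pi * Complex.I * (k : ℤ) * θ - (round (k * θ) : ℤ) * (2 * Real.pi * Complex.I) := by
    push_cast; ring
  rw [h, Complex.exp_sub, Complex.exp_int_mul_two_pi_mul_I, div_one, char]

/-- The left-hand chord has length `2 |sin πt|` with `|t| ≤ 1/2`, and Jordan's inequality gives `sin
π|t| ≥ 2|t|`. -/
lemma le_norm_char_sub_one (θ : ℝ) (k : ℕ) : 4 * intDist θ k ≤ ‖char k θ - 1‖ := by
  rw [char_natCast, Complex.norm_exp_I_mul_ofReal_sub_one, intDist]
  set t := (k : ℝ) * θ - round ((k : ℝ) * θ)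
  have ht : |t| ≤ 1 / 2 := abs_sub_round _
  have h1 : 2 / Real.pi * (Real.pi * |t|) ≤ Real.sin (Real.pi * |t|) :=
    Real.mul_le_sin (by positivity) (by nlinarith [Real.pi_pos])
  have h2 : 2 / Real.pi * (Real.pi * |t|) = 2 * |t| := by field_simp
  have h3 : ‖2 * Real.sin (2 * Real.pi * t / 2)‖ = 2 * |Real.sin (Real.pi * t)| := by
    rw [Real.norm_eq_abs, abs_mul, abs_two]; ring_nf
  rw [h3]
  have h4 : Real.sin (Real.pi * |t|) ≤ |Real.sin (Real.pi * t)| := by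
    rcases abs_cases t with ⟨h, _⟩ | ⟨h, _⟩ <;> rw [h]
    · exact le_abs_self _
    · rw [mul_neg, Real.sin_neg]; exact neg_le_abs _
  linarith

lemma norm_char_neg_sub_one (θ : ℝ) (k : ℤ) : ‖char (-k) θ - 1‖ = ‖char k θ - 1‖ := by
  have h : char (-k) θ = (starRingEnd ℂ) (char k θ) := by
    simp [char, ← Complex.exp_conj, Complex.conj_ofNat]
  rw [h, ← Complex.norm_conj (char k θ - 1)]
  simp

lemma norm_char_sub_one_natAbs (θ : ℝ) (k : ℤ) :
    ‖char k θ - 1‖ = ‖char (k.natAbs : ℤ) θ - 1‖ := by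
  rcases Int.natAbs_eq k with h | h
  · rw [← h]
  · conv_lhs => rw [h]
    exact norm_char_neg_sub_one θ _

lemma intDist_pos {γ τ θ : ℝ} (hγ : 0 < γ) (hθ : θ ∈ Diophantine γ τ) {k : ℕ} (hk : k ≠ 0) :
    0 < intDist θ k := by
  have := hθ (round (k * θ)) k (by exact_mod_cast hk)
  refine lt_of_lt_of_le ?_ (this.trans (le_of_eq (by simp [intDist])))
  have : (0 : ℝ) < k := by exact_mod_cast Nat.pos_of_ne_zero hk
  simp only [Int.cast_natCast, abs_of_pos this]
  positivity

lemma char_sub_one_ne_zero {γ τ θ : ℝ} (hγ : 0 < γ) (hθ : θ ∈ Diophantine γ τ) {k : ℤ}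
    (hk : k ≠ 0) : char k θ - 1 ≠ 0 := by
  rw [← norm_pos_iff, norm_char_sub_one_natAbs]
  have := intDist_pos hγ hθ (Int.natAbs_ne_zero.2 hk)
  linarith [le_norm_char_sub_one θ k.natAbs]

/-- The quadratic small divisor sum. -/
lemma sum_small_divisors_le {γ τ θ δ : ℝ} (hγ : 0 < γ) (hτ : 0 ≤ τ) (hδ : 0 < δ)
    (hθ : θ ∈ Diophantine γ τ) (S : Finset ℤ) (h0 : (0 : ℤ) ∉ S) :
    ∑ k ∈ S, Real.exp (-(4 * Real.pi * |(k : ℝ)| * δ)) / ‖char k θ - 1‖ ^ 2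
      ≤ cR τ ^ 2 / (2 * (γ * δ ^ τ) ^ 2) := by
  set w : ℕ → ℝ := fun k => 1 / intDist θ k ^ 2 * Real.exp (-(4 * Real.pi * δ * k)) with hw
  have hw0 : ∀ k, 0 ≤ w k := fun k => by positivity
  set N := S.sup Int.natAbs with hN
  have hSN : ∀ k ∈ S, k.natAbs ∈ Finset.Icc 1 N := fun k hk => Finset.mem_Icc.2
    ⟨Nat.one_le_iff_ne_zero.2 (Int.natAbs_ne_zero.2 fun h => h0 (h ▸ hk)),
      Finset.le_sup (f := Int.natAbs) hk⟩
  have hsum : ∑ k ∈ Finset.Icc 1 N, w k ≤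
      hurwitzTwo ((2 : ℝ) ^ τ) * 2 ^ (2 * τ) / γ ^ 2 * Real.Gamma (2 * τ + 1)
        / (4 * Real.pi * δ) ^ (2 * τ) := by
    have hz := (hurwitzTwo_pos (a := (2 : ℝ) ^ τ) (by positivity)).le
    refine sum_mul_exp_le (fun k => by positivity) (by positivity) (by positivity)
      (by positivity) (fun n => (sum_intDist_le hγ hτ hθ n).trans (le_of_eq ?_)) N
    rw [Real.mul_rpow (by positivity) (by positivity)]; ring
  have hterm : ∀ k ∈ S, Real.exp (-(4 * Real.pi * |(k : ℝ)| * δ)) / ‖char k θ - 1‖ ^ 2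
      ≤ w k.natAbs / 16 := by
    intro k hk
    have hk0 : k ≠ 0 := fun h => h0 (h ▸ hk)
    have hpos := intDist_pos hγ hθ (Int.natAbs_ne_zero.2 hk0)
    have hle := le_norm_char_sub_one θ k.natAbs
    rw [norm_char_sub_one_natAbs, hw]
    have e : ((k.natAbs : ℕ) : ℝ) = |(k : ℝ)| := by rw [Nat.cast_natAbs]; simp
    simp only [e]
    calc _ ≤ Real.exp (-(4 * Real.pi * |(k : ℝ)| * δ)) / (4 * intDist θ k.natAbs) ^ 2 := by gcongr
      _ = _ := by field_simp; ring_nf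
  -- Each `n` is the absolute value of at most two frequencies.
  have hfib : ∑ k ∈ S, w k.natAbs ≤ 2 * ∑ k ∈ Finset.Icc 1 N, w k := by
    rw [← Finset.sum_fiberwise_of_maps_to hSN, Finset.mul_sum]
    refine Finset.sum_le_sum fun n _ => ?_
    rw [Finset.sum_congr rfl (g := fun _ => w n) fun k hk => by rw [(Finset.mem_filter.1 hk).2],
      Finset.sum_const, nsmul_eq_mul]
    refine mul_le_mul_of_nonneg_right ?_ (hw0 n)
    have : S.filter (fun k => k.natAbs = n) ⊆ {(n : ℤ), -(n : ℤ)} := by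
      intro k hk
      have := (Finset.mem_filter.1 hk).2
      simp only [Finset.mem_insert, Finset.mem_singleton]; omega
    have := (Finset.card_le_card this).trans Finset.card_le_two
    exact_mod_cast this
  have hcR : cR τ ^ 2 = hurwitzTwo ((2 : ℝ) ^ τ) * Real.Gamma (2 * τ + 1)
      / (4 * (2 * Real.pi) ^ (2 * τ)) := by
    rw [cR, div_pow, Real.sq_sqrt, mul_pow, ← Real.rpow_natCast ((2 * Real.pi) ^ τ),
      ← Real.rpow_mul (by positivity)]
    · norm_num; ring_nf
    · have := (hurwitzTwo_pos (a := (2 : ℝ) ^ τ) (by positivity)).le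
      have := (Real.Gamma_pos_of_pos (s := 2 * τ + 1) (by linarith)).le
      positivity
  calc _ ≤ ∑ k ∈ S, w k.natAbs / 16 := Finset.sum_le_sum hterm
    _ ≤ 2 * (hurwitzTwo ((2 : ℝ) ^ τ) * 2 ^ (2 * τ) / γ ^ 2 * Real.Gamma (2 * τ + 1)
        / (4 * Real.pi * δ) ^ (2 * τ)) / 16 := by
        rw [← Finset.sum_div]; gcongr; exact hfib.trans (by gcongr)
    _ = _ := by
        rw [hcR, mul_pow, ← Real.rpow_natCast (δ ^ τ), ← Real.rpow_mul hδ.le,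
          show (4 * Real.pi * δ) = 2 * ((2 * Real.pi) * δ) by ring,
          Real.mul_rpow zero_le_two (by positivity), Real.mul_rpow (by positivity) hδ.le,
          show τ * ((2 : ℕ) : ℝ) = 2 * τ by push_cast; ring]
        field_simp
        ring

/-! ### The cohomological equation -/

lemma cR_nonneg (τ : ℝ) : 0 ≤ cR τ := by
  unfold cR; positivity

/-- The solution of `u (z + θ) - u z = v z` given by its Fourier series. -/
def cohom (θ : ℝ) (v : ℂ → ℂ) (z : ℂ) : ℂ := ∑' k : ℤ, coeff v k / (char k θ - 1) * char k z

section Cohom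

variable {ρ δ γ τ θ M : ℝ} {v : ℂ → ℂ}

/-- Cauchy-Schwarz: the weight `exp(2π|k|ρ)` goes to the coefficients and `exp(-2π|k|δ)` to the
small divisors. The 2 of Bessel cancels the 1/2 of the divisor sum, leaving exactly `c_R`. A bound
on all finite sums yields summability and the estimate together. -/
lemma sum_cohom_le (hρ : 0 < ρ) (hδ : 0 < δ) (hγ : 0 < γ) (hτ : 0 ≤ τ)
    (hθ : θ ∈ Diophantine γ τ) (hv : PerHol ρ v) (hM : ∀ z ∈ strip ρ, ‖v z‖ ≤ M)
    (h0 : coeff v 0 = 0) (S : Finset ℤ) :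
    ∑ k ∈ S, ‖coeff v k / (char k θ - 1)‖ * Real.exp (2 * Real.pi * |(k : ℝ)| * (ρ - δ))
      ≤ cR τ * M / (γ * δ ^ τ) := by
  have hM0 : 0 ≤ M := (norm_nonneg _).trans (hM 0 (by simpa [mem_strip] using hρ))
  set a : ℤ → ℝ := fun k => ‖coeff v k‖ * Real.exp (2 * Real.pi * |(k : ℝ)| * ρ)
  set b : ℤ → ℝ := fun k => Real.exp (-(2 * Real.pi * |(k : ℝ)| * δ)) / ‖char k θ - 1‖
  have ha : ∑ k ∈ S.erase 0, a k ^ 2 ≤ 2 * M ^ 2 := by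
    refine le_trans (le_of_eq (Finset.sum_congr rfl fun k _ => ?_))
      (hv.sum_coeff_abs_le hρ hM (S.erase 0))
    simp only [a]
    rw [mul_pow, ← Real.exp_nat_mul]; congr 2; push_cast; ring
  have hb : ∑ k ∈ S.erase 0, b k ^ 2 ≤ cR τ ^ 2 / (2 * (γ * δ ^ τ) ^ 2) := by
    refine le_trans (le_of_eq (Finset.sum_congr rfl fun k _ => ?_))
      (sum_small_divisors_le hγ hτ hδ hθ (S.erase 0) (Finset.notMem_erase 0 S))
    simp only [b]
    rw [div_pow, ← Real.exp_nat_mul]; congr 2; push_cast; ring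
  have hR : 0 ≤ cR τ * M / (γ * δ ^ τ) := by have := cR_nonneg τ; positivity
  calc _ = ∑ k ∈ S.erase 0, a k * b k := by
        rw [Finset.sum_erase _ (by simp [a, h0])]
        refine Finset.sum_congr rfl fun k _ => ?_
        have : Real.exp (2 * Real.pi * |(k : ℝ)| * (ρ - δ)) =
            Real.exp (2 * Real.pi * |(k : ℝ)| * ρ) * Real.exp (-(2 * Real.pi * |(k : ℝ)| * δ)) := by
          rw [← Real.exp_add]; ring_nf
        simp only [a, b]
        rw [norm_div, this]; ring
    _ ≤ cR τ * M / (γ * δ ^ τ) := by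
        refine le_of_sq_le_sq ?_ hR
        calc _ ≤ (∑ k ∈ S.erase 0, a k ^ 2) * ∑ k ∈ S.erase 0, b k ^ 2 :=
              Finset.sum_mul_sq_le_sq_mul_sq _ _ _
          _ ≤ (2 * M ^ 2) * (cR τ ^ 2 / (2 * (γ * δ ^ τ) ^ 2)) :=
              mul_le_mul ha hb (Finset.sum_nonneg fun _ _ => by positivity) (by positivity)
          _ = _ := by field_simp

lemma summable_cohom (hρ : 0 < ρ) (hδ : 0 < δ) (hγ : 0 < γ) (hτ : 0 ≤ τ)
    (hθ : θ ∈ Diophantine γ τ) (hv : PerHol ρ v) (hM : ∀ z ∈ strip ρ, ‖v z‖ ≤ M)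
    (h0 : coeff v 0 = 0) :
    Summable fun k : ℤ =>
      ‖coeff v k / (char k θ - 1)‖ * Real.exp (2 * Real.pi * |(k : ℝ)| * (ρ - δ)) :=
  summable_of_sum_le (fun _ => by positivity) (sum_cohom_le hρ hδ hγ hτ hθ hv hM h0)

lemma norm_cohom_term_le (v : ℂ → ℂ) (θ : ℝ) (k : ℤ) {y : ℝ} {z : ℂ} (hz : z ∈ strip y) :
    ‖coeff v k / (char k θ - 1) * char k z‖
      ≤ ‖coeff v k / (char k θ - 1)‖ * Real.exp (2 * Real.pi * |(k : ℝ)| * y) := by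
  rw [norm_mul]
  gcongr
  exact norm_char_le k (le_of_lt hz)

lemma perHol_cohom (hρ : 0 < ρ) (hδ : 0 < δ) (hγ : 0 < γ) (hτ : 0 ≤ τ)
    (hθ : θ ∈ Diophantine γ τ) (hv : PerHol ρ v) (hM : ∀ z ∈ strip ρ, ‖v z‖ ≤ M)
    (h0 : coeff v 0 = 0) : PerHol (ρ - δ) (cohom θ v) where
  diff := Complex.differentiableOn_tsum_of_summable_norm
    (summable_cohom hρ hδ hγ hτ hθ hv hM h0)
    (fun k => ((differentiable_char k).const_mul _).differentiableOn) (isOpen_strip _)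
    fun k _ hz => norm_cohom_term_le v θ k hz
  per z _ := by
    simp only [cohom, char_add, char_one, mul_one]

/-- Rüssmann's estimate. -/
lemma norm_cohom_le (hρ : 0 < ρ) (hδ : 0 < δ) (hγ : 0 < γ) (hτ : 0 ≤ τ)
    (hθ : θ ∈ Diophantine γ τ) (hv : PerHol ρ v) (hM : ∀ z ∈ strip ρ, ‖v z‖ ≤ M)
    (h0 : coeff v 0 = 0) {z : ℂ} (hz : z ∈ strip (ρ - δ)) :
    ‖cohom θ v z‖ ≤ cR τ * M / (γ * δ ^ τ) :=
  (tsum_of_norm_bounded (summable_cohom hρ hδ hγ hτ hθ hv hM h0).hasSum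
    fun k => norm_cohom_term_le v θ k hz).trans
    ((summable_cohom hρ hδ hγ hτ hθ hv hM h0).tsum_le_of_sum_le
      (sum_cohom_le hρ hδ hγ hτ hθ hv hM h0))

lemma cohom_add_sub (hρ : 0 < ρ) (hδ : 0 < δ) (hγ : 0 < γ) (hτ : 0 ≤ τ)
    (hθ : θ ∈ Diophantine γ τ) (hv : PerHol ρ v) (hM : ∀ z ∈ strip ρ, ‖v z‖ ≤ M)
    (h0 : coeff v 0 = 0) {z : ℂ} (hz : z ∈ strip (ρ - δ)) :
    cohom θ v (z + θ) - cohom θ v z = v z := by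
  have hsum : ∀ w ∈ strip (ρ - δ), Summable fun k : ℤ => coeff v k / (char k θ - 1) * char k w :=
    fun w hw => Summable.of_norm_bounded (summable_cohom hρ hδ hγ hτ hθ hv hM h0)
      fun k => norm_cohom_term_le v θ k hw
  rw [cohom, cohom, ← (hsum _ (add_real_mem_strip hz θ)).tsum_sub (hsum z hz),
    ← (hv.hasSum_coeff hρ hM (strip_mono (by linarith) hz)).tsum_eq]
  refine tsum_congr fun k => ?_
  -- At `k = 0` the divisor is zero and the quotient is `0` by convention, in agreement with the
  -- zero mean of `v`.
  rcases eq_or_ne k 0 with rfl | hk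
  · simp [h0]
  · have := char_sub_one_ne_zero hγ hθ hk
    rw [char_add]; field_simp

lemma conj_char_ofReal (k : ℤ) (x : ℝ) : (starRingEnd ℂ) (char k x) = char (-k) x := by
  simp [char, ← Complex.exp_conj, Complex.conj_ofNat]

lemma conj_coeff (hv : ∀ x : ℝ, (v x).im = 0) (k : ℤ) :
    (starRingEnd ℂ) (coeff v k) = coeff v (-k) := by
  rw [coeff_eq, coeff_eq, ← intervalIntegral.intervalIntegral_conj]
  refine intervalIntegral.integral_congr fun x _ => ?_
  simp only [map_mul, conj_char_ofReal, Complex.conj_eq_iff_im.2 (hv x)]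

lemma cohom_im (hv : ∀ x : ℝ, (v x).im = 0) (x : ℝ) : (cohom θ v x).im = 0 := by
  rw [← Complex.conj_eq_iff_im, cohom, Complex.conj_tsum, ← (Equiv.neg ℤ).tsum_eq]
  refine tsum_congr fun k => ?_
  simp only [Equiv.neg_apply, map_mul, map_div₀, map_sub, map_one, conj_char_ofReal,
    conj_coeff hv, neg_neg]

end Cohom

/-! ### Cauchy and Taylor estimates on strips -/

lemma closedBall_subset_strip {ρ δ : ℝ} {z : ℂ} (hz : z ∈ strip (ρ - δ)) :
    Metric.closedBall z δ ⊆ strip ρ := by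
  intro w hw
  have h1 : |w.im - z.im| ≤ δ := by
    rw [← Complex.sub_im]
    exact (Complex.abs_im_le_norm _).trans (by simpa [dist_eq_norm] using hw)
  have h2 : |z.im| < ρ - δ := hz
  rw [mem_strip, abs_lt]
  rw [abs_lt] at h2; rw [abs_le] at h1
  constructor <;> linarith

/-- Cauchy's estimate. -/
lemma norm_deriv_le_of_strip {ρ δ C : ℝ} {f : ℂ → ℂ} (hδ : 0 < δ)
    (hf : DifferentiableOn ℂ f (strip ρ)) (hC : ∀ z ∈ strip ρ, ‖f z‖ ≤ C) {z : ℂ}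
    (hz : z ∈ strip (ρ - δ)) : ‖deriv f z‖ ≤ C / δ := by
  refine Complex.norm_deriv_le_of_forall_mem_sphere_norm_le hδ ?_ fun w hw =>
    hC w (closedBall_subset_strip hz (Metric.sphere_subset_closedBall hw))
  refine DifferentiableOn.diffContOnCl ?_
  rw [closure_ball z hδ.ne']
  exact hf.mono (closedBall_subset_strip hz)

/-- The second order Taylor estimate. -/
lemma norm_taylor_le {r c : ℝ} {p : ℂ → ℂ} (hp : DifferentiableOn ℂ p (strip r))
    (hc : ∀ z ∈ strip r, ‖deriv (deriv p) z‖ ≤ c) {w t : ℂ} (hw : w ∈ strip r)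
    (ht : w + t ∈ strip r) : ‖p (w + t) - p w - deriv p w * t‖ ≤ 1 / 2 * c * ‖t‖ ^ 2 := by
  have hmem : ∀ u ∈ Set.Icc (0 : ℝ) 1, w + (u : ℂ) * t ∈ strip r := by
    intro u hu
    have := (convex_strip r).add_smul_mem hw ht hu
    simpa using this
  have hp' := hp.deriv (isOpen_strip r)
  have hd : ∀ u ∈ Set.Icc (0 : ℝ) 1, HasDerivAt
      (fun u : ℝ => p (w + (u : ℂ) * t) - p w - u * (deriv p w * t))
      ((deriv p (w + u * t) - deriv p w) * t) u := by
    intro u hu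
    have h1 : HasDerivAt p (deriv p (w + (u : ℂ) * t)) (w + (u : ℂ) * t) :=
      (hp.differentiableAt ((isOpen_strip r).mem_nhds (hmem u hu))).hasDerivAt
    have h2 : HasDerivAt (fun u : ℂ => w + u * t) t (u : ℂ) := by
      simpa using ((hasDerivAt_id (u : ℂ)).mul_const t).const_add w
    have h3 := ((h1.comp (u : ℂ) h2).sub_const (p w)).sub
      ((hasDerivAt_id (u : ℂ)).mul_const (deriv p w * t))
    rw [one_mul, ← sub_mul] at h3
    exact h3.comp_ofReal
  have hlip : ∀ u ∈ Set.Icc (0 : ℝ) 1,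
      ‖deriv p (w + (u : ℂ) * t) - deriv p w‖ ≤ c * (u * ‖t‖) := by
    intro u hu
    have := (convex_strip r).norm_image_sub_le_of_norm_deriv_le (𝕜 := ℂ) (f := deriv p) (C := c)
      (fun x hx => hp'.differentiableAt ((isOpen_strip r).mem_nhds hx)) hc hw (hmem u hu)
    simpa [abs_of_nonneg hu.1] using this
  have key := image_norm_le_of_norm_deriv_right_le_deriv_boundary (a := 0) (b := 1)
    (f := fun u : ℝ => p (w + (u : ℂ) * t) - p w - u * (deriv p w * t))
    (f' := fun u : ℝ => (deriv p (w + u * t) - deriv p w) * t)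
    (B := fun u : ℝ => 1 / 2 * c * ‖t‖ ^ 2 * u ^ 2)
    (B' := fun u : ℝ => c * ‖t‖ ^ 2 * u)
    (fun u hu => (hd u hu).continuousAt.continuousWithinAt)
    (fun u hu => (hd u (Set.Ico_subset_Icc_self hu)).hasDerivWithinAt)
    (by simp)
    (fun u => ((hasDerivAt_pow 2 u).const_mul (1 / 2 * c * ‖t‖ ^ 2)).congr_deriv (by
      push_cast; ring))
    (fun u hu => by
      rw [norm_mul]
      have := hlip u (Set.Ico_subset_Icc_self hu)
      nlinarith [norm_nonneg t])
    (Set.right_mem_Icc.2 zero_le_one)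
  simpa using key

lemma deriv_im_eq_zero {h : ℂ → ℂ} (hr : ∀ x : ℝ, (h x).im = 0) {x : ℝ}
    (hd : DifferentiableAt ℂ h x) : (deriv h x).im = 0 := by
  have h1 := hd.hasDerivAt.comp_ofReal
  have h2 : HasDerivAt (fun t : ℝ => (h t).im) (deriv h x).im x := by
    have := (Complex.imCLM.hasFDerivAt.comp_hasDerivAt x h1)
    simpa [Function.comp_def] using this
  have h3 : (fun t : ℝ => (h t).im) = fun _ => 0 := funext hr
  rw [h3] at h2
  exact h2.unique (hasDerivAt_const x 0)

lemma integral_im_eq_zero {v : ℂ → ℂ} (hv : ∀ x : ℝ, (v x).im = 0) :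
    (∫ x in (0 : ℝ)..1, v x).im = 0 := by
  rw [← Complex.conj_eq_iff_im, ← intervalIntegral.intervalIntegral_conj]
  exact intervalIntegral.integral_congr fun x _ => Complex.conj_eq_iff_im.2 (hv x)

lemma integral_re {v : ℂ → ℂ} (hv : Continuous fun x : ℝ => v x) :
    (∫ x in (0 : ℝ)..1, v x).re = ∫ x in (0 : ℝ)..1, (v x).re :=
  (Complex.reCLM.intervalIntegral_comp_comm (hv.intervalIntegrable 0 1)).symm

lemma norm_integral_le_of_real {v : ℂ → ℂ} {C : ℝ} (hv : ∀ x : ℝ, ‖v x‖ ≤ C) :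
    ‖∫ x in (0 : ℝ)..1, v x‖ ≤ C := by
  simpa using intervalIntegral.norm_integral_le_of_norm_le_const (a := (0 : ℝ)) (b := 1)
    (f := fun x : ℝ => v x) fun x _ => hv x

/-! ### Approximate conjugacies -/

/-- `h` conjugates `z ↦ z + α + p z` to the rotation by `θ` on the open strip of width `ρ`
up to an error `M`; `h` is `d`-close to the identity and `h'` is `ω`-close to `1`. -/
structure Approx (p : ℂ → ℂ) (θ ρ ω d M : ℝ) (h : ℂ → ℂ) (α : ℝ) : Prop where
  diff : DifferentiableOn ℂ h (strip ρ)
  per : ∀ z ∈ strip ρ, h (z + 1) = h z + 1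
  real : ∀ x : ℝ, (h x).im = 0
  mean : ∫ x in (0 : ℝ)..1, (h x - x) = 0
  deriv_le : ∀ z ∈ strip ρ, ‖deriv h z - 1‖ ≤ ω
  dist_le : ∀ z ∈ strip ρ, ‖h z - z‖ ≤ d
  err_le : ∀ z ∈ strip ρ, ‖h z + α + p (h z) - h (z + θ)‖ ≤ M

/-- The class of perturbations `p` of the rotations `z ↦ z + α`. -/
structure Perturbation (r c : ℝ) (p : ℂ → ℂ) : Prop where
  hol : PerHol r p
  real : ∀ x : ℝ, (p x).im = 0
  deriv2_le : ∀ z ∈ strip r, ‖deriv (deriv p) z‖ ≤ c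

namespace Approx

variable {p h : ℂ → ℂ} {θ ρ ω d M α r c : ℝ}

lemma differentiableAt (H : Approx p θ ρ ω d M h α) {z : ℂ} (hz : z ∈ strip ρ) :
    DifferentiableAt ℂ h z := H.diff.differentiableAt ((isOpen_strip ρ).mem_nhds hz)

lemma mapsTo (H : Approx p θ ρ ω d M h α) (hr : ρ + d ≤ r) {z : ℂ} (hz : z ∈ strip ρ) :
    h z ∈ strip r := by
  have h1 := (Complex.abs_im_le_norm _).trans (H.dist_le z hz)
  have h2 : |z.im| < ρ := hz
  rw [Complex.sub_im] at h1
  rw [mem_strip, abs_lt]; rw [abs_lt] at h2; rw [abs_le] at h1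
  constructor <;> linarith

lemma perHol_deriv (H : Approx p θ ρ ω d M h α) : PerHol ρ (deriv h) where
  diff := H.diff.deriv (isOpen_strip ρ)
  per z hz := by
    rw [← deriv_comp_add_const]
    have : (fun w => h (w + 1)) =ᶠ[𝓝 z] fun w => h w + 1 :=
      Filter.eventuallyEq_of_mem ((isOpen_strip ρ).mem_nhds hz) H.per
    rw [this.deriv_eq, deriv_add_const]

lemma deriv_real (H : Approx p θ ρ ω d M h α) (hρ : 0 < ρ) (x : ℝ) : (deriv h x).im = 0 :=
  deriv_im_eq_zero H.real (H.differentiableAt (ofReal_mem_strip hρ x))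

lemma norm_deriv_le (H : Approx p θ ρ ω d M h α) {z : ℂ} (hz : z ∈ strip ρ) :
    ‖deriv h z‖ ≤ 1 + ω := by
  have := norm_add_le (1 : ℂ) (deriv h z - 1)
  rw [add_sub_cancel, norm_one] at this
  linarith [H.deriv_le z hz]

lemma le_norm_deriv (H : Approx p θ ρ ω d M h α) {z : ℂ} (hz : z ∈ strip ρ) :
    1 - ω ≤ ‖deriv h z‖ := by
  have := norm_sub_norm_le (1 : ℂ) (1 - deriv h z)
  rw [sub_sub_cancel, norm_one, norm_sub_rev] at this
  linarith [H.deriv_le z hz]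

lemma perHol_inv_deriv (H : Approx p θ ρ ω d M h α) (hω : ω < 1) :
    PerHol ρ fun z => (deriv h (z + θ))⁻¹ where
  diff := by
    refine DifferentiableOn.inv ?_ fun z hz h0 => ?_
    · exact H.perHol_deriv.diff.comp (by fun_prop) fun z hz => add_real_mem_strip hz θ
    · have := H.le_norm_deriv (add_real_mem_strip hz θ)
      rw [h0, norm_zero] at this; linarith
  per z hz := by
    rw [add_right_comm, H.perHol_deriv.per _ (add_real_mem_strip hz θ)]

lemma perHol_err (H : Approx p θ ρ ω d M h α) (hp : PerHol r p) (hr : ρ + d ≤ r) :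
    PerHol ρ fun z => h z + α + p (h z) - h (z + θ) where
  diff := by
    refine ((H.diff.add_const _).add (hp.diff.comp H.diff fun z hz => H.mapsTo hr hz)).sub ?_
    exact H.diff.comp (by fun_prop) fun z hz => add_real_mem_strip hz θ
  per z hz := by
    rw [add_right_comm z, H.per z hz, H.per _ (add_real_mem_strip hz θ),
      hp.per _ (H.mapsTo hr hz)]
    ring

lemma ofReal_re (H : Approx p θ ρ ω d M h α) (x : ℝ) : (((h x).re : ℝ) : ℂ) = h x :=
  Complex.ext (by simp) (by simp [H.real x])

lemma err_real (H : Approx p θ ρ ω d M h α) (hp : ∀ x : ℝ, (p x).im = 0) (x : ℝ) :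
    (h x + α + p (h x) - h (x + θ)).im = 0 := by
  have h1 := H.real x
  have h2 := hp (h x).re
  have h3 := H.real (x + θ)
  rw [H.ofReal_re] at h2
  push_cast at h3
  simp [h1, h2, h3]

lemma integral_deriv (H : Approx p θ ρ ω d M h α) (hρ : 0 < ρ) :
    ∫ x in (0 : ℝ)..1, deriv h x = 1 := by
  have := intervalIntegral.integral_eq_sub_of_hasDerivAt (a := 0) (b := 1)
    (f := fun x : ℝ => h x) (f' := fun x : ℝ => deriv h x)
    (fun x _ => (H.differentiableAt (ofReal_mem_strip hρ x)).hasDerivAt.comp_ofReal)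
    ((H.perHol_deriv.continuous_real hρ).intervalIntegrable 0 1)
  rw [this]
  have := H.per 0 (by simpa using ofReal_mem_strip hρ 0)
  rw [zero_add] at this
  simp [this]

/-- The reciprocal of the derivative, shifted by `θ`, has mean at least `1 / (1 + ω)`. -/
lemma le_integral_inv_deriv (H : Approx p θ ρ ω d M h α) (hρ : 0 < ρ) (hω : ω < 1) :
    (1 + ω)⁻¹ ≤ ‖∫ x in (0 : ℝ)..1, (deriv h ((x : ℂ) + θ))⁻¹‖ := by
  have hc := (H.perHol_inv_deriv hω).continuous_real hρ
  refine le_trans ?_ ((le_abs_self _).trans (Complex.abs_re_le_norm _))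
  have e := integral_re (v := fun z => (deriv h (z + θ))⁻¹) hc
  rw [e]
  have : ∀ x : ℝ, (1 + ω)⁻¹ ≤ ((deriv h ((x : ℂ) + θ))⁻¹).re := by
    intro x
    have him := H.deriv_real hρ (x + θ)
    have hle := H.deriv_le _ (ofReal_mem_strip hρ (x + θ))
    push_cast at him hle
    have hre := (Complex.abs_re_le_norm _).trans hle
    simp only [Complex.sub_re, Complex.one_re, abs_le] at hre
    have e : deriv h ((x : ℂ) + θ) = ((deriv h ((x : ℂ) + θ)).re : ℂ) :=
      Complex.ext (by simp) (by simp [him])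
    rw [e, ← Complex.ofReal_inv, Complex.ofReal_re]
    exact inv_anti₀ (by linarith) (by linarith)
  have := intervalIntegral.integral_mono (a := 0) (b := 1) (μ := volume) zero_le_one
    intervalIntegrable_const ((Complex.continuous_re.comp hc).intervalIntegrable 0 1) this
  simpa using this

end Approx

/-! ### The Newton step -/

/-- The constant `C₁` of the perturbative setting. -/
def stepConst (s τ : ℝ) : ℝ := (1 + s) * cR τ * (1 + s * s) * s

lemma stepConst_nonneg {s τ : ℝ} (hs : 0 ≤ s) : 0 ≤ stepConst s τ := by
  have := cR_nonneg τ
  unfold stepConst; positivity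

namespace Approx

variable {p h : ℂ → ℂ} {θ ρ ω d M α r c δ γ τ s : ℝ}

/-- The solution of the linearized equation. -/
lemma exists_correction (H : Approx p θ ρ ω d M h α) (hp : Perturbation r c p)
    (hδ : 0 < δ) (hδρ : δ < ρ) (hγ : 0 < γ) (hτ : 0 ≤ τ) (hθ : θ ∈ Diophantine γ τ)
    (hω : ω < 1) (hs1 : 1 + ω ≤ s) (hs2 : 1 ≤ s * (1 - ω)) (hr : ρ + d ≤ r) :
    ∃ (ξ : ℂ → ℂ) (η : ℝ), PerHol (ρ - δ) ξ ∧ (∀ x : ℝ, (ξ x).im = 0) ∧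
      (∫ x in (0 : ℝ)..1, deriv h x * ξ x) = 0 ∧
      (∀ z ∈ strip (ρ - δ), ‖ξ z‖ ≤ stepConst s τ * M / (γ * δ ^ τ)) ∧ |η| ≤ s * s * M ∧
      ∀ z ∈ strip (ρ - δ), deriv h (z + θ) * (ξ (z + θ) - ξ z)
        = h z + α + p (h z) - h (z + θ) + η := by
  have hρ : 0 < ρ := hδ.trans hδρ
  have hM0 : 0 ≤ M := (norm_nonneg _).trans (H.err_le 0 (by simpa using ofReal_mem_strip hρ 0))
  have hω0 : 0 ≤ ω := (norm_nonneg _).trans (H.deriv_le 0 (by simpa using ofReal_mem_strip hρ 0))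
  have hs0 : 0 < s := by linarith
  set e : ℂ → ℂ := fun z => h z + α + p (h z) - h (z + θ) with he_def
  -- Multiplication by `b` turns the linearized equation into `ξ(z + θ) - ξ(z) = b(z) (e(z) + η)`.
  set b : ℂ → ℂ := fun z => (deriv h (z + θ))⁻¹ with hb_def
  have he : PerHol ρ e := H.perHol_err hp.hol hr
  have hb : PerHol ρ b := H.perHol_inv_deriv hω
  have hbs : ∀ z ∈ strip ρ, ‖b z‖ ≤ s := by
    intro z hz
    rw [hb_def, norm_inv]
    have := H.le_norm_deriv (add_real_mem_strip hz θ)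
    refine inv_le_of_inv_le₀ hs0 (le_trans ?_ this)
    rw [inv_le_iff_one_le_mul₀ hs0]; linarith
  have hbr : ∀ x : ℝ, (b x).im = 0 := by
    intro x
    have := H.deriv_real hρ (x + θ)
    push_cast at this
    simp [hb_def, Complex.inv_im, this]
  have her : ∀ x : ℝ, (e x).im = 0 := H.err_real hp.real
  set B : ℂ := ∫ x in (0 : ℝ)..1, b x with hB
  have hBge : s⁻¹ ≤ ‖B‖ := le_trans (inv_anti₀ (by linarith) hs1)
    (H.le_integral_inv_deriv hρ hω)
  have hB0 : B ≠ 0 := norm_pos_iff.1 (lt_of_lt_of_le (by positivity) hBge)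
  have hBi : B.im = 0 := integral_im_eq_zero hbr
  set I : ℂ := ∫ x in (0 : ℝ)..1, b x * e x with hI
  have hIi : I.im = 0 := integral_im_eq_zero (v := fun z => b z * e z) fun x => by
    simp [Complex.mul_im, hbr x, her x]
  have hIle : ‖I‖ ≤ s * M := norm_integral_le_of_real (v := fun z => b z * e z) fun x => by
    rw [norm_mul]
    exact mul_le_mul (hbs _ (ofReal_mem_strip hρ x)) (H.err_le _ (ofReal_mem_strip hρ x))
      (norm_nonneg _) hs0.le
  -- The only constant for which `b (e + η)` has mean zero, which the cohomological equation
  -- requires.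
  set η : ℂ := -(I / B) with hη
  have hηi : η.im = 0 := by simp [hη, Complex.div_im, hIi, hBi]
  have hηr : ((η.re : ℝ) : ℂ) = η := Complex.ext (by simp) (by simp [hηi])
  have hηle : ‖η‖ ≤ s * s * M := by
    rw [hη, norm_neg, norm_div, div_eq_mul_inv]
    have : ‖B‖⁻¹ ≤ s := inv_le_of_inv_le₀ hs0 hBge
    calc ‖I‖ * ‖B‖⁻¹ ≤ (s * M) * s := by gcongr
      _ = _ := by ring
  set v : ℂ → ℂ := fun z => b z * (e z + η) with hv_def
  have hv : PerHol ρ v := ⟨hb.diff.mul (he.diff.add_const _), fun z hz => by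
    simp only [hv_def]; rw [hb.per z hz, he.per z hz]⟩
  have hvM : ∀ z ∈ strip ρ, ‖v z‖ ≤ s * (1 + s * s) * M := by
    intro z hz
    rw [norm_mul]
    calc ‖b z‖ * ‖e z + η‖ ≤ s * (M + s * s * M) := by
          refine mul_le_mul (hbs z hz) ((norm_add_le _ _).trans ?_) (norm_nonneg _) hs0.le
          exact add_le_add (H.err_le z hz) hηle
      _ = _ := by ring
  have hv0 : coeff v 0 = 0 := by
    rw [coeff_zero]
    have h1 : IntervalIntegrable (fun x : ℝ => b x * e x) volume 0 1 :=
      ((hb.continuous_real hρ).mul (he.continuous_real hρ)).intervalIntegrable 0 1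
    have h2 : IntervalIntegrable (fun x : ℝ => b x * η) volume 0 1 :=
      ((hb.continuous_real hρ).mul continuous_const).intervalIntegrable 0 1
    simp only [hv_def, mul_add]
    rw [intervalIntegral.integral_add h1 h2, intervalIntegral.integral_mul_const, ← hI, ← hB, hη]
    field_simp; ring
  have hvr : ∀ x : ℝ, (v x).im = 0 := fun x => by
    simp [hv_def, Complex.mul_im, hbr x, her x, hηi]
  set φ := cohom θ v
  have hφ : PerHol (ρ - δ) φ := perHol_cohom hρ hδ hγ hτ hθ hv hvM hv0
  set N : ℝ := cR τ * (s * (1 + s * s) * M) / (γ * δ ^ τ) with hN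
  have hφN : ∀ z ∈ strip (ρ - δ), ‖φ z‖ ≤ N := fun z hz =>
    norm_cohom_le hρ hδ hγ hτ hθ hv hvM hv0 hz
  have hρδ : 0 < ρ - δ := by linarith
  -- The solution is free up to a constant. As `h'` has mean 1, subtracting `m` gives `h' ξ` mean
  -- zero, which keeps `h - id` of zero average; it costs the factor `1 + s` of `stepConst`.
  set m : ℂ := ∫ x in (0 : ℝ)..1, deriv h x * φ x with hm
  have hmN : ‖m‖ ≤ s * N := norm_integral_le_of_real (v := fun z => deriv h z * φ z) fun x => by
    rw [norm_mul]
    exact mul_le_mul ((H.norm_deriv_le (ofReal_mem_strip hρ x)).trans hs1)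
      (hφN _ (ofReal_mem_strip hρδ x)) (norm_nonneg _) hs0.le
  have hmi : m.im = 0 := integral_im_eq_zero (v := fun z => deriv h z * φ z) fun x => by
    have h1 := H.deriv_real hρ x
    have h2 : (φ x).im = 0 := cohom_im hvr x
    simp [Complex.mul_im, h1, h2]
  refine ⟨fun z => φ z - m, η.re, ⟨hφ.diff.sub_const _, fun z hz => by rw [hφ.per z hz]⟩,
    fun x => ?_, ?_, fun z hz => ?_, (Complex.abs_re_le_norm _).trans hηle, fun z hz => ?_⟩
  · have h2 : (φ x).im = 0 := cohom_im hvr x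
    simp [h2, hmi]
  · have h1 : IntervalIntegrable (fun x : ℝ => deriv h x * φ x) volume 0 1 :=
      ((H.perHol_deriv.continuous_real hρ).mul (hφ.continuous_real hρδ)).intervalIntegrable 0 1
    have h2 : IntervalIntegrable (fun x : ℝ => deriv h x * m) volume 0 1 :=
      ((H.perHol_deriv.continuous_real hρ).mul continuous_const).intervalIntegrable 0 1
    simp only [mul_sub]
    rw [intervalIntegral.integral_sub h1 h2, intervalIntegral.integral_mul_const,
      H.integral_deriv hρ, ← hm, one_mul, sub_self]
  · calc ‖φ z - m‖ ≤ N + s * N := (norm_sub_le _ _).trans (add_le_add (hφN z hz) hmN)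
      _ = _ := by rw [hN, stepConst]; ring
  · have h1 := cohom_add_sub hρ hδ hγ hτ hθ hv hvM hv0 hz
    have h2 : deriv h (z + θ) ≠ 0 := by
      intro h0
      have := H.le_norm_deriv (add_real_mem_strip (strip_mono (by linarith) hz) θ)
      rw [h0, norm_zero] at this; linarith
    rw [sub_sub_sub_cancel_right, h1, hηr]
    simp only [hv_def, hb_def, he_def]
    field_simp

/-- One step of the Newton iteration. -/
lemma step (H : Approx p θ ρ ω d M h α) (hp : Perturbation r c p)
    (hδ : 0 < δ) (hδρ : 2 * δ < ρ) (hγ : 0 < γ) (hτ : 0 ≤ τ) (hθ : θ ∈ Diophantine γ τ)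
    (hω : ω < 1) (hs1 : 1 + ω ≤ s) (hs2 : 1 ≤ s * (1 - ω))
    {N : ℝ} (hN : N = stepConst s τ * M / (γ * δ ^ τ)) (hr : ρ + (d + s * N) ≤ r) :
    ∃ (h' : ℂ → ℂ) (α' : ℝ),
      Approx p θ (ρ - 2 * δ) (ω + s * N / δ) (d + s * N)
        (M / δ * N + 1 / 2 * c * (s * N) ^ 2) h' α' ∧
      (∀ z ∈ strip (ρ - 2 * δ), ‖h' z - h z‖ ≤ s * N) ∧ |α' - α| ≤ s * s * M := by
  have hρ : 0 < ρ := by linarith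
  have hM0 : 0 ≤ M := (norm_nonneg _).trans (H.err_le 0 (by simpa using ofReal_mem_strip hρ 0))
  have hω0 : 0 ≤ ω := (norm_nonneg _).trans (H.deriv_le 0 (by simpa using ofReal_mem_strip hρ 0))
  have hs0 : 0 < s := by linarith
  have hN0 : 0 ≤ N := by
    have := stepConst_nonneg (τ := τ) hs0.le
    rw [hN]; positivity
  have hr0 : ρ + d ≤ r := by nlinarith
  obtain ⟨ξ, η, hξ, hξr, hξm, hξN, hη, heq⟩ :=
    H.exists_correction hp hδ (by linarith) hγ hτ hθ hω hs1 hs2 hr0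
  rw [← hN] at hξN
  have hsub : strip (ρ - δ) ⊆ strip ρ := strip_mono (by linarith)
  have hsub2 : strip (ρ - 2 * δ) ⊆ strip (ρ - δ) := strip_mono (by linarith)
  have hD : DifferentiableOn ℂ (fun z => deriv h z * ξ z) (strip (ρ - δ)) :=
    (H.perHol_deriv.diff.mono hsub).mul hξ.diff
  have hDN : ∀ z ∈ strip (ρ - δ), ‖deriv h z * ξ z‖ ≤ s * N := by
    intro z hz
    rw [norm_mul]
    exact mul_le_mul ((H.norm_deriv_le (hsub hz)).trans hs1) (hξN z hz) (norm_nonneg _) hs0.le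
  have hdist : ∀ z ∈ strip (ρ - δ), ‖h z + deriv h z * ξ z - z‖ ≤ d + s * N := by
    intro z hz
    calc _ = ‖(h z - z) + deriv h z * ξ z‖ := by ring_nf
      _ ≤ _ := (norm_add_le _ _).trans (add_le_add (H.dist_le z (hsub hz)) (hDN z hz))
  refine ⟨fun z => h z + deriv h z * ξ z, α + η, ⟨?_, ?_, ?_, ?_, ?_, ?_, ?_⟩, ?_, ?_⟩
  · exact (H.diff.mono (hsub2.trans hsub)).add (hD.mono hsub2)
  · intro z hz
    rw [H.per z (hsub (hsub2 hz)), H.perHol_deriv.per z (hsub (hsub2 hz)), hξ.per z (hsub2 hz)]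
    ring
  · intro x
    simp [Complex.mul_im, H.real x, H.deriv_real hρ x, hξr x]
  · have hρδ : 0 < ρ - δ := by linarith
    have h1 : IntervalIntegrable (fun x : ℝ => h x - x) volume 0 1 := by
      refine Continuous.intervalIntegrable ?_ 0 1
      refine Continuous.sub ?_ (by fun_prop)
      exact H.diff.continuousOn.comp_continuous (by fun_prop) fun x => ofReal_mem_strip hρ x
    have h2 : IntervalIntegrable (fun x : ℝ => deriv h x * ξ x) volume 0 1 :=
      ((H.perHol_deriv.continuous_real hρ).mul (hξ.continuous_real hρδ)).intervalIntegrable 0 1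
    have := intervalIntegral.integral_add h1 h2
    rw [H.mean, hξm, add_zero] at this
    rw [← this]
    exact intervalIntegral.integral_congr fun x _ => by ring
  · intro z hz
    have hz1 := hsub2 hz
    have h1 : deriv (fun z => h z + deriv h z * ξ z) z
        = deriv h z + deriv (fun z => deriv h z * ξ z) z :=
      deriv_fun_add (H.differentiableAt (hsub hz1))
        (hD.differentiableAt ((isOpen_strip _).mem_nhds hz1))
    have h2 : ‖deriv (fun z => deriv h z * ξ z) z‖ ≤ s * N / δ :=
      norm_deriv_le_of_strip hδ hD hDN (by rwa [show ρ - δ - δ = ρ - 2 * δ by ring])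
    calc _ = ‖(deriv h z - 1) + deriv (fun z => deriv h z * ξ z) z‖ := by rw [h1]; ring_nf
      _ ≤ _ := (norm_add_le _ _).trans (add_le_add (H.deriv_le z (hsub hz1)) h2)
  · exact fun z hz => hdist z (hsub2 hz)
  · intro z hz
    have hz1 := hsub2 hz
    have hz0 := hsub hz1
    have hhz := H.mapsTo hr0 hz0
    have hmem : h z + deriv h z * ξ z ∈ strip r := by
      have h1 := (Complex.abs_im_le_norm _).trans (hdist z hz1)
      have h2 : |z.im| < ρ - 2 * δ := hz
      rw [Complex.sub_im] at h1
      rw [mem_strip, abs_lt]; rw [abs_lt] at h2; rw [abs_le] at h1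
      constructor <;> linarith
    -- The term neglected by the linearization is `e' ξ`; Cauchy's estimate bounds `e'` by `M / δ`.
    have hder : deriv (fun z => h z + α + p (h z) - h (z + θ)) z
        = deriv h z + deriv p (h z) * deriv h z - deriv h (z + θ) := by
      have h1 := (H.differentiableAt hz0).hasDerivAt
      have h2 := ((hp.hol.diff.differentiableAt
        ((isOpen_strip r).mem_nhds hhz)).hasDerivAt).comp z h1
      have h3 := ((H.differentiableAt (add_real_mem_strip hz0 θ)).hasDerivAt).comp_add_const z θ
      exact (((h1.add_const (α : ℂ)).add h2).sub h3).deriv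
    have hcauchy : ‖deriv h z + deriv p (h z) * deriv h z - deriv h (z + θ)‖ ≤ M / δ := by
      rw [← hder]
      exact norm_deriv_le_of_strip hδ (H.perHol_err hp.hol hr0).diff H.err_le hz1
    have htay := norm_taylor_le hp.hol.diff hp.deriv2_le hhz hmem
    have hc0 : 0 ≤ c := (norm_nonneg _).trans (hp.deriv2_le _ hhz)
    -- By the linearized equation the new error is `e' ξ` plus the Taylor remainder of `p`, both
    -- quadratic in `M`.
    have hsplit : h z + deriv h z * ξ z + ((α + η : ℝ) : ℂ) + p (h z + deriv h z * ξ z)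
          - (h (z + θ) + deriv h (z + θ) * ξ (z + θ))
        = (deriv h z + deriv p (h z) * deriv h z - deriv h (z + θ)) * ξ z
          + (p (h z + deriv h z * ξ z) - p (h z) - deriv p (h z) * (deriv h z * ξ z)) := by
      push_cast
      linear_combination -(heq z hz1)
    rw [hsplit]
    refine (norm_add_le _ _).trans (add_le_add ?_ (htay.trans ?_))
    · rw [norm_mul]
      exact mul_le_mul hcauchy (hξN z hz1) (norm_nonneg _) (by positivity)
    · gcongr
      exact hDN z hz1
  · intro z hz
    rw [add_sub_cancel_left]
    exact hDN z (hsub2 hz)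
  · rw [add_sub_cancel_left]; exact hη

end Approx

/-! ### The sums `Σ_{t,l}` -/

/-- The general term of the sums `Σ_{t,l}`. -/
def sigTerm (a t l : ℝ) (j : ℕ) : ℝ := t ^ (2 ^ j - 1) * a ^ (-l * (j : ℝ))

lemma sigTerm_zero (a t l : ℝ) : sigTerm a t l 0 = 1 := by simp [sigTerm]

lemma sigTerm_nonneg {a t : ℝ} (ha : 0 ≤ a) (ht : 0 ≤ t) (l : ℝ) (j : ℕ) :
    0 ≤ sigTerm a t l j := by unfold sigTerm; positivity

lemma two_pow_succ_sub_one (j : ℕ) : 2 ^ (j + 1) - 1 = (2 ^ j - 1) + 2 ^ j := by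
  have : 1 ≤ 2 ^ j := Nat.one_le_two_pow
  rw [pow_succ]; omega

lemma sigTerm_succ {a t : ℝ} (ha : 0 < a) (l : ℝ) (j : ℕ) :
    sigTerm a t l (j + 1) = t ^ (2 ^ j) * a ^ (-l) * sigTerm a t l j := by
  rw [sigTerm, sigTerm, two_pow_succ_sub_one, pow_add]
  push_cast
  rw [mul_add, mul_one, Real.rpow_add ha]; ring

lemma summable_sigTerm {a t : ℝ} (ha : 0 < a) (ht0 : 0 ≤ t) (ht : t < 1) (l : ℝ) :
    Summable (sigTerm a t l) := by
  -- For `t = 0` only the term `j = 0`, equal to `0^0 = 1`, survives; the ratio test needs nonzero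
  -- terms.
  rcases ht0.eq_or_lt with rfl | ht0
  · refine summable_of_ne_finset_zero (s := {0}) fun j hj => ?_
    rw [Finset.mem_singleton] at hj
    have : 2 ≤ 2 ^ j := Nat.le_self_pow hj 2
    rw [sigTerm, zero_pow (by omega), zero_mul]
  · refine summable_of_ratio_test_tendsto_lt_one (l := 0) zero_lt_one
      (Eventually.of_forall fun j => ?_) ?_
    · rw [sigTerm]; positivity
    · have h1 : Tendsto (fun j : ℕ => t ^ (2 ^ j) * a ^ (-l)) atTop (𝓝 (0 * a ^ (-l))) :=
        ((tendsto_pow_atTop_nhds_zero_of_lt_one ht0.le ht).comp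
          (tendsto_pow_atTop_atTop_of_one_lt one_lt_two)).mul_const _
      rw [zero_mul] at h1
      refine h1.congr fun j => ?_
      have hpos : 0 < sigTerm a t l j := by rw [sigTerm]; positivity
      rw [sigTerm_succ ha, norm_mul, mul_div_assoc, div_self (norm_pos_iff.2 hpos.ne').ne',
        mul_one, Real.norm_of_nonneg (by positivity)]

lemma one_le_tsum_sigTerm {a t : ℝ} (ha : 0 < a) (ht0 : 0 ≤ t) (ht : t < 1) (l : ℝ) :
    1 ≤ ∑' j, sigTerm a t l j := by
  rw [← sigTerm_zero a t l]
  exact (summable_sigTerm ha ht0 ht l).le_tsum 0 fun j _ => sigTerm_nonneg ha.le ht0 l j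

lemma tsum_sigTerm_mono {a t t' l l' : ℝ} (ha : 1 < a) (ht0 : 0 ≤ t) (htt : t ≤ t') (ht : t' < 1)
    (hl : l' ≤ l) : ∑' j, sigTerm a t l j ≤ ∑' j, sigTerm a t' l' j := by
  refine (summable_sigTerm (by linarith) ht0 (by linarith) l).tsum_le_tsum (fun j => ?_)
    (summable_sigTerm (by linarith) (by linarith) ht l')
  unfold sigTerm
  have ht'0 : 0 ≤ t' := ht0.trans htt
  have h1 : a ^ (-l * (j : ℝ)) ≤ a ^ (-l' * (j : ℝ)) :=
    Real.rpow_le_rpow_of_exponent_le ha.le (by gcongr)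
  gcongr

lemma tsum_sigTerm_le {a t l : ℝ} (ha : 1 < a) (ht0 : 0 ≤ t) (ht : t < 1) (hl : 0 < l) :
    ∑' j, sigTerm a t l j ≤ (1 - a ^ (-l))⁻¹ := by
  have h1 : a ^ (-l) < 1 := Real.rpow_lt_one_of_one_lt_of_neg ha (by linarith)
  have h0 : 0 ≤ a ^ (-l) := by positivity
  rw [← tsum_geometric_of_lt_one h0 h1]
  refine (summable_sigTerm (by linarith) ht0 ht l).tsum_le_tsum (fun j => ?_)
    (summable_geometric_of_lt_one h0 h1)
  rw [sigTerm, Real.rpow_mul (by linarith), Real.rpow_natCast]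
  exact mul_le_of_le_one_left (by positivity) (pow_le_one₀ ht0 ht.le)

/-! ### Convergence of the Newton iteration -/

/-- `h` conjugates `z ↦ z + α + p z` to the rotation by `θ` on the closed strip. -/
structure IsConj (p : ℂ → ℂ) (θ ρ ω d : ℝ) (h : ℂ → ℂ) (α : ℝ) : Prop where
  cont : ContinuousOn h {z : ℂ | |z.im| ≤ ρ}
  diff : DifferentiableOn ℂ h (strip ρ)
  per : ∀ z : ℂ, |z.im| ≤ ρ → h (z + 1) = h z + 1
  real : ∀ x : ℝ, (h x).im = 0
  mean : ∫ x in (0 : ℝ)..1, (h x - x) = 0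
  deriv_le : ∀ z ∈ strip ρ, ‖deriv h z - 1‖ ≤ ω
  dist_le : ∀ z : ℂ, |z.im| ≤ ρ → ‖h z - z‖ ≤ d
  conj : ∀ z : ℂ, |z.im| ≤ ρ → h z + α + p (h z) = h (z + θ)

/-- Dependent choice that keeps both the invariant `P` and the relation `R` between consecutive
terms. -/
lemma exists_seq_of_step {X : Type*} {P : ℕ → X → Prop} {R : ℕ → X → X → Prop} {x₀ : X}
    (h0 : P 0 x₀) (hstep : ∀ n x, P n x → ∃ y, P (n + 1) y ∧ R n x y) :
    ∃ F : ℕ → X, F 0 = x₀ ∧ (∀ n, P n (F n)) ∧ ∀ n, R n (F n) (F (n + 1)) := by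
  choose! g hg hR using hstep
  let F : ℕ → X := fun n => Nat.rec x₀ (fun n x => g n x) n
  have hF : ∀ n, P n (F n) := by
    intro n
    induction n with
    | zero => exact h0
    | succ n ih => exact hg n _ ih
  exact ⟨F, rfl, hF, fun n => hR n _ (hF n)⟩

/-- The limit of a convergent sequence of approximate conjugacies. -/
lemma exists_isConj_of_seq {p : ℂ → ℂ} {θ ρ r c ω d : ℝ} (hp : Perturbation r c p) (hρ : 0 < ρ)
    {ρs ωs ds Ms us vs : ℕ → ℝ} {h : ℕ → ℂ → ℂ} {α : ℕ → ℝ} (hid : h 0 = id)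
    (hρs : ∀ n, ρ < ρs n) (hωs : ∀ n, ωs n ≤ ω) (hds : ∀ n, ds n ≤ d) (hdr : ρ + d < r)
    (hM : Tendsto Ms atTop (𝓝 0)) (hu : Summable us) (hv : Summable vs)
    (H : ∀ n, Approx p θ (ρs n) (ωs n) (ds n) (Ms n) (h n) (α n))
    (hh : ∀ n, ∀ z ∈ strip (ρs (n + 1)), ‖h (n + 1) z - h n z‖ ≤ us n)
    (hα : ∀ n, |α (n + 1) - α n| ≤ vs n) :
    ∃ h' α', IsConj p θ ρ ω d h' α' := by
  set S : Set ℂ := {z : ℂ | |z.im| ≤ ρ} with hS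
  have hmem : ∀ n, ∀ z ∈ S, z ∈ strip (ρs n) := fun n z hz => lt_of_le_of_lt hz (hρs n)
  have hSθ : ∀ z ∈ S, ∀ t : ℝ, z + (t : ℂ) ∈ S := fun z hz t => by simpa [hS] using hz
  have hS1 : ∀ z ∈ S, z + 1 ∈ S := fun z hz => by simpa using hSθ z hz 1
  have hsub : strip ρ ⊆ S := fun z hz => (mem_strip.1 hz).le
  have hrealS : ∀ x : ℝ, (x : ℂ) ∈ S := fun x => hsub (ofReal_mem_strip hρ x)
  -- The limit as a telescoping series, which starts from `h 0 = id`.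
  set L : ℂ → ℂ := fun z => z + ∑' n, (h (n + 1) z - h n z) with hL
  have hunif : TendstoUniformlyOn h L atTop S := by
    have h1 := tendstoUniformlyOn_tsum_nat (f := fun n z => h (n + 1) z - h n z) (s := S) hu
      fun n z hz => hh n z (hmem _ z hz)
    rw [Metric.tendstoUniformlyOn_iff] at h1 ⊢
    intro ε hε
    filter_upwards [h1 ε hε] with n hn z hz
    have := hn z hz
    rw [Finset.sum_range_sub (fun n => h n z), hid] at this
    rw [dist_eq_norm] at this ⊢
    convert this using 2
    simp only [hL, id]; ring
  have hpt : ∀ z ∈ S, Tendsto (fun n => h n z) atTop (𝓝 (L z)) := fun z hz =>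
    hunif.tendsto_at hz
  obtain ⟨α', hα'⟩ : ∃ α', Tendsto α atTop (𝓝 α') :=
    cauchySeq_tendsto_of_complete (cauchySeq_of_dist_le_of_summable vs (fun n => by
      rw [dist_comm, Real.dist_eq]; exact hα n) hv)
  have hloc : TendstoLocallyUniformlyOn h L atTop (strip ρ) :=
    (hunif.mono hsub).tendstoLocallyUniformlyOn
  have hdiffn : ∀ n, DifferentiableOn ℂ (h n) (strip ρ) := fun n =>
    (H n).diff.mono fun z hz => hmem n z (hsub hz)
  have hdist : ∀ z ∈ S, ‖L z - z‖ ≤ d := fun z hz =>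
    le_of_tendsto ((hpt z hz).sub_const z).norm
      (Eventually.of_forall fun n => ((H n).dist_le z (hmem n z hz)).trans (hds n))
  refine ⟨L, α', ?_, ?_, ?_, ?_, ?_, ?_, hdist, ?_⟩
  · exact hunif.continuousOn (Eventually.of_forall fun n =>
      (H n).diff.continuousOn.mono fun z hz => hmem n z hz).frequently
  · exact hloc.differentiableOn (Eventually.of_forall hdiffn) (isOpen_strip ρ)
  · intro z hz
    refine tendsto_nhds_unique (hpt _ (hS1 z hz)) (((hpt z hz).add_const 1).congr fun n => ?_)
    exact ((H n).per z (hmem n z hz)).symm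
  · intro x
    have h1 := (Complex.continuous_im.tendsto _).comp (hpt x (hrealS x))
    refine tendsto_nhds_unique h1 (tendsto_const_nhds.congr fun n => ?_)
    exact ((H n).real x).symm
  · have h1 : Tendsto (fun n => ∫ x in (0 : ℝ)..1, (h n x - x)) atTop
        (𝓝 (∫ x in (0 : ℝ)..1, (L x - x))) := by
      refine intervalIntegral.tendsto_integral_filter_of_dominated_convergence (fun _ => d)
        (Eventually.of_forall fun n => ?_) (Eventually.of_forall fun n => ae_of_all _ fun x _ =>
          ((H n).dist_le x (hmem n _ (hrealS x))).trans (hds n)) intervalIntegrable_const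
        (ae_of_all _ fun x _ => (hpt x (hrealS x)).sub_const _)
      refine (Continuous.sub ?_ (by fun_prop)).aestronglyMeasurable
      exact (H n).diff.continuousOn.comp_continuous (by fun_prop) fun x => hmem n _ (hrealS x)
    refine tendsto_nhds_unique h1 (tendsto_const_nhds.congr fun n => ?_)
    exact (H n).mean.symm
  · intro z hz
    have h1 := (hloc.deriv (Eventually.of_forall hdiffn) (isOpen_strip ρ)).tendsto_at hz
    exact le_of_tendsto (h1.sub_const 1).norm
      (Eventually.of_forall fun n => ((H n).deriv_le z (hmem n z (hsub hz))).trans (hωs n))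
  · intro z hz
    have hLz : L z ∈ strip r := by
      have h1 := (Complex.abs_im_le_norm _).trans (hdist z hz)
      have h2 : |z.im| ≤ ρ := hz
      rw [Complex.sub_im] at h1
      rw [mem_strip, abs_lt]; rw [abs_le] at h2; rw [abs_le] at h1
      constructor <;> linarith
    have hpc : ContinuousAt p (L z) :=
      hp.hol.diff.continuousOn.continuousAt ((isOpen_strip r).mem_nhds hLz)
    have h1 : Tendsto (fun n => h n z + (α n : ℂ) + p (h n z) - h n (z + θ)) atTop
        (𝓝 (L z + α' + p (L z) - L (z + θ))) :=
      (((hpt z hz).add ((Complex.continuous_ofReal.tendsto _).comp hα')).add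
        (hpc.tendsto.comp (hpt z hz))).sub (hpt _ (hSθ z hz θ))
    have h2 : Tendsto (fun n => h n z + (α n : ℂ) + p (h n z) - h n (z + θ)) atTop (𝓝 0) :=
      squeeze_zero_norm (fun n => (H n).err_le z (hmem n z hz)) hM
    exact sub_eq_zero.1 (tendsto_nhds_unique h1 h2)

lemma sigTerm_eq {a : ℝ} (ha : 0 ≤ a) (t l : ℝ) (j : ℕ) :
    sigTerm a t l j = t ^ (2 ^ j - 1) * (a ^ (-(j : ℝ))) ^ l := by
  rw [sigTerm, ← Real.rpow_mul ha]; ring_nf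

/-- The quadratic error bound along the Newton iteration. -/
lemma newton_error_le {τ γ δ s c C₁ C₃ a κ E P t : ℝ} (hτ : 1 ≤ τ) (hγ : 0 < γ) (hδ : 0 < δ)
    (hC₁ : 0 ≤ C₁) (ha : 0 < a)
    (hC₃ : C₃ = C₁ * γ * δ ^ (τ - 1) + 1 / 2 * c * (s * C₁) ^ 2)
    (hκ : κ = C₃ * a ^ (2 * τ) / (γ ^ 2 * δ ^ (2 * τ)) * E) (hP : 0 < P) (hP1 : P ≤ 1) :
    E * (t * P ^ (2 * τ)) / (δ * P) * (C₁ * E / (γ * δ ^ τ) * (t * P ^ τ))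
        + 1 / 2 * c * (s * (C₁ * E / (γ * δ ^ τ) * (t * P ^ τ))) ^ 2
      ≤ E * (t * (t * κ) * (P / a) ^ (2 * τ)) := by
  have h2 : ∀ x : ℝ, 0 < x → x ^ (2 * τ) = (x ^ τ) ^ 2 := fun x hx => by
    rw [← Real.rpow_natCast, ← Real.rpow_mul hx.le]; push_cast; ring_nf
  have hQ : 0 < P ^ τ := by positivity
  have hD : 0 < δ ^ τ := by positivity
  have hA : 0 < a ^ τ := by positivity
  -- Here `τ ≥ 1` enters: the term from Cauchy's estimate carries a spare factor `P^τ / P`.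
  have hQP : P ^ τ ≤ P := by
    simpa using Real.rpow_le_rpow_of_exponent_ge hP hP1 hτ
  rw [hκ, hC₃, Real.div_rpow hP.le ha.le, h2 P hP, h2 a ha, h2 δ hδ, Real.rpow_sub hδ,
    Real.rpow_one]
  have e1 : E * (t * (P ^ τ) ^ 2) / (δ * P) * (C₁ * E / (γ * δ ^ τ) * (t * P ^ τ))
      = (E * t * P ^ τ) ^ 2 * (C₁ / (γ * δ ^ τ * δ)) * (P ^ τ / P) := by
    field_simp
  -- The definition of `C₃` makes the Taylor terms on the two sides equal and the Cauchy terms equal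
  -- up to that factor.
  have e2 : E * (t * (t * ((C₁ * γ * (δ ^ τ / δ) + 1 / 2 * c * (s * C₁) ^ 2) * (a ^ τ) ^ 2
        / (γ ^ 2 * (δ ^ τ) ^ 2) * E)) * ((P ^ τ) ^ 2 / (a ^ τ) ^ 2))
      = (E * t * P ^ τ) ^ 2 * (C₁ / (γ * δ ^ τ * δ)) * 1
        + 1 / 2 * c * (s * (C₁ * E / (γ * δ ^ τ) * (t * P ^ τ))) ^ 2 := by
    field_simp
  rw [e1, e2]
  gcongr
  rwa [div_le_one hP]

/-- The a-posteriori theorem for the perturbation of a rotation. -/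
theorem exists_isConj {p : ℂ → ℂ} {τ γ θ ρ ρinf r δ s c C₃ a κ E ω d : ℝ} (hτ : 1 ≤ τ)
    (hγ : 0 < γ) (hθ : θ ∈ Diophantine γ τ) (hδ : 0 < δ) (hρinf : 0 < ρinf)
    (hρ : ρinf < ρ - 2 * δ) (hp : Perturbation r c p) (hE : ∀ z ∈ strip ρ, ‖p z‖ ≤ E)
    (hC₃ : C₃ = stepConst s τ * γ * δ ^ (τ - 1) + 1 / 2 * c * (s * stepConst s τ) ^ 2)
    (ha : a = (ρ - ρinf) / (ρ - 2 * δ - ρinf))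
    (hκ : κ = C₃ * a ^ (2 * τ) / (γ ^ 2 * δ ^ (2 * τ)) * E) (hκ0 : 0 ≤ κ) (hκ1 : κ < 1)
    (hω : ω = s * stepConst s τ * E / (γ * δ ^ (τ + 1)) * ∑' j, sigTerm a κ (τ - 1) j)
    (hd : d = s * stepConst s τ * E / (γ * δ ^ τ) * ∑' j, sigTerm a κ τ j)
    (hω1 : ω < 1) (hs1 : 1 + ω ≤ s) (hs2 : 1 ≤ s * (1 - ω)) (hs0 : 0 < s) (hdr : ρ + d < r) :
    ∃ h α, IsConj p θ ρinf ω d h α := by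
  have hρ0 : 0 < ρ := by linarith
  have hE0 : 0 ≤ E := (norm_nonneg _).trans (hE 0 (by simpa using ofReal_mem_strip hρ0 0))
  have hden : 0 < ρ - 2 * δ - ρinf := by linarith
  have ha1 : 1 < a := by rw [ha, one_lt_div hden]; linarith
  have ha0 : 0 < a := by linarith
  have hC0 : 0 ≤ stepConst s τ := stepConst_nonneg hs0.le
  set C₁ := stepConst s τ with hC₁
  -- Step `n` loses `2 δ a^(-n)` of strip; `a` is the ratio for which these losses add up to exactly
  -- `ρ - ρinf`.
  set P : ℕ → ℝ := fun n => a ^ (-(n : ℝ)) with hPdef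
  have hP : ∀ n, 0 < P n := fun n => by positivity
  have hP1 : ∀ n, P n ≤ 1 := fun n => Real.rpow_le_one_of_one_le_of_nonpos ha1.le (by simp)
  have hPs : ∀ n, P (n + 1) = P n / a := fun n => by
    simp only [hPdef]; push_cast
    rw [neg_add, Real.rpow_add ha0, Real.rpow_neg_one]; rfl
  set ρs : ℕ → ℝ := fun n => ρinf + (ρ - ρinf) * P n with hρs
  have hρstep : ∀ n, ρs n - 2 * (δ * P n) = ρs (n + 1) := by
    intro n
    simp only [hρs, hPs, ha]
    have : ρ - ρinf ≠ 0 := by linarith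
    field_simp; ring
  have hρslt : ∀ n, ρinf < ρs n := fun n => by
    have : 0 < (ρ - ρinf) * P n := mul_pos (by linarith) (hP n)
    simp only [hρs]; linarith
  have hρsle : ∀ n, ρs n ≤ ρ := fun n => by
    have : (ρ - ρinf) * P n ≤ (ρ - ρinf) * 1 :=
      mul_le_mul_of_nonneg_left (hP1 n) (by linarith)
    simp only [hρs]; linarith
  -- The error is kept below `E κ^(2^n - 1) a^(-2τn)`; the last factor compensates for the small
  -- divisor loss, squared by the quadratic step, as the strip losses shrink.
  set M : ℕ → ℝ := fun n => E * sigTerm a κ (2 * τ) n with hM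
  set N : ℕ → ℝ := fun n => C₁ * E / (γ * δ ^ τ) * sigTerm a κ τ n with hN
  have hN0 : ∀ n, 0 ≤ N n := fun n => by
    have := sigTerm_nonneg ha0.le hκ0 τ n
    positivity
  have hNM : ∀ n, N n = C₁ * M n / (γ * (δ * P n) ^ τ) := by
    intro n
    have h1 := hP n
    have h2 : 0 < P n ^ τ := by positivity
    have h3 : (P n) ^ (2 * τ) = P n ^ τ * P n ^ τ := by rw [← Real.rpow_add h1]; ring_nf
    simp only [hN, hM, sigTerm_eq ha0.le]
    rw [Real.mul_rpow hδ.le h1.le]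
    change _ * (_ * P n ^ τ) = C₁ * (E * (_ * P n ^ (2 * τ))) / _
    rw [h3]
    field_simp
  have hωterm : ∀ n, s * N n / (δ * P n)
      = s * C₁ * E / (γ * δ ^ (τ + 1)) * sigTerm a κ (τ - 1) n := by
    intro n
    have h1 := hP n
    simp only [hN, sigTerm_eq ha0.le]
    change s * (_ * (_ * P n ^ τ)) / _ = _ * (_ * P n ^ (τ - 1))
    rw [Real.rpow_sub h1, Real.rpow_add hδ, Real.rpow_one, Real.rpow_one]
    field_simp
  have hsN : ∀ n, s * N n = s * C₁ * E / (γ * δ ^ τ) * sigTerm a κ τ n := fun n => by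
    simp only [hN]; ring
  have hsum1 : Summable fun n => s * N n := by
    simp_rw [hsN]; exact (summable_sigTerm ha0 hκ0 hκ1 τ).mul_left _
  have hsum2 : Summable fun n => s * N n / (δ * P n) := by
    simp_rw [hωterm]; exact (summable_sigTerm ha0 hκ0 hκ1 (τ - 1)).mul_left _
  have hsumM : Summable M := (summable_sigTerm ha0 hκ0 hκ1 (2 * τ)).mul_left _
  -- Distances to the identity accumulate as partial sums, whose totals are `d` and `ω`; so every
  -- step runs under the same bounds.
  set ds : ℕ → ℝ := fun n => ∑ j ∈ Finset.range n, s * N j with hds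
  set ωs : ℕ → ℝ := fun n => ∑ j ∈ Finset.range n, s * N j / (δ * P j) with hωs
  have hdsle : ∀ n, ds n ≤ d := fun n => by
    rw [hd, ← tsum_mul_left]; simp_rw [← hsN]
    exact hsum1.sum_le_tsum _ fun j _ => mul_nonneg hs0.le (hN0 j)
  have hωsle : ∀ n, ωs n ≤ ω := fun n => by
    rw [hω, ← tsum_mul_left]; simp_rw [← hωterm]
    exact hsum2.sum_le_tsum _ fun j _ =>
      div_nonneg (mul_nonneg hs0.le (hN0 j)) (mul_nonneg hδ.le (hP j).le)
  have herr : ∀ n, M n / (δ * P n) * N n + 1 / 2 * c * (s * N n) ^ 2 ≤ M (n + 1) := by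
    intro n
    have h := newton_error_le (t := κ ^ (2 ^ n - 1)) hτ hγ hδ hC0 ha0 hC₃ hκ (hP n) (hP1 n)
    simp only [hN, hM, sigTerm_eq ha0.le]
    refine h.trans (le_of_eq ?_)
    rw [← hPs, two_pow_succ_sub_one, pow_add]
    have : κ ^ (2 ^ n) = κ ^ (2 ^ n - 1) * κ := by
      rw [← pow_succ, Nat.sub_add_cancel Nat.one_le_two_pow]
    rw [this]
  obtain ⟨F, hF0, hF, hFs⟩ := exists_seq_of_step
    (P := fun n (x : (ℂ → ℂ) × ℝ) => Approx p θ (ρs n) (ωs n) (ds n) (M n) x.1 x.2)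
    (R := fun n (x y : (ℂ → ℂ) × ℝ) =>
      (∀ z ∈ strip (ρs (n + 1)), ‖y.1 z - x.1 z‖ ≤ s * N n) ∧ |y.2 - x.2| ≤ s * s * M n)
    (x₀ := (id, θ))
    (by
      have hρs0 : ρs 0 = ρ := by simp [hρs, hPdef]
      have hM0 : M 0 = E := by simp [hM, sigTerm_zero]
      rw [hρs0, hM0]
      refine ⟨differentiableOn_id, fun _ _ => rfl, fun x => by simp, by simp,
        fun z _ => by simp [hωs], fun z _ => by simp [hds], fun z hz => ?_⟩
      rw [show id z + ((θ : ℝ) : ℂ) + p (id z) - id (z + θ) = p z by simp only [id]; ring]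
      exact hE z hz)
    (fun n x hx => by
      obtain ⟨h', α', h1, h2, h3⟩ := hx.step hp (δ := δ * P n) (γ := γ) (τ := τ) (s := s)
        (mul_pos hδ (hP n)) (by linarith [hρstep n, hρslt (n + 1)]) hγ (by linarith) hθ
        (by linarith [hωsle n]) (by linarith [hωsle n]) (by nlinarith [hωsle n]) (hNM n)
        (by
          have : ds n + s * N n = ds (n + 1) := (Finset.sum_range_succ _ n).symm
          rw [this]; linarith [hdsle (n + 1), hρsle n])
      rw [hρstep] at h1 h2
      refine ⟨(h', α'), ?_, h2, h3⟩
      have e1 : ds n + s * N n = ds (n + 1) := (Finset.sum_range_succ _ n).symm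
      have e2 : ωs n + s * N n / (δ * P n) = ωs (n + 1) := (Finset.sum_range_succ _ n).symm
      rw [e1, e2] at h1
      exact { h1 with err_le := fun z hz => (h1.err_le z hz).trans (herr n) })
  exact exists_isConj_of_seq (h := fun n => (F n).1) (α := fun n => (F n).2) hp hρinf
    (by rw [hF0]) hρslt hωsle hdsle (by linarith) hsumM.tendsto_atTop_zero hsum1
    (hsumM.mul_left (s * s)) hF (fun n => (hFs n).1) (fun n => (hFs n).2)

/-! ### Dependence of the parameter on the rotation number -/

lemma integral_comp_add_of_periodic {f : ℝ → ℝ} (hf : Function.Periodic f 1) (t : ℝ) :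
    ∫ x in (0 : ℝ)..1, f (x + t) = ∫ x in (0 : ℝ)..1, f x := by
  have := hf.intervalIntegral_add_eq (0 + t) 0
  rw [intervalIntegral.integral_comp_add_right, add_comm 1 t]
  simpa using this

/-- A real lift of a circle diffeomorphism close to the identity in the `C¹` topology. -/
structure NearId (ω : ℝ) (k k' : ℝ → ℝ) : Prop where
  deriv : ∀ x, HasDerivAt k (k' x) x
  cont : Continuous k'
  le : ∀ x, |k' x - 1| ≤ ω
  per : ∀ x, k (x + 1) = k x + 1

namespace NearId

variable {ω : ℝ} {k k' : ℝ → ℝ}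

lemma abs_sub_le (H : NearId ω k k') (u v : ℝ) : |k u - k v - (u - v)| ≤ ω * |u - v| := by
  have := (convex_univ (𝕜 := ℝ) (E := ℝ)).norm_image_sub_le_of_norm_hasDerivWithin_le
    (f := fun x => k x - x) (f' := fun x => k' x - 1) (C := ω)
    (fun x _ => ((H.deriv x).sub (hasDerivAt_id x)).hasDerivWithinAt) (fun x _ => H.le x)
    (Set.mem_univ v) (Set.mem_univ u)
  simp only [Real.norm_eq_abs] at this
  convert this using 2
  ring

lemma continuous (H : NearId ω k k') : Continuous k :=
  continuous_iff_continuousAt.2 fun x => (H.deriv x).continuousAt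

lemma le_abs_sub (H : NearId ω k k') (u v : ℝ) : (1 - ω) * |u - v| ≤ |k u - k v| := by
  have h1 := H.abs_sub_le u v
  have h2 := abs_sub_abs_le_abs_sub (u - v) (k u - k v)
  rw [abs_sub_comm (u - v)] at h2
  linarith

lemma injective (H : NearId ω k k') (hω : ω < 1) : Function.Injective k := by
  intro u v huv
  have h1 := H.le_abs_sub u v
  rw [huv, sub_self, abs_zero] at h1
  have h2 : |u - v| ≤ 0 := by
    by_contra h
    have : 0 < (1 - ω) * |u - v| := mul_pos (by linarith) (by linarith)
    linarith
  exact sub_eq_zero.1 (abs_nonpos_iff.1 h2)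

lemma strictMono (H : NearId ω k k') (hω : ω < 1) : StrictMono k :=
  strictMono_of_deriv_pos fun x => by
    rw [(H.deriv x).deriv]
    have := (abs_le.1 (H.le x)).1
    linarith

lemma surjective (H : NearId ω k k') : Function.Surjective k := by
  have hper : ∀ n : ℤ, ∀ x, k (x + n) = k x + n := by
    intro n
    induction n using Int.induction_on with
    | zero => simp
    | succ n ih => intro x; push_cast at ih ⊢; rw [← add_assoc, H.per, ih]; ring
    | pred n ih =>
      intro x
      have := H.per (x + ((-(n : ℤ) - 1 : ℤ) : ℝ))
      push_cast at ih this ⊢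
      rw [show x + (-(n : ℝ) - 1) + 1 = x + -(n : ℝ) by ring, ih] at this
      linarith
  intro y
  set n := ⌊y - k 0⌋
  have h1 : k 0 + n ≤ y := by have := Int.floor_le (y - k 0); linarith
  have h2 : y ≤ k 0 + n + 1 := by have := Int.lt_floor_add_one (y - k 0); linarith
  have hn := hper n 0
  have hn1 := hper (n + 1) 0
  push_cast at hn1
  rw [zero_add] at hn hn1
  obtain ⟨x, -, hx⟩ := intermediate_value_Icc (a := (n : ℝ)) (b := n + 1) (by linarith)
    H.continuous.continuousOn (show y ∈ Set.Icc (k n) (k (n + 1)) from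
      ⟨by linarith, by linarith⟩)
  exact ⟨x, hx⟩

end NearId

/-- Rotation numbers and parameters agree up to second order in the distance of the conjugacies
to the identity. -/
theorem abs_rotation_sub_param_le {ω θ₁ θ₂ α₁ α₂ : ℝ} {k₁ k₁' k₂ k₂' P : ℝ → ℝ}
    (H₁ : NearId ω k₁ k₁') (H₂ : NearId ω k₂ k₂') (hω : ω < 1)
    (c₁ : ∀ x, k₁ x + α₁ + P (k₁ x) = k₁ (x + θ₁))
    (c₂ : ∀ x, k₂ x + α₂ + P (k₂ x) = k₂ (x + θ₂)) :
    |θ₂ - θ₁ - (α₂ - α₁)| ≤ ω ^ 2 / (1 - ω) * |α₂ - α₁| := by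
  have hω0 : 0 ≤ ω := (abs_nonneg _).trans (H₁.le 0)
  have hω1 : 0 < 1 - ω := by linarith
  -- `ψ` is the inverse of `k₁`; it straightens `f_{α₁}` to the rotation by `θ₁`.
  obtain ⟨ψ, hψ⟩ := H₁.surjective.hasRightInverse
  have hψper : ∀ y, ψ (y + 1) = ψ y + 1 := fun y => H₁.injective hω (by
    rw [hψ, H₁.per, hψ])
  have hψlip : ∀ y z, |ψ y - ψ z| ≤ |y - z| / (1 - ω) := fun y z => by
    have := H₁.le_abs_sub (ψ y) (ψ z)
    rw [hψ, hψ] at this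
    rw [le_div_iff₀ hω1]; linarith
  have hψc : Continuous ψ := by
    refine (LipschitzWith.of_dist_le_mul (K := Real.toNNReal (1 / (1 - ω))) fun y z => ?_).continuous
    rw [Real.coe_toNNReal _ (by positivity), Real.dist_eq, Real.dist_eq]
    refine (hψlip y z).trans (le_of_eq ?_)
    ring
  have hπ : ∀ y z, |ψ y - y - (ψ z - z)| ≤ ω / (1 - ω) * |y - z| := fun y z => by
    have h1 := H₁.abs_sub_le (ψ y) (ψ z)
    rw [hψ, hψ] at h1
    rw [show ψ y - y - (ψ z - z) = -(y - z - (ψ y - ψ z)) by ring, abs_neg]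
    refine h1.trans ?_
    calc ω * |ψ y - ψ z| ≤ ω * (|y - z| / (1 - ω)) := by gcongr; exact hψlip y z
      _ = _ := by ring
  set Δ := α₂ - α₁ with hΔ
  -- `T` is a periodic function minus its translate by `Δ`. It is therefore of size `ω |Δ| / (1 -
  -- ω)` and has mean zero.
  set T : ℝ → ℝ := fun y => (ψ y - y) - (ψ (y - Δ) - (y - Δ)) with hT
  have hTc : Continuous T := by fun_prop
  have hTper : Function.Periodic T 1 := fun y => by
    simp only [hT]
    rw [hψper, show y + 1 - Δ = y - Δ + 1 by ring, hψper]; ring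
  have hTle : ∀ y, |T y| ≤ ω / (1 - ω) * |Δ| := fun y => by
    have := hπ y (y - Δ)
    rwa [sub_sub_cancel] at this
  have hk₂c := H₂.continuous
  have hTkper : Function.Periodic (fun x => T (k₂ x)) 1 := fun x => by
    simp only [H₂.per]; exact hTper _
  set κ : ℝ → ℝ := fun x => ψ (k₂ x) - x with hκ
  have hκper : Function.Periodic κ 1 := fun x => by
    simp only [hκ, H₂.per, hψper]; ring
  have hκc : Continuous κ := by fun_prop
  -- Since `k₂(x + θ₂) - Δ = f_{α₁}(k₂ x)`, its image under `ψ` is `ψ(k₂ x) + θ₁`. So `T ∘ k₂` is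
  -- the wanted constant plus a coboundary, which integrates to zero.
  have hid : ∀ x, T (k₂ (x + θ₂)) = (θ₂ - θ₁ - Δ) + (κ (x + θ₂) - κ x) := by
    intro x
    have h1 : ψ (k₂ (x + θ₂) - Δ) = ψ (k₂ x) + θ₁ := H₁.injective hω (by
      rw [hψ, ← c₁, hψ, ← c₂]; ring)
    simp only [hT, hκ]
    rw [h1]; ring
  have hint : θ₂ - θ₁ - Δ = ∫ x in (0 : ℝ)..1, T (k₂ x) := by
    rw [← integral_comp_add_of_periodic hTkper θ₂]
    simp_rw [hid]
    have i1 : IntervalIntegrable (fun x => κ (x + θ₂)) volume 0 1 :=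
      (by fun_prop : Continuous fun x => κ (x + θ₂)).intervalIntegrable 0 1
    rw [intervalIntegral.integral_add (by simp) (i1.sub (hκc.intervalIntegrable 0 1)),
      intervalIntegral.integral_sub i1 (hκc.intervalIntegrable 0 1),
      integral_comp_add_of_periodic hκper]
    simp
  -- Changing variables by `k₂` gives the integral of `T` over a period, which vanishes.
  have hzero : ∫ x in (0 : ℝ)..1, T (k₂ x) * k₂' x = 0 := by
    have h1 := intervalIntegral.integral_comp_mul_deriv (a := 0) (b := 1) (f := k₂) (f' := k₂')
      (g := T) (fun x _ => H₂.deriv x) H₂.cont.continuousOn hTc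
    simp only [Function.comp_apply] at h1
    have h2 := H₂.per 0
    rw [zero_add] at h2
    have i1 : Continuous fun x => ψ x - x := by fun_prop
    have i2 : Function.Periodic (fun x => ψ x - x) 1 := fun x => by simp only [hψper]; ring
    have h3 := i2.intervalIntegral_add_eq (k₂ 0) (k₂ 0 - Δ)
    have h4 : ∫ x in (k₂ 0)..(k₂ 0 + 1), T x = (∫ x in (k₂ 0)..(k₂ 0 + 1), (ψ x - x))
        - ∫ x in (k₂ 0)..(k₂ 0 + 1), (ψ (x - Δ) - (x - Δ)) :=
      intervalIntegral.integral_sub (i1.intervalIntegrable _ _)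
        ((by fun_prop : Continuous fun x => ψ (x - Δ) - (x - Δ)).intervalIntegrable _ _)
    rw [intervalIntegral.integral_comp_sub_right (fun x => ψ x - x)] at h4
    rw [h1, h2, h4, h3, show k₂ 0 + 1 - Δ = k₂ 0 - Δ + 1 by ring, sub_self]
  -- Subtracting the zero integral leaves a product of two factors of order `ω`: the gain from first
  -- to second order.
  have hfin : θ₂ - θ₁ - Δ = ∫ x in (0 : ℝ)..1, T (k₂ x) * (1 - k₂' x) := by
    have hc := H₂.cont
    simp_rw [mul_sub, mul_one]
    have i1 : Continuous fun x => T (k₂ x) := by fun_prop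
    have i2 : Continuous fun x => T (k₂ x) * k₂' x := by fun_prop
    rw [intervalIntegral.integral_sub (i1.intervalIntegrable 0 1) (i2.intervalIntegrable 0 1),
      ← hint, hzero, sub_zero]
  rw [hfin, ← Real.norm_eq_abs]
  refine (intervalIntegral.norm_integral_le_of_norm_le_const (C := ω ^ 2 / (1 - ω) * |Δ|)
    fun x _ => ?_).trans (le_of_eq (by simp))
  rw [norm_mul, Real.norm_eq_abs, Real.norm_eq_abs, abs_sub_comm 1]
  calc |T (k₂ x)| * |k₂' x - 1| ≤ (ω / (1 - ω) * |Δ|) * ω :=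
        mul_le_mul (hTle _) (H₂.le x) (abs_nonneg _) (by positivity)
    _ = _ := by ring

namespace IsConj

variable {p h : ℂ → ℂ} {θ ρ ω d α : ℝ}

lemma ofReal_re (H : IsConj p θ ρ ω d h α) (x : ℝ) : (((h x).re : ℝ) : ℂ) = h x :=
  Complex.ext (by simp) (by simp [H.real x])

lemma nearId (H : IsConj p θ ρ ω d h α) (hρ : 0 < ρ) :
    NearId ω (fun x : ℝ => (h x).re) (fun x : ℝ => (deriv h x).re) where
  deriv x := by
    have h1 := (H.diff.differentiableAt
      ((isOpen_strip ρ).mem_nhds (ofReal_mem_strip hρ x))).hasDerivAt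
    exact h1.real_of_complex
  cont := Complex.continuous_re.comp <|
    (H.diff.deriv (isOpen_strip ρ)).continuousOn.comp_continuous (by fun_prop) fun x =>
      ofReal_mem_strip hρ x
  le x := by
    have := (Complex.abs_re_le_norm _).trans (H.deriv_le x (ofReal_mem_strip hρ x))
    simpa using this
  per x := by
    have := H.per x (by simpa using hρ.le)
    push_cast
    rw [this]; simp

lemma conj_re (H : IsConj p θ ρ ω d h α) (hρ : 0 < ρ) (x : ℝ) :
    (h x).re + α + (fun y : ℝ => (p y).re) (h x).re = (h ((x + θ : ℝ) : ℂ)).re := by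
  have := H.conj x (by simpa using hρ.le)
  push_cast
  rw [← this]
  simp [H.ofReal_re]

lemma abs_sub_le {h₂ : ℂ → ℂ} {θ₂ α₂ : ℝ} (H₁ : IsConj p θ ρ ω d h α)
    (H₂ : IsConj p θ₂ ρ ω d h₂ α₂) (hρ : 0 < ρ) (hω : ω < 1) :
    |θ₂ - θ - (α₂ - α)| ≤ ω ^ 2 / (1 - ω) * |α₂ - α| :=
  abs_rotation_sub_param_le (P := fun y : ℝ => (p y).re) (H₁.nearId hρ) (H₂.nearId hρ) hω (H₁.conj_re hρ) (H₂.conj_re hρ)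

end IsConj

/-- Comparison of the measures of a bounded set and its image. -/
lemma volume_real_le_of_abs_sub_le {S : Set ℝ} {α : ℝ → ℝ} {c : ℝ} (hc0 : 0 ≤ c) (hc : c < 1)
    (hS : volume S ≠ ⊤)
    (h : ∀ x ∈ S, ∀ y ∈ S, |y - x - (α y - α x)| ≤ c * |α y - α x|) :
    volume.real S ≤ (1 + c) * volume.real (α '' S) := by
  have hup : ∀ x ∈ S, ∀ y ∈ S, |y - x| ≤ (1 + c) * |α y - α x| := fun x hx y hy => by
    have h1 := h x hx y hy
    have h2 := abs_sub_abs_le_abs_sub (y - x) (α y - α x)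
    linarith
  have hlo : ∀ x ∈ S, ∀ y ∈ S, |α y - α x| ≤ 1 / (1 - c) * |y - x| := fun x hx y hy => by
    have h1 := h x hx y hy
    have h2 := abs_sub_abs_le_abs_sub (α y - α x) (y - x)
    rw [abs_sub_comm (α y - α x)] at h2
    rw [one_div, inv_mul_eq_div, le_div_iff₀ (by linarith)]
    linarith
  have hinj : Set.InjOn α S := fun x hx y hy hxy => by
    have := hup x hx y hy
    rw [hxy, sub_self, abs_zero, mul_zero] at this
    exact (sub_eq_zero.1 (abs_nonpos_iff.1 this)).symm
  -- `volume.real` is 0 on sets of infinite measure, so finiteness of the image is needed before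
  -- passing to real numbers.
  have hfin : volume (α '' S) ≠ ⊤ := by
    have hl : LipschitzOnWith (Real.toNNReal (1 / (1 - c))) α S :=
      LipschitzOnWith.of_dist_le_mul fun x hx y hy => by
        rw [Real.coe_toNNReal _ (one_div_nonneg.2 (by linarith)), Real.dist_eq, Real.dist_eq]
        exact hlo y hy x hx
    have := hl.hausdorffMeasure_image_le (d := 1) zero_le_one
    rw [hausdorffMeasure_real] at this
    refine ne_top_of_le_ne_top ?_ this
    exact ENNReal.mul_ne_top (by simp) hS
  -- The Hausdorff measure bound for the Lipschitz inverse holds for arbitrary sets, so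
  -- measurability of the image plays no role.
  have hl : LipschitzOnWith (Real.toNNReal (1 + c)) (Function.invFunOn α S) (α '' S) :=
    LipschitzOnWith.of_dist_le_mul fun x hx y hy => by
      obtain ⟨x, hx, rfl⟩ := hx
      obtain ⟨y, hy, rfl⟩ := hy
      rw [Real.coe_toNNReal _ (by linarith), hinj.leftInvOn_invFunOn hx,
        hinj.leftInvOn_invFunOn hy, Real.dist_eq, Real.dist_eq]
      exact hup y hy x hx
  have := hl.hausdorffMeasure_image_le (d := 1) zero_le_one
  rw [hausdorffMeasure_real, hinj.leftInvOn_invFunOn.image_image] at this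
  have h2 := ENNReal.toReal_mono (ENNReal.mul_ne_top (by simp) hfin) this
  rw [ENNReal.toReal_mul] at h2
  refine h2.trans (le_of_eq ?_)
  simp [Measure.real, max_eq_left (by linarith : 0 ≤ 1 + c)]

/-! ### The measure of the Diophantine numbers -/

-- Gauss's identity that the totients of the divisors of `n` sum to `n` says that the Dirichlet
-- convolution `φ * 1` is the identity function.
open scoped LSeries.notation in
lemma LSeries_totient_mul_zeta {s : ℂ} (hs : 2 < s.re) :
    LSeries (fun n => (Nat.totient n : ℂ)) s * riemannZeta s = riemannZeta (s - 1) := by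
  have h1 : LSeriesSummable (fun n => (Nat.totient n : ℂ)) s := by
    refine LSeriesSummable_of_le_const_mul_rpow hs ⟨1, fun n _ => ?_⟩
    rw [show (2 : ℝ) - 1 = 1 by norm_num, Real.rpow_one, one_mul, Complex.norm_natCast]
    exact_mod_cast Nat.totient_le n
  have h2 : LSeriesSummable (1 : ℕ → ℂ) s := LSeriesSummable_one_iff.2 (by linarith)
  rw [← LSeries_one_eq_riemannZeta (by linarith), ← LSeries_one_eq_riemannZeta (s := s - 1)
    (by rw [Complex.sub_re, Complex.one_re]; linarith), ← LSeries_convolution' h1 h2]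
  refine tsum_congr fun n => ?_
  rcases eq_or_ne n 0 with rfl | hn
  · simp
  rw [LSeries.term_of_ne_zero hn, LSeries.term_of_ne_zero hn, LSeries.convolution_def]
  simp only [Pi.one_apply, mul_one]
  rw [Nat.sum_divisorsAntidiagonal (f := fun d _ => (Nat.totient d : ℂ)), ← Nat.cast_sum,
    Nat.sum_totient, Complex.cpow_sub _ _ (by exact_mod_cast hn), Complex.cpow_one]
  simp

lemma zetaReal_pos {s : ℝ} (hs : 1 < s) : 0 < zetaReal s := by
  have h : riemannZeta (s : ℂ) = ((∑' n : ℕ, 1 / (n : ℝ) ^ s : ℝ) : ℂ) := by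
    rw [zeta_eq_tsum_one_div_nat_cpow (by simpa using hs), Complex.ofReal_tsum]
    refine tsum_congr fun n => ?_
    push_cast
    rw [Complex.ofReal_cpow (by positivity)]; simp
  rw [zetaReal, h, Complex.ofReal_re]
  exact (Real.summable_one_div_nat_rpow.2 hs).tsum_pos (fun n => by positivity) 1 (by simp)

lemma hasSum_totient {τ : ℝ} (hτ : 1 < τ) :
    HasSum (fun n : ℕ => (Nat.totient n : ℝ) * (n : ℝ) ^ (-(τ + 1)))
      (zetaReal τ / zetaReal (τ + 1)) := by
  have hs : Summable fun n : ℕ => (Nat.totient n : ℝ) * (n : ℝ) ^ (-(τ + 1)) := by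
    refine Summable.of_nonneg_of_le (fun n => by positivity) (fun n => ?_)
      (Real.summable_nat_rpow.2 (by linarith : -τ < -1))
    rcases Nat.eq_zero_or_pos n with rfl | hn
    · simp; positivity
    · have hn' : (0 : ℝ) < n := by exact_mod_cast hn
      have h1 : (n : ℝ) ^ (-τ) = n * (n : ℝ) ^ (-(τ + 1)) := by
        rw [show -τ = 1 + -(τ + 1) by ring, Real.rpow_add hn', Real.rpow_one]
      rw [h1]
      gcongr
      exact_mod_cast Nat.totient_le n
  have h1 := LSeries_totient_mul_zeta (s := ((τ + 1 : ℝ) : ℂ)) (by rw [Complex.ofReal_re]; linarith)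
  have h2 : LSeries (fun n => (Nat.totient n : ℂ)) ((τ + 1 : ℝ) : ℂ)
      = ((∑' n : ℕ, (Nat.totient n : ℝ) * (n : ℝ) ^ (-(τ + 1)) : ℝ) : ℂ) := by
    rw [Complex.ofReal_tsum]
    refine tsum_congr fun n => ?_
    rcases eq_or_ne n 0 with rfl | hn
    · simp
    rw [LSeries.term_of_ne_zero hn, Real.rpow_neg (by positivity)]
    push_cast [Complex.ofReal_cpow (Nat.cast_nonneg n : (0 : ℝ) ≤ n)]
    rfl
  rw [h2] at h1
  have h3 := congrArg Complex.re h1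
  rw [Complex.re_ofReal_mul] at h3
  have h4 : (((τ + 1 : ℝ) : ℂ) - 1) = (τ : ℂ) := by push_cast; ring
  rw [h4] at h3
  have hpos := zetaReal_pos (s := τ + 1) (by linarith)
  have h5 : zetaReal τ / zetaReal (τ + 1)
      = ∑' n : ℕ, (Nat.totient n : ℝ) * (n : ℝ) ^ (-(τ + 1)) := by
    rw [div_eq_iff hpos.ne']; exact h3.symm
  rw [h5]
  exact hs.hasSum

/-- The numbers in `[0, 1]` that are too close to a reduced fraction with denominator `q`. -/
def resonant (γ τ : ℝ) (q : ℕ) : Set ℝ :=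
  if q = 1 then Set.Icc 0 γ ∪ Set.Icc (1 - γ) 1
  else ⋃ p ∈ (Finset.range q).filter (Nat.Coprime q),
    Metric.closedBall ((p : ℝ) / q) (γ * (q : ℝ) ^ (-(τ + 1)))

/-- There are `φ(q)` reduced fractions of denominator `q` modulo 1. For `q = 1` the half intervals
at `0` and `1` together make up one full interval, so the count remains `φ(1) = 1`. -/
lemma volume_resonant_le {γ τ : ℝ} (hγ : 0 ≤ γ) (q : ℕ) :
    volume (resonant γ τ q)
      ≤ ENNReal.ofReal (2 * γ * ((Nat.totient q : ℝ) * (q : ℝ) ^ (-(τ + 1)))) := by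
  rw [resonant]
  split_ifs with hq
  · subst hq
    refine (measure_union_le _ _).trans ?_
    rw [Real.volume_Icc, Real.volume_Icc, ← ENNReal.ofReal_add (by linarith) (by linarith)]
    refine ENNReal.ofReal_le_ofReal ?_
    simp; linarith
  · refine (measure_biUnion_finset_le _ _).trans ?_
    simp only [Real.volume_closedBall, Finset.sum_const, nsmul_eq_mul]
    rw [← Nat.totient_eq_card_coprime, ← ENNReal.ofReal_natCast,
      ← ENNReal.ofReal_mul (by positivity)]
    refine ENNReal.ofReal_le_ofReal (le_of_eq ?_)
    ring

/-- A resonance `p/q` can be reduced to lowest terms: with `q = mQ`, the distance gets smaller by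
`|m|` while the threshold only grows. As `γ < 1/2`, the reduced numerator lies between `0` and `Q`.
-/
lemma diff_Theta_subset {γ τ : ℝ} (hγ : 0 < γ) (hγ' : γ < 1 / 2) (hτ : 0 ≤ τ) :
    Set.Icc 0 1 \ Theta γ τ ⊆ ⋃ q : ℕ, resonant γ τ q := by
  rintro θ ⟨hθ, hn⟩
  have hn' : θ ∉ Diophantine γ τ := fun h => hn ⟨hθ, h⟩
  simp only [Diophantine, Set.mem_ofPred_eq, not_forall, not_le] at hn'
  obtain ⟨p, q, hq, hlt⟩ := hn'
  set x : ℚ := (p : ℚ) / q with hx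
  set Q := x.den with hQdef
  set P := x.num with hPdef
  have hQpos : 0 < Q := x.den_pos
  have hQ0 : (0 : ℝ) < Q := by exact_mod_cast hQpos
  obtain ⟨m, hm1, hm2⟩ : ∃ m : ℤ, p = m * P ∧ q = m * Q :=
    Rat.num_den_mk hq (by rw [hx, Rat.divInt_eq_div])
  have hm0 : m ≠ 0 := by rintro rfl; simp at hm2; exact hq hm2
  have hmabs : (1 : ℝ) ≤ |(m : ℝ)| := by exact_mod_cast Int.one_le_abs hm0
  have hclose : |(Q : ℝ) * θ - P| < γ * (Q : ℝ) ^ (-τ) := by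
    have e1 : (q : ℝ) * θ - p = m * ((Q : ℝ) * θ - P) := by
      rw [hm1, hm2]; push_cast; ring
    have e2 : |(q : ℝ)| = |(m : ℝ)| * Q := by
      rw [hm2]; push_cast; rw [abs_mul, abs_of_pos hQ0]
    rw [e1, e2, abs_mul, Real.mul_rpow (by positivity) hQ0.le] at hlt
    have h3 : |(m : ℝ)| ^ (-τ) ≤ 1 := Real.rpow_le_one_of_one_le_of_nonpos hmabs (by linarith)
    have h4 : 0 < (Q : ℝ) ^ (-τ) := by positivity
    calc |(Q : ℝ) * θ - P| ≤ |(m : ℝ)| * |(Q : ℝ) * θ - P| :=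
          le_mul_of_one_le_left (abs_nonneg _) hmabs
      _ < γ * (|(m : ℝ)| ^ (-τ) * (Q : ℝ) ^ (-τ)) := hlt
      _ ≤ γ * (1 * (Q : ℝ) ^ (-τ)) := by gcongr
      _ = _ := by rw [one_mul]
  have hQ1 : (1 : ℝ) ≤ Q := by exact_mod_cast hQpos
  have hhalf : |(Q : ℝ) * θ - P| < 1 / 2 := by
    have : (Q : ℝ) ^ (-τ) ≤ 1 := Real.rpow_le_one_of_one_le_of_nonpos hQ1 (by linarith)
    have : γ * (Q : ℝ) ^ (-τ) ≤ γ * 1 := by gcongr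
    linarith
  have hb := abs_lt.1 hhalf
  have hP0 : 0 ≤ P := by
    have h1 : (-1 : ℝ) < P := by nlinarith [hθ.1]
    have : (-1 : ℤ) < P := by exact_mod_cast h1
    omega
  have hPQ : P ≤ Q := by
    have h1 : (P : ℝ) < Q + 1 := by nlinarith [hθ.2]
    have : P < (Q : ℤ) + 1 := by exact_mod_cast h1
    omega
  rw [Set.mem_iUnion]
  refine ⟨Q, ?_⟩
  rw [resonant]
  have hcop : Nat.Coprime P.natAbs Q := x.reduced
  split_ifs with h1
  · rw [h1] at hclose hPQ
    simp only [Nat.cast_one, one_mul, Real.one_rpow, mul_one] at hclose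
    have hc := abs_lt.1 hclose
    have : P = 0 ∨ P = 1 := by push_cast at hPQ; omega
    rcases this with h | h <;> rw [h] at hc <;> push_cast at hc
    · left; exact ⟨hθ.1, by linarith⟩
    · right; exact ⟨by linarith, hθ.2⟩
  · simp only [Finset.mem_filter, Finset.mem_range, Set.mem_iUnion]
    refine ⟨P.natAbs, ⟨?_, hcop.symm⟩, ?_⟩
    · have hne : P.natAbs ≠ Q := fun h => h1 (by rw [h] at hcop; exact (Nat.coprime_self Q).1 hcop)
      omega
    · have e : ((P.natAbs : ℕ) : ℝ) = P := by
        rw [Nat.cast_natAbs, abs_of_nonneg hP0]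
      rw [Metric.mem_closedBall, Real.dist_eq, e]
      have h5 : θ - P / Q = ((Q : ℝ) * θ - P) / Q := by field_simp
      rw [h5, abs_div, abs_of_pos hQ0, div_le_iff₀ hQ0]
      have h6 : γ * (Q : ℝ) ^ (-(τ + 1)) * Q = γ * (Q : ℝ) ^ (-τ) := by
        rw [neg_add, Real.rpow_add hQ0, Real.rpow_neg_one]; field_simp
      rw [h6]; exact hclose.le

lemma isClosed_Theta (γ τ : ℝ) : IsClosed (Theta γ τ) := by
  refine isClosed_Icc.inter ?_
  simp only [Diophantine, Set.ofPred_forall]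
  refine isClosed_iInter fun p => isClosed_iInter fun q => isClosed_iInter fun _ => ?_
  exact isClosed_le continuous_const (by fun_prop)

lemma volume_Theta_ne_top (γ τ : ℝ) : volume (Theta γ τ) ≠ ⊤ :=
  ne_top_of_le_ne_top (by simp : volume (Set.Icc (0 : ℝ) 1) ≠ ⊤)
    (measure_mono Set.inter_subset_left)

theorem le_volume_Theta {γ τ : ℝ} (hγ : 0 < γ) (hγ' : γ < 1 / 2) (hτ : 1 < τ) :
    1 - 2 * γ * (zetaReal τ / zetaReal (τ + 1)) ≤ volume.real (Theta γ τ) := by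
  have hs := (hasSum_totient hτ).mul_left (2 * γ)
  have h1 : volume (Set.Icc 0 1 \ Theta γ τ)
      ≤ ENNReal.ofReal (2 * γ * (zetaReal τ / zetaReal (τ + 1))) := by
    refine (measure_mono (diff_Theta_subset hγ hγ' (by linarith))).trans
      ((measure_iUnion_le _).trans ?_)
    rw [← hs.tsum_eq, ENNReal.ofReal_tsum_of_nonneg (fun n => by positivity) hs.summable]
    exact ENNReal.tsum_le_tsum fun q => volume_resonant_le hγ.le q
  have hZ : 0 ≤ 2 * γ * (zetaReal τ / zetaReal (τ + 1)) := hs.nonneg fun n => by positivity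
  have h2 : volume.real (Set.Icc 0 1 \ Theta γ τ) ≤ 2 * γ * (zetaReal τ / zetaReal (τ + 1)) :=
    ENNReal.toReal_le_of_le_ofReal hZ h1
  have h3 := measureReal_sdiff (μ := volume) (s₁ := Set.Icc (0 : ℝ) 1) (s₂ := Theta γ τ)
    Set.inter_subset_left (isClosed_Theta γ τ).measurableSet (by simp)
  rw [h3] at h2
  simp at h2
  linarith

/-! ### The constants of the perturbative setting -/

/-- Because `τ^(-2τ) (2τ+1)^(2τ) ≥ 1` and `2τ + 1 ≥ 3`. The factor 3 pays for `1 + s ≤ 3s` in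
`second_order_le`. -/
lemma three_mul_cR_sq_le_cRhat {τ : ℝ} (hτ : 1 ≤ τ) : 3 * cR τ ^ 2 ≤ cRhat τ := by
  have h0 : 0 < τ := by linarith
  rw [cRhat]
  refine mul_le_mul_of_nonneg_right ?_ (sq_nonneg _)
  have h1 : τ ^ (2 * τ) ≤ (2 * τ + 1) ^ (2 * τ) :=
    Real.rpow_le_rpow h0.le (by linarith) (by linarith)
  rw [Real.rpow_add (by linarith), Real.rpow_one, Real.rpow_neg h0.le, inv_mul_eq_div,
    le_div_iff₀ (by positivity), mul_comm]
  exact mul_le_mul h1 (by linarith) (by norm_num) (by positivity)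

lemma cR_pos {τ : ℝ} (hτ : 0 < τ) : 0 < cR τ := by
  have h1 := hurwitzTwo_pos (a := (2 : ℝ) ^ τ) (by positivity)
  have h2 := Real.Gamma_pos_of_pos (s := 2 * τ + 1) (by linarith)
  unfold cR; positivity

section Constants

variable {r ρ δ ρinf γ τ s c2 c3 E : ℝ} {d : Data}

lemma C1_eq (hd : d = perturbativeData r ρ δ ρinf γ τ s c2 c3 E) : d.C1 = stepConst s τ := by
  subst hd; simp [Data.C1, perturbativeData, stepConst]

lemma C2_eq (hd : d = perturbativeData r ρ δ ρinf γ τ s c2 c3 E) :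
    d.C2 = s ^ 3 * stepConst s τ := by
  rw [← C1_eq hd]; subst hd; simp only [Data.C2, perturbativeData]; ring

lemma C3_eq (hd : d = perturbativeData r ρ δ ρinf γ τ s c2 c3 E) :
    d.C3 = stepConst s τ * γ * δ ^ (τ - 1) + 1 / 2 * c2 * (s * stepConst s τ) ^ 2 := by
  rw [← C1_eq hd]; subst hd; simp [Data.C3, perturbativeData]

lemma C8Lip_eq (hd : d = perturbativeData r ρ δ ρinf γ τ s c2 c3 E) :
    d.C8Lip = 2 * s ^ 3 * (s - 1) * (1 + s ^ 2) * (γ * δ ^ (τ + 1)) + s ^ 2 := by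
  subst hd; simp [Data.C8Lip, Data.C0Lip, perturbativeData]; ring

lemma weightedErr_eq (hd : d = perturbativeData r ρ δ ρinf γ τ s c2 c3 E) (hE : 0 ≤ E) :
    d.weightedErr = E := by
  subst hd; simp [Data.weightedErr, perturbativeData, hE]

/-- Only the `ĉ_R` part of `L₇` is kept. It does not depend on `γ` or on the perturbation, and
serves both to dominate `ω²` and to bound `𝕮₁^Lip` from below. -/
lemma le_C7Lip (hd : d = perturbativeData r ρ δ ρinf γ τ s c2 c3 E) (hs : 1 < s) (hγ : 0 < γ)
    (hδ : 0 < δ) :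
    s * ((1 + s) * (1 + s ^ 2) * s) * cRhat τ ≤ d.C7Lip := by
  have hc := cR_nonneg τ
  have hs1 : 0 ≤ s - 1 := by linarith
  have h0 : 0 ≤ d.C0Lip := by
    subst hd; simp only [Data.C0Lip, perturbativeData, mul_zero, zero_mul, add_zero]; positivity
  have h1 : 0 ≤ d.C1Lip := by
    have : d.C1Lip = s * (d.C0Lip + (1 + s * s) * s * (s - 1 + (s - 1))) := by
      subst hd; simp [Data.C1Lip, perturbativeData]
    rw [this]; positivity
  have h2 : d.C2Lip = cR τ * d.C1Lip * γ * δ ^ (τ + 1) + cRhat τ * (1 + s * s) * s := by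
    subst hd; simp [Data.C2Lip, perturbativeData]
  have h3 : d.C3Lip = d.C2Lip * (s + 1)
      + (s - 1) * cR τ * (1 + s * s) * s * γ * δ ^ (τ + 1) := by
    subst hd; simp [Data.C3Lip, perturbativeData]
  have h4 : d.C7Lip = (s - 1) * d.C1 * γ * δ ^ (τ + 1) + s * d.C3Lip + s * d.C1 := by
    subst hd; simp [Data.C7Lip, Data.C4Lip, perturbativeData]
  have hC1 : 0 ≤ d.C1 := by rw [C1_eq hd]; exact stepConst_nonneg (by linarith)
  rw [h4, h3, h2]
  have e1 : 0 ≤ cR τ * d.C1Lip * γ * δ ^ (τ + 1) := by positivity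
  have e2 : 0 ≤ (s - 1) * cR τ * (1 + s * s) * s * γ * δ ^ (τ + 1) := by positivity
  have e3 : 0 ≤ (s - 1) * d.C1 * γ * δ ^ (τ + 1) := by positivity
  nlinarith [mul_nonneg e1 (by positivity : 0 ≤ s * (s + 1)), mul_nonneg e2 (by linarith : 0 ≤ s),
    mul_nonneg hC1 (by linarith : 0 ≤ s)]

lemma Sig_eq (hd : d = perturbativeData r ρ δ ρinf γ τ s c2 c3 E) (t l : ℝ) :
    d.Sig t l = ∑' j, sigTerm ((ρ - ρinf) / (ρ - 2 * δ - ρinf)) t l j := by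
  subst hd; rfl

/-- What the smallness condition on the norm of the perturbation says about the Newton iteration
and about the dependence on the rotation number. -/
lemma smallness (hd : d = perturbativeData r ρ δ ρinf γ τ s c2 c3 E) (hδ : 0 < δ)
    (hρinf : 0 < ρinf) (hρ : ρinf < ρ - 2 * δ) (hρr : ρ < r) (hs : 1 < s)
    (hγ : 0 < γ) (hc2 : 0 ≤ c2) (hE : 0 ≤ E)
    (hsmall : d.frakC1Lip * E / (γ ^ 2 * ρ ^ (2 * τ + 2)) < 1) :
    0 ≤ d.κ ∧ d.κ ≤ d.μ ∧ d.μ < 1 ∧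
      s * stepConst s τ * E / (γ * δ ^ τ) * d.Sig d.κ τ < r - ρ ∧
      s ^ 4 * (s * stepConst s τ * E / (γ * δ ^ (τ + 1)) * d.Sig d.κ (τ - 1)) < s - 1 ∧
      d.C7Lip * d.Sig d.μ (-2) * (E / (γ * δ ^ (τ + 1))) ≤ (s - 1) * (γ * δ ^ (τ + 1)) ∧
      d.C7Lip * d.Sig d.μ (-2) * (ρ / δ) ^ (2 * τ + 2) / (s - 1) ≤ d.frakC1Lip := by
  have hρ0 : 0 < ρ := by linarith
  have hW : 0 < γ ^ 2 * ρ ^ (2 * τ + 2) := by positivity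
  have hentry : ∀ X, X ≤ d.frakC1Lip → X * E / (γ ^ 2 * ρ ^ (2 * τ + 2)) < 1 := fun X hX =>
    lt_of_le_of_lt (by gcongr) hsmall
  have hdρ : d.ρ = ρ := by subst hd; rfl
  have hdδ : d.δ = δ := by subst hd; rfl
  have hdγ : d.γ = γ := by subst hd; rfl
  have hdτ : d.τ = τ := by subst hd; rfl
  have hda3 : d.a3 = ρ / δ := by subst hd; rfl
  have hderr : d.err = E := by subst hd; rfl
  have ha1 : 1 < d.a1 := by
    have : d.a1 = (ρ - ρinf) / (ρ - 2 * δ - ρinf) := by subst hd; rfl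
    rw [this, one_lt_div (by linarith)]; linarith
  have ha0 : 0 < d.a1 := by linarith
  have hC1 := stepConst_nonneg (s := s) (τ := τ) (by linarith)
  have hC3 : 0 ≤ d.C3 := by rw [C3_eq hd]; positivity
  have hC36 : d.C3 ≤ d.C6Lip := le_max_left _ _
  have hD : 0 < δ ^ τ := by positivity
  have hR : 0 < ρ ^ τ := by positivity
  have hA : 0 < d.a1 ^ τ := by positivity
  have h2 : ∀ x : ℝ, 0 < x → x ^ (2 * τ) = (x ^ τ) ^ 2 := fun x hx => by
    rw [← Real.rpow_natCast, ← Real.rpow_mul hx.le]; push_cast; ring_nf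
  have h22 : ∀ x : ℝ, 0 < x → x ^ (2 * τ + 2) = (x ^ τ) ^ 2 * x ^ 2 := fun x hx => by
    rw [Real.rpow_add hx, h2 x hx]; norm_cast
  have h1 : ∀ x : ℝ, 0 < x → x ^ (τ + 1) = x ^ τ * x := fun x hx => by
    rw [Real.rpow_add hx, Real.rpow_one]
  have hκ : d.κ = d.C3 * d.a1 ^ (2 * τ) / (γ ^ 2 * δ ^ (2 * τ)) * E := by
    rw [Data.κ, hdγ, hdδ, hdτ, hderr]
  have hμ : d.μ = d.C6Lip * d.a1 ^ (2 * τ) / (γ ^ 2 * δ ^ (2 * τ)) * E := by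
    rw [Data.μ, weightedErr_eq hd hE, hdγ, hdδ, hdτ]
  -- The powers of `a₃` in `𝕮₁^Lip` trade `ρ` for `δ`, so each entry turns into a condition at the
  -- scale of the first strip loss.
  have hC4 : d.C4 * E / (γ * δ ^ (τ + 1)) < 1 := by
    have h := hentry (d.a3 ^ (d.τ + 1) * d.C4 * d.γ * d.ρ ^ (d.τ + 1))
      ((le_max_left _ _).trans (le_max_right _ _))
    rw [hda3, hdτ, hdγ, hdρ, h1 (ρ / δ) (by positivity), Real.div_rpow hρ0.le hδ.le, h1 ρ hρ0,
      h22 ρ hρ0] at h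
    rw [h1 δ hδ]
    convert h using 1
    field_simp
  have hx : 0 ≤ E / (γ * δ ^ (τ + 1)) := by positivity
  have hC4le : ∀ X, X ≤ d.C4 → X * (E / (γ * δ ^ (τ + 1))) < 1 := fun X hX => by
    rw [mul_div_assoc] at hC4
    exact lt_of_le_of_lt (mul_le_mul_of_nonneg_right hX hx) hC4
  refine ⟨?_, ?_, ?_, ?_, ?_, ?_, ?_⟩
  · rw [hκ]; positivity
  · rw [hκ, hμ]; gcongr
  · have h := hentry ((d.a1 * d.a3) ^ (2 * d.τ) * d.ρ ^ 2 * d.C6Lip) (le_max_left _ _)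
    rw [hda3, hdτ, hdρ, h2 _ (by positivity), Real.mul_rpow ha0.le (by positivity),
      Real.div_rpow hρ0.le hδ.le, h22 ρ hρ0] at h
    rw [hμ, h2 _ ha0, h2 _ hδ]
    convert h using 1
    field_simp
  · have h := hC4le _ (le_max_left _ _)
    have e : d.distStrip = r - ρ := by subst hd; rfl
    have e' : d.σ1 = s := by subst hd; rfl
    rw [e, e', C1_eq hd, hdδ, hdτ, h1 δ hδ] at h
    have hr : 0 < r - ρ := by linarith
    rw [div_mul_eq_mul_div, div_lt_one hr] at h
    refine lt_of_eq_of_lt ?_ h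
    field_simp
  -- The `σ_b` entry: `s² C₂ = s⁴ (s C₁)` produces the factor `s⁴`, from which all later bounds on
  -- `ω` follow.
  · have h := hC4le _ ((le_max_right _ _).trans ((le_max_right _ _).trans (le_max_right _ _)))
    have e : d.σb - d.invAvgB = s - 1 := by subst hd; rfl
    have e' : d.σb = s := by subst hd; rfl
    rw [e, e', C2_eq hd, hdτ, div_mul_eq_mul_div, div_lt_one (by linarith)] at h
    refine lt_of_eq_of_lt ?_ h
    ring
  · have h := hentry (d.C7Lip * d.Sig d.μ (-2) * d.a3 ^ (2 * d.τ + 2) / (d.β1 - d.lipDh))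
      ((le_max_left _ _).trans ((le_max_right _ _).trans
        ((le_max_right _ _).trans (le_max_right _ _))))
    have e : d.β1 - d.lipDh = s - 1 := by subst hd; simp [perturbativeData]
    have hs1 : 0 < s - 1 := by linarith
    rw [e, hda3, hdτ, Real.div_rpow hρ0.le hδ.le, h22 ρ hρ0, h22 δ hδ] at h
    rw [h1 δ hδ]
    have e2 : d.C7Lip * d.Sig d.μ (-2) * ((ρ ^ τ) ^ 2 * ρ ^ 2 / ((δ ^ τ) ^ 2 * δ ^ 2)) / (s - 1) * E
          / (γ ^ 2 * ((ρ ^ τ) ^ 2 * ρ ^ 2))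
        = d.C7Lip * d.Sig d.μ (-2) * (E / (γ * (δ ^ τ * δ)))
          / ((s - 1) * (γ * (δ ^ τ * δ))) := by
      field_simp
    rw [e2, div_lt_one (by positivity)] at h
    exact h.le
  · have e : d.β1 - d.lipDh = s - 1 := by subst hd; simp [perturbativeData]
    have h : d.C7Lip * d.Sig d.μ (-2) * d.a3 ^ (2 * d.τ + 2) / (d.β1 - d.lipDh) ≤ d.frakC1Lip :=
      (le_max_left _ _).trans ((le_max_right _ _).trans
        ((le_max_right _ _).trans (le_max_right _ _)))
    rwa [e, hda3, hdτ] at h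

end Constants

/-- The second order correction of the rotation number is dominated by the measure defect. -/
lemma second_order_le {s C R x D S S' S₂ L ω : ℝ} (hs : 1 < s) (hx : 0 ≤ x) (hD : 0 ≤ D)
    (hS : 0 ≤ S) (hSS' : S ≤ S') (hSS₂ : S ≤ S₂) (hR : 3 * C ^ 2 ≤ R)
    (hL : s * ((1 + s) * (1 + s ^ 2) * s) * R ≤ L) (h : L * S₂ * x ≤ (s - 1) * D)
    (hω : ω = s * ((1 + s) * C * (1 + s * s) * s) * x * S) :
    2 * ω ^ 2 ≤ (2 * s ^ 3 * (s - 1) * (1 + s ^ 2) * D + s ^ 2) * S' * x := by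
  set k := (1 + s) * (1 + s ^ 2) * s with hk
  have hk0 : 0 < k := by positivity
  have hR0 : 0 ≤ R := by nlinarith [sq_nonneg C]
  have hs1 : 0 < s - 1 := by linarith
  have hs0 : 0 < s := by linarith
  have hL0 : 0 ≤ L := le_trans (by positivity) hL
  have h1 : s * k * R * S * x ≤ (s - 1) * D := by
    refine le_trans ?_ h
    gcongr
  -- One of the two factors `x` in `ω²` is absorbed by the smallness condition `h1`; what is left is
  -- linear in `x`.
  have h2 : 3 * ω ^ 2 ≤ ((s - 1) * D) * (s * k * S * x) := by
    calc 3 * ω ^ 2 = (3 * C ^ 2) * (s * k * S * x) ^ 2 := by rw [hω, hk]; ring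
      _ ≤ R * (s * k * S * x) ^ 2 := by gcongr
      _ = (s * k * R * S * x) * (s * k * S * x) := by ring
      _ ≤ _ := by gcongr
  have h3 : ((s - 1) * D) * (s * k * S * x)
      ≤ 3 * (s ^ 3 * (s - 1) * (1 + s ^ 2) * D * S * x) := by
    have : 0 ≤ s ^ 2 * (s - 1) * (1 + s ^ 2) * D * S * x := by positivity
    rw [hk]
    nlinarith [mul_nonneg this (by linarith : 0 ≤ 2 * s - 1)]
  have h4 : 2 * (s ^ 3 * (s - 1) * (1 + s ^ 2) * D * S * x)
      ≤ (2 * s ^ 3 * (s - 1) * (1 + s ^ 2) * D + s ^ 2) * S' * x := by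
    calc _ = (2 * s ^ 3 * (s - 1) * (1 + s ^ 2) * D) * S * x := by ring
      _ ≤ _ := by
        gcongr
        exact le_add_of_nonneg_right (by positivity)
  linarith

/-! ### The measure of the set of parameters -/

/-- Periodicity reduces the strip to a compact rectangle. Without boundedness the real supremum in
`stripNorm` would be the default value 0. -/
lemma IsPer.bddAbove {ρ ρ' : ℝ} {g : ℂ → ℂ} (hg : IsPer ρ' g) (h : ρ ≤ ρ') :
    BddAbove (Set.range fun z : {z : ℂ // |z.im| < ρ} => ‖g z.1‖) := by
  have hK : IsCompact (Set.Icc (0 : ℝ) 1 ×ℂ Set.Icc (-ρ') ρ') :=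
    isCompact_Icc.reProdIm isCompact_Icc
  obtain ⟨C, hC⟩ := hK.exists_bound_of_continuousOn (f := g) (hg.continuousOn.mono fun z hz =>
    abs_le.2 (Complex.mem_reProdIm.1 hz).2)
  refine ⟨C, ?_⟩
  rintro _ ⟨⟨z, hz⟩, rfl⟩
  have hz' : |z.im| ≤ ρ' := hz.le.trans h
  have hper : ∀ n : ℤ, ∀ w : ℂ, |w.im| ≤ ρ' → g (w + n) = g w := by
    intro n
    induction n using Int.induction_on with
    | zero => simp
    | succ n ih =>
      intro w hw
      push_cast at ih ⊢
      rw [← add_assoc, hg.periodic _ (by simpa using hw), ih w hw]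
    | pred n ih =>
      intro w hw
      have := hg.periodic (w + ((-(n : ℤ) - 1 : ℤ) : ℂ)) (by simpa using hw)
      push_cast at ih this ⊢
      rw [← this, show w + (-(n : ℂ) - 1) + 1 = w + -(n : ℂ) by ring, ih w hw]
  have hw := hC (z + ((-⌊z.re⌋ : ℤ) : ℂ)) (Complex.mem_reProdIm.2 ⟨by
    have h1 := Int.floor_le z.re
    have h2 := Int.lt_floor_add_one z.re
    rw [Complex.add_re, Complex.intCast_re]
    push_cast
    constructor <;> linarith, by simpa using abs_le.1 hz'⟩)
  rwa [hper _ z hz'] at hw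

lemma IsPer.norm_le_stripNorm {ρ ρ' : ℝ} {g : ℂ → ℂ} (hg : IsPer ρ' g) (h : ρ ≤ ρ') {z : ℂ}
    (hz : z ∈ strip ρ) : ‖g z‖ ≤ stripNorm ρ g :=
  le_ciSup (hg.bddAbove h) ⟨z, hz⟩

lemma stripNorm_nonneg (ρ : ℝ) (g : ℂ → ℂ) : 0 ≤ stripNorm ρ g :=
  Real.iSup_nonneg fun _ => norm_nonneg _

lemma IsPer.perturbation {ρ r ε c : ℝ} {g : ℂ → ℂ} (hg : IsPer ρ g) (hr : r ≤ ρ) (hε : 0 ≤ ε)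
    (hc : ∀ z : ℂ, |z.im| < r → ε * ‖iteratedDeriv 2 g z‖ ≤ c) :
    Perturbation r c fun z => ε * g z where
  hol := ⟨(hg.holomorphic.mono (strip_mono hr)).const_mul _, fun z hz => by
    rw [hg.periodic z ((mem_strip.1 hz).le.trans hr)]⟩
  real x := by simp [hg.real x]
  deriv2_le z hz := by
    have h1 : deriv (deriv fun z => (ε : ℂ) * g z) z = ε * deriv (deriv g) z := by
      have : (deriv fun z => (ε : ℂ) * g z) = fun z => (ε : ℂ) * deriv g z := by
        funext w; exact deriv_const_mul_field _
      rw [this]; exact deriv_const_mul_field _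
    have h2 := hc z hz
    rw [iteratedDeriv_succ, iteratedDeriv_one] at h2
    rw [h1, norm_mul, Complex.norm_real, Real.norm_of_nonneg hε]
    exact h2

lemma IsConj.isCircleMap {p h : ℂ → ℂ} {θ ρ ω d α : ℝ} (H : IsConj p θ ρ ω d h α) (hρ : 0 < ρ)
    (hω : ω < 1) : IsCircleMap ρ h where
  sub_id := ⟨H.cont.sub continuousOn_id, H.diff.sub differentiableOn_id, fun z hz => by
    rw [H.per z hz]; ring, fun x => by simp [H.real x]⟩
  homeo := (H.nearId hρ).strictMono hω

lemma IsConj.deriv_ne_zero {p h : ℂ → ℂ} {θ ρ ω d α : ℝ} (H : IsConj p θ ρ ω d h α)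
    (hω : ω < 1) {z : ℂ} (hz : z ∈ strip ρ) : deriv h z ≠ 0 := by
  intro h0
  have := H.deriv_le z hz
  rw [h0, zero_sub, norm_neg, norm_one] at this
  linarith

lemma IsConj.abs_im_lt {p h : ℂ → ℂ} {θ ρ ω d α r : ℝ} (H : IsConj p θ ρ ω d h α)
    (hr : ρ + d < r) {z : ℂ} (hz : |z.im| ≤ ρ) : |(h z).im| < r := by
  have h1 := (Complex.abs_im_le_norm _).trans (H.dist_le z hz)
  rw [Complex.sub_im] at h1
  have h2 := abs_sub_abs_le_abs_sub (h z).im z.im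
  linarith

/-- The conjugacies, and the second order estimate of the parameters. -/
lemma exists_family {r ρhat ρ δ ρinf γ τ s c2 c3 ε : ℝ} {g : ℂ → ℂ} {d : Data}
    (hd : d = perturbativeData r ρ δ ρinf γ τ s c2 c3 (ε * stripNorm ρ g))
    (hτ : 1 < τ) (hδ : 0 < δ) (hρinf : 0 < ρinf) (hρ : ρinf < ρ - 2 * δ)
    (hρr : ρ < r) (hr : r ≤ ρhat) (hs : 1 < s) (hγ : 0 < γ) (hg : IsPer ρhat g) (hε : 0 ≤ ε)
    (hc2 : ∀ z : ℂ, |z.im| < r → ε * ‖iteratedDeriv 2 g z‖ ≤ c2)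
    (hsmall : d.frakC1Lip * (ε * stripNorm ρ g) / (γ ^ 2 * ρ ^ (2 * τ + 2)) < 1) :
    ∃ (h : ℝ → ℂ → ℂ) (α : ℝ → ℝ) (ω b : ℝ), 0 ≤ ω ∧ ω ≤ 1 / 2 ∧ ρinf + b < r ∧
      2 * ω ^ 2 ≤ d.C8Lip * d.Sig d.μ (τ - 1) * (ε * stripNorm ρ g / (γ * δ ^ (τ + 1))) ∧
      ∀ θ ∈ Theta γ τ, IsConj (fun z => ε * g z) θ ρinf ω b (h θ) (α θ) := by
  set E := ε * stripNorm ρ g with hE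
  have hE0 : 0 ≤ E := mul_nonneg hε (stripNorm_nonneg ρ g)
  have hρ0 : 0 < ρ := by linarith
  have hc20 : 0 ≤ c2 :=
    le_trans (mul_nonneg hε (norm_nonneg _)) (hc2 0 (by simp; linarith))
  obtain ⟨hκ0, hκμ, hμ, hdist, hω4, hLip, -⟩ :=
    smallness hd hδ hρinf hρ hρr hs hγ hc20 hE0 hsmall
  have hda1 : d.a1 = (ρ - ρinf) / (ρ - 2 * δ - ρinf) := by subst hd; rfl
  have ha1 : 1 < d.a1 := by
    rw [hda1, one_lt_div (by linarith)]; linarith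
  set ω := s * stepConst s τ * E / (γ * δ ^ (τ + 1)) * d.Sig d.κ (τ - 1) with hω
  set b := s * stepConst s τ * E / (γ * δ ^ τ) * d.Sig d.κ τ with hb
  have hC1 : 0 ≤ stepConst s τ := stepConst_nonneg (by linarith)
  have hSκ : 1 ≤ d.Sig d.κ (τ - 1) :=
    one_le_tsum_sigTerm (by linarith) hκ0 (by linarith) _
  have hω0 : 0 ≤ ω := by positivity
  -- Together with `s⁴ ω < s - 1` this keeps `ω` below `1/2`, however large `s` is.
  have hs4 : 4 * (s - 1) ≤ s ^ 4 := by nlinarith [sq_nonneg (s ^ 2 - 1), sq_nonneg (s - 1)]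
  have hs1 : 1 ≤ s ^ 3 := one_le_pow₀ hs.le
  have hs14 : 1 ≤ s ^ 4 := one_le_pow₀ hs.le
  have hω2 : ω ≤ 1 / 2 := by
    by_contra hlt
    push Not at hlt
    nlinarith
  have hωs : ω ≤ s - 1 := le_trans (le_mul_of_one_le_left hω0 hs14) hω4.le
  have hωs2 : s * ω ≤ s - 1 := by
    refine le_trans ?_ hω4.le
    have : 0 ≤ s * ω := by positivity
    calc s * ω ≤ s ^ 3 * (s * ω) := le_mul_of_one_le_left this hs1
      _ = _ := by ring
  have hex : ∀ θ ∈ Theta γ τ, ∃ (h : ℂ → ℂ) (α : ℝ),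
      IsConj (fun z => ε * g z) θ ρinf ω b h α := fun θ hθ =>
    exists_isConj (κ := d.κ) (E := E) (C₃ := d.C3) (a := d.a1) (s := s) hτ.le hγ hθ.2 hδ hρinf hρ
      (hg.perturbation hr hε hc2) (fun z hz => by
        rw [norm_mul, Complex.norm_real, Real.norm_of_nonneg hε]
        exact mul_le_mul_of_nonneg_left (hg.norm_le_stripNorm (by linarith) hz) hε)
      (C3_eq hd) hda1 (by subst hd; rfl) hκ0 (by linarith) hω hb (by linarith) (by linarith)
      (by linarith) (by linarith) (by linarith)
  choose! h α hconj using hex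
  refine ⟨h, α, ω, b, hω0, hω2, by linarith, ?_, hconj⟩
  rw [C8Lip_eq hd]
  refine second_order_le (C := cR τ) (R := cRhat τ) (L := d.C7Lip) (S := d.Sig d.κ (τ - 1))
    (S₂ := d.Sig d.μ (-2)) hs (by positivity) (by positivity) (by linarith)
    (tsum_sigTerm_mono ha1 hκ0 hκμ hμ le_rfl) (tsum_sigTerm_mono ha1 hκ0 hκμ hμ (by linarith))
    (three_mul_cR_sq_le_cRhat hτ.le) (le_C7Lip hd hs hγ hδ) hLip ?_
  rw [hω, stepConst]; ring

/-- The measure defect is `γ C₂ ρ^(τ+1) / C₁` times the quantity that the smallness condition makes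
less than 1. -/
lemma measure_defect_lt {ε C₁ C₂ G γ ρ τ : ℝ} (hρ : 0 < ρ) (hγ : 0 < γ) (hC₁ : 0 < C₁)
    (hC₂ : 0 < C₂) (h : ε * (C₁ * G / (γ ^ 2 * ρ ^ (2 * τ + 2))) < 1) :
    ε * (C₂ * G / (γ * ρ ^ (τ + 1))) < γ * (C₂ * ρ ^ (τ + 1) / C₁) := by
  have e : ε * (C₂ * G / (γ * ρ ^ (τ + 1)))
      = γ * (C₂ * ρ ^ (τ + 1) / C₁) * (ε * (C₁ * G / (γ ^ 2 * ρ ^ (2 * τ + 2)))) := by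
    have hR : 0 < ρ ^ (τ + 1) := by positivity
    rw [show 2 * τ + 2 = (τ + 1) + (τ + 1) by ring, Real.rpow_add hρ (τ + 1) (τ + 1)]
    generalize ρ ^ (τ + 1) = R at hR
    field_simp
  rw [e]
  exact mul_lt_of_lt_one_right (by positivity) h

/-- Since `(1 - A)(1 + A) ≤ 1`, the upper bound on `m` inverts. If `1 - A` and `1 - B` are both
negative, their product is positive and says nothing about `m'`; but then `Q > A > 1` makes `1 - (Q
+ B)` negative, so the last inequality survives. -/
lemma measure_image_bounds {A B Q m m' : ℝ} (hA : 0 ≤ A) (hB : 0 ≤ B) (hAQ : A < Q) (hm' : 0 ≤ m')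
    (hm : 0 ≤ m) (hBm : 1 - B ≤ m) (hmm' : m ≤ (1 + A) * m') :
    (1 - A) * m ≤ m' ∧ (0 ≤ 1 - A ∨ 0 ≤ 1 - B → (1 - A) * (1 - B) ≤ m') ∧
      1 - (Q + B) < (1 - A) * (1 - B) ∧ 1 - (Q + B) < m' := by
  have hAB := mul_nonneg hA hB
  have hmain : (1 - A) * m ≤ m' := by
    rcases le_total A 1 with h1 | h1
    · have h3 := mul_le_mul_of_nonneg_left hmm' (by linarith : 0 ≤ 1 - A)
      have h4 : (1 - A) * ((1 + A) * m') = m' - A ^ 2 * m' := by ring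
      have h5 : 0 ≤ A ^ 2 * m' := by positivity
      linarith
    · exact le_trans (mul_nonpos_of_nonpos_of_nonneg (by linarith) hm) hm'
  have hlt : 1 - (Q + B) < (1 - A) * (1 - B) := by
    have : (1 - A) * (1 - B) = 1 - A - B + A * B := by ring
    linarith
  have hprod : 0 ≤ 1 - A ∨ 0 ≤ 1 - B → (1 - A) * (1 - B) ≤ m' := by
    intro hor
    rcases le_or_gt 0 (1 - A) with h1 | h1
    · exact (mul_le_mul_of_nonneg_left hBm h1).trans hmain
    · exact le_trans (mul_nonpos_of_nonpos_of_nonneg h1.le (hor.resolve_left h1.not_ge)) hm'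
  refine ⟨hmain, hprod, hlt, ?_⟩
  rcases le_or_gt 0 (1 - A) with h1 | h1
  · exact hlt.trans_le (hprod (Or.inl h1))
  · linarith

/-- The two constants of the measure estimate are comparable, uniformly in the perturbation. -/
lemma frakC_bounds {r ρ δ ρinf γ τ s c2 c3 E : ℝ} {d : Data}
    (hd : d = perturbativeData r ρ δ ρinf γ τ s c2 c3 E)
    (hτ : 1 < τ) (hδ : 0 < δ) (hρinf : 0 < ρinf) (hρ : ρinf < ρ - 2 * δ)
    (hρr : ρ < r) (hs : 1 < s) (hγ : 0 < γ) (hγ' : γ < 1 / 2) (hc2 : 0 ≤ c2) (hE : 0 ≤ E)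
    (hsmall : d.frakC1Lip * E / (γ ^ 2 * ρ ^ (2 * τ + 2)) < 1) :
    s * ((1 + s) * (1 + s ^ 2) * s) * cRhat τ * (ρ / δ) ^ (2 * τ + 2) / (s - 1) ≤ d.frakC1Lip ∧
      0 < d.frakC2Lip ∧
      d.frakC2Lip ≤ (ρ / δ) ^ (τ + 1)
        * (2 * s ^ 3 * (s - 1) * (1 + s ^ 2) * (1 / 2 * δ ^ (τ + 1)) + s ^ 2)
        * (1 - ((ρ - ρinf) / (ρ - 2 * δ - ρinf)) ^ (-(τ - 1)))⁻¹ := by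
  obtain ⟨hκ0, hκμ, hμ, -, -, -, hC⟩ := smallness hd hδ hρinf hρ hρr hs hγ hc2 hE hsmall
  have hρ0 : 0 < ρ := by linarith
  have hs1 : 0 < s - 1 := by linarith
  have ha1 : 1 < (ρ - ρinf) / (ρ - 2 * δ - ρinf) := by
    rw [one_lt_div (by linarith)]; linarith
  have hL := le_C7Lip hd hs hγ hδ
  have hcR := three_mul_cR_sq_le_cRhat hτ.le
  have hR : 0 ≤ cRhat τ := by nlinarith [sq_nonneg (cR τ)]
  have hL0 : 0 ≤ d.C7Lip := le_trans (by positivity) hL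
  have hS2 : 1 ≤ d.Sig d.μ (-2) := by
    rw [Sig_eq hd]; exact one_le_tsum_sigTerm (by linarith) (by linarith) hμ _
  have hS1 : 1 ≤ d.Sig d.μ (τ - 1) := by
    rw [Sig_eq hd]; exact one_le_tsum_sigTerm (by linarith) (by linarith) hμ _
  -- As `τ > 1` and `μ < 1`, a geometric series bounds the sum uniformly in `μ`.
  have hS1' : d.Sig d.μ (τ - 1) ≤ (1 - ((ρ - ρinf) / (ρ - 2 * δ - ρinf)) ^ (-(τ - 1)))⁻¹ := by
    rw [Sig_eq hd]; exact tsum_sigTerm_le ha1 (by linarith) hμ (by linarith)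
  have hC2 : d.frakC2Lip = (ρ / δ) ^ (τ + 1)
      * (2 * s ^ 3 * (s - 1) * (1 + s ^ 2) * (γ * δ ^ (τ + 1)) + s ^ 2) * d.Sig d.μ (τ - 1) := by
    rw [← C8Lip_eq hd]; subst hd; rfl
  refine ⟨le_trans ?_ hC, ?_, ?_⟩
  · exact div_le_div_of_nonneg_right (mul_le_mul_of_nonneg_right
      (hL.trans (le_mul_of_one_le_right hL0 hS2)) (by positivity)) hs1.le
  · rw [hC2]; positivity
  · rw [hC2]
    have : 0 ≤ d.Sig d.μ (τ - 1) := by linarith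
    gcongr

end CircleKAM

end

/-! ### The main theorem. -/

open CircleKAM MeasureTheory in
theorem mainTheorem4 (τ : ℝ) (hτ : 1 < τ)
    (ρhat r ρ δ ρinf : ℝ) (hδ : 0 < δ) (hδρ : δ < ρ / 2)
    (hρinf : 0 < ρinf) (hρinfρ : ρinf < ρ - 2 * δ) (hρr : ρ < r) (hr : r ≤ ρhat)
    (s : ℝ) (hs : 1 < s) :
    ∃ K : ℝ, 0 < K ∧
      ∀ (γ : ℝ), 0 < γ → γ < 1 / 2 →
      ∀ (g : ℂ → ℂ), CircleKAM.IsPer ρhat g →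
      ∀ (ε : ℝ), 0 ≤ ε →
      ∀ (c2 c3 : ℝ),
        (∀ z : ℂ, |z.im| < r → ε * ‖iteratedDeriv 2 g z‖ ≤ c2) →
        (∀ z : ℂ, |z.im| < r → ε * ‖iteratedDeriv 3 g z‖ ≤ c3) →
      ∀ (G C₁ C₂ Z : ℝ),
        G = CircleKAM.stripNorm ρ g →
        C₁ = (CircleKAM.perturbativeData r ρ δ ρinf γ τ s c2 c3 (ε * G)).frakC1Lip →
        C₂ = (CircleKAM.perturbativeData r ρ δ ρinf γ τ s c2 c3 (ε * G)).frakC2Lip →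
        Z = CircleKAM.zetaReal τ / CircleKAM.zetaReal (τ + 1) →
        ε * (C₁ * G / (γ ^ 2 * ρ ^ (2 * τ + 2))) < 1 →
        -- the conjugations and the parameters at which they exist
        ∃ (h : ℝ → ℂ → ℂ) (αinf : ℝ → ℝ),
          (∀ θ ∈ CircleKAM.Theta γ τ,
            CircleKAM.IsCircleMap ρinf (h θ) ∧
            (∫ x in (0 : ℝ)..1, (h θ (x : ℂ) - (x : ℂ))) = 0 ∧
            (∀ z : ℂ, |z.im| < ρinf → deriv (h θ) z ≠ 0) ∧
            (∀ z : ℂ, |z.im| ≤ ρinf → |(h θ z).im| < r) ∧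
            (∀ z : ℂ, |z.im| ≤ ρinf →
              CircleKAM.family ε g (αinf θ) (h θ z) = h θ (z + (θ : ℂ)))) ∧
          -- the measure of these parameters
          (1 - ε * (C₂ * G / (γ * ρ ^ (τ + 1))))
              * MeasureTheory.volume.real (CircleKAM.Theta γ τ)
            ≤ MeasureTheory.volume.real (αinf '' CircleKAM.Theta γ τ) ∧
          1 - 2 * γ * Z ≤ MeasureTheory.volume.real (CircleKAM.Theta γ τ) ∧
          (0 ≤ 1 - ε * (C₂ * G / (γ * ρ ^ (τ + 1))) ∨ 0 ≤ 1 - 2 * γ * Z →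
            (1 - ε * (C₂ * G / (γ * ρ ^ (τ + 1)))) * (1 - 2 * γ * Z)
              ≤ MeasureTheory.volume.real (αinf '' CircleKAM.Theta γ τ)) ∧
          -- the asymptotic form
          1 - γ * (C₂ * ρ ^ (τ + 1) / C₁ + 2 * Z)
            < (1 - ε * (C₂ * G / (γ * ρ ^ (τ + 1)))) * (1 - 2 * γ * Z) ∧
          1 - γ * (C₂ * ρ ^ (τ + 1) / C₁ + 2 * Z)
            < MeasureTheory.volume.real (αinf '' CircleKAM.Theta γ τ) ∧
          C₂ * ρ ^ (τ + 1) / C₁ + 2 * Z ≤ K := by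
  have hρ0 : 0 < ρ := by linarith
  have hs1 : 0 < s - 1 := by linarith
  have hZ : 0 < zetaReal τ / zetaReal (τ + 1) :=
    div_pos (zetaReal_pos hτ) (zetaReal_pos (by linarith))
  have hcR : 0 < cRhat τ := by
    have := three_mul_cR_sq_le_cRhat hτ.le
    have := pow_pos (cR_pos (τ := τ) (by linarith)) 2
    linarith
  -- `B₁` bounds `𝕮₁^Lip` from below and `B₂` bounds `𝕮₂^Lip` from above, with `γ` replaced by `1/2`
  -- in the latter; their quotient gives a `K` that depends only on the geometry.
  set B₁ : ℝ := s * ((1 + s) * (1 + s ^ 2) * s) * cRhat τ * (ρ / δ) ^ (2 * τ + 2) / (s - 1)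
    with hB₁
  set B₂ : ℝ := (ρ / δ) ^ (τ + 1)
    * (2 * s ^ 3 * (s - 1) * (1 + s ^ 2) * (1 / 2 * δ ^ (τ + 1)) + s ^ 2)
    * (1 - ((ρ - ρinf) / (ρ - 2 * δ - ρinf)) ^ (-(τ - 1)))⁻¹ with hB₂
  have hB₁0 : 0 < B₁ := by positivity
  have hB₂0 : 0 < B₂ := by
    have ha1 : 1 < (ρ - ρinf) / (ρ - 2 * δ - ρinf) := by
      rw [one_lt_div (by linarith)]; linarith
    have : 0 < 1 - ((ρ - ρinf) / (ρ - 2 * δ - ρinf)) ^ (-(τ - 1)) :=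
      sub_pos.2 (Real.rpow_lt_one_of_one_lt_of_neg ha1 (by linarith))
    positivity
  refine ⟨B₂ * ρ ^ (τ + 1) / B₁ + 2 * (zetaReal τ / zetaReal (τ + 1)), by positivity, ?_⟩
  intro γ hγ hγ' g hg ε hε c2 c3 hc2 hc3 G C₁ C₂ Z hG hC₁ hC₂ hZdef hsmall
  obtain ⟨d, hd⟩ : ∃ d, d = perturbativeData r ρ δ ρinf γ τ s c2 c3 (ε * stripNorm ρ g) :=
    ⟨_, rfl⟩
  rw [hG, ← hd] at hC₁ hC₂
  have hG0 : 0 ≤ G := by rw [hG]; exact stripNorm_nonneg ρ g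
  rw [hZdef]
  have hsmall' : d.frakC1Lip * (ε * stripNorm ρ g) / (γ ^ 2 * ρ ^ (2 * τ + 2)) < 1 := by
    rw [← hG, ← hC₁]
    refine lt_of_eq_of_lt ?_ hsmall
    ring
  have hc20 : 0 ≤ c2 :=
    le_trans (mul_nonneg hε (norm_nonneg _)) (hc2 0 (by simp; linarith))
  obtain ⟨hb₁, hC₂pos, hb₂⟩ := frakC_bounds hd hτ hδ hρinf hρinfρ hρr hs hγ hγ' hc20
    (mul_nonneg hε (stripNorm_nonneg ρ g)) hsmall'
  obtain ⟨h, α, ω, b, hω0, hω2, hb, hωA, hconj⟩ := exists_family hd hτ hδ hρinf hρinfρ hρr hr hs hγ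
    hg hε hc2 hsmall'
  rw [← hC₁] at hb₁
  rw [← hC₂] at hC₂pos hb₂
  have hC₁pos : 0 < C₁ := lt_of_lt_of_le hB₁0 hb₁
  set A : ℝ := ε * (C₂ * G / (γ * ρ ^ (τ + 1))) with hA
  have hA0 : 0 ≤ A := by positivity
  have hωA' : 2 * ω ^ 2 ≤ A := by
    refine hωA.trans (le_of_eq ?_)
    have e : d.frakC2Lip = (ρ / δ) ^ (τ + 1) * d.C8Lip * d.Sig d.μ (τ - 1) := by rw [hd]; rfl
    rw [hA, hC₂, e, hG, Real.div_rpow hρ0.le hδ.le]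
    field_simp
  -- With `ω ≤ 1/2` the second order discrepancy is at most `2 ω² ≤ A`.
  have hc : ω ^ 2 / (1 - ω) ≤ 2 * ω ^ 2 := by
    rw [div_le_iff₀ (by linarith)]; nlinarith [sq_nonneg ω]
  have hc0 : 0 ≤ ω ^ 2 / (1 - ω) := div_nonneg (sq_nonneg ω) (by linarith)
  have hc1 : ω ^ 2 / (1 - ω) < 1 := by nlinarith
  have hvol := volume_real_le_of_abs_sub_le (α := α) hc0 hc1 (volume_Theta_ne_top γ τ)
    fun x hx y hy => (hconj x hx).abs_sub_le (hconj y hy) hρinf (by linarith)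
  have hm0 : 0 ≤ volume.real (α '' Theta γ τ) := measureReal_nonneg
  have hvol' : volume.real (Theta γ τ) ≤ (1 + A) * volume.real (α '' Theta γ τ) :=
    hvol.trans (mul_le_mul_of_nonneg_right (by linarith) hm0)
  have hTheta := le_volume_Theta hγ hγ' hτ
  have hAQ : A < γ * (C₂ * ρ ^ (τ + 1) / C₁) := measure_defect_lt hρ0 hγ hC₁pos hC₂pos hsmall
  have hB0 : 0 ≤ 2 * γ * (zetaReal τ / zetaReal (τ + 1)) := by positivity
  obtain ⟨hmain, h1, h2, h3⟩ := measure_image_bounds hA0 hB0 hAQ hm0 measureReal_nonneg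
    hTheta hvol'
  have e : γ * (C₂ * ρ ^ (τ + 1) / C₁ + 2 * (zetaReal τ / zetaReal (τ + 1)))
      = γ * (C₂ * ρ ^ (τ + 1) / C₁) + 2 * γ * (zetaReal τ / zetaReal (τ + 1)) := by ring
  rw [e]
  refine ⟨h, α, fun θ hθ => ⟨(hconj θ hθ).isCircleMap hρinf (by linarith), (hconj θ hθ).mean,
    fun z hz => (hconj θ hθ).deriv_ne_zero (by linarith) hz,
    fun z hz => (hconj θ hθ).abs_im_lt hb hz, (hconj θ hθ).conj⟩, hmain, hTheta, h1, h2, h3, ?_⟩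
  gcongr
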